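/- Let $n\ge 1$ and let $(N^{2n+1},\varphi,\xi,\eta,g)$ be a strictly regular Sasakian space form of constant $\varphi$-sectional curvature $c$ (with the convention $g(X,\varphi Y)=d\eta(X,Y)=\tfrac12\big(X\eta(Y)-Y\eta(X)-\eta([X,Y])\big)$). Let $\pi:N\to\bar N=N/\xi$ be its Boothby--Wang fibration, that is, the projection onto the $2n$-dimensional orbit space of $\xi$, which carries the manifold structure and the Riemannian metric that make $\pi$ a Riemannian submersion. Let $\bar M^{2n-1}$ be a non-empty (immersed) hypersurface of $\bar N$ with induced metric, second fundamental form $\bar B$ and mean curvature vector field $\bar H=\frac{1}{2n-1}\operatorname{trace}\bar B$, and let $M=\pi^{-1}(\bar M)$ be the Hopf cylinder over $\bar M$, an (immersed) hypersurface of $N$ with induced metric. Suppose that $\|\bar H\|$ is a nonzero constant. Then $M$ is proper-biharmonic in $N$, i.e. its immersion $i:M\to N$ satisfies $$\tau_2(i)=-\Delta^{i}\tau(i)-\operatorname{trace}_{g_M}R^N(di,\tau(i))di=0$$ (where $\tau(i)=\operatorname{trace}_{g_M}\nabla di$, $\Delta^i=-\operatorname{trace}_{g_M}(\nabla^i\nabla^i-\nabla^i_{\nabla})$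 and $R^N(X,Y)=\nabla_X\nabla_Y-\nabla_Y\nabla_X-\nabla_{[X,Y]}$) without $\tau(i)$ vanishing identically, if and only if $$\|\bar B\|^2=\frac{c(n+1)+3n-5}{2}$$ at every point of $\bar M$. -/

import Mathlib

open scoped Manifold ContDiff Bundle
open Bundle

noncomputable section

/-! ## Riemannian geometry on manifolds modelled on `ℝᵐ` -/

/-- The type of smooth Riemannian metrics on an `m`-dimensional manifold `M`. -/
abbrev RiemMetric (m : ℕ) (M : Type*) [TopologicalSpace M]
    [ChartedSpace (EuclideanSpace ℝ (Fin m)) M] [IsManifold (𝓡 m) ∞ M] :=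
  ContMDiffRiemannianMetric (𝓡 m) ∞ (EuclideanSpace ℝ (Fin m))
    (TangentSpace (𝓡 m) : M → Type _)

section Metric

variable {m : ℕ} {M : Type*} [TopologicalSpace M]
  [ChartedSpace (EuclideanSpace ℝ (Fin m)) M] [IsManifold (𝓡 m) ∞ M]

/-- A vector field that is smooth near `x` and takes the value `v` at `x` (the field which is
constant in the local trivialization of the tangent bundle at `x`). -/
def extendVec {x : M} (v : TangentSpace (𝓡 m) x) : (y : M) → TangentSpace (𝓡 m) y :=
  FiberBundle.extend (EuclideanSpace ℝ (Fin m)) v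

/-- The `i`-th vector of a basis of the tangent space at `x` (not orthonormal in general). -/
def tangentBasis (x : M) (i : Fin m) : TangentSpace (𝓡 m) x :=
  (EuclideanSpace.single i 1 : EuclideanSpace ℝ (Fin m))

/-- The matrix `(g_{ij})` of the metric at `x`. -/
def gramMatrix (g : RiemMetric m M) (x : M) : Matrix (Fin m) (Fin m) ℝ :=
  Matrix.of fun i j => g.inner x (tangentBasis x i) (tangentBasis x j)

/-- The trace `∑ g^{ij} b(e_i, e_j)` of a bilinear map `b` on the tangent space with respect to
the metric; it equals `∑ b(E_i, E_i)` for every orthonormal basis `E_i`. -/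
def metricTrace (g : RiemMetric m M) (x : M) {W : Type*} [AddCommGroup W] [Module ℝ W]
    (b : TangentSpace (𝓡 m) x → TangentSpace (𝓡 m) x → W) : W :=
  ∑ i, ∑ j, (gramMatrix g x)⁻¹ i j • b (tangentBasis x i) (tangentBasis x j)

/-- The Koszul expression: for the Levi-Civita connection `∇` it is `g(∇_X Y, Z)` at `x`. -/
def koszul (g : RiemMetric m M) (X Y Z : (y : M) → TangentSpace (𝓡 m) y) (x : M) : ℝ :=
  (1 / 2) *
    (mvfderiv (𝓡 m) (fun y => g.inner y (Y y) (Z y)) x (X x)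
      + mvfderiv (𝓡 m) (fun y => g.inner y (X y) (Z y)) x (Y x)
      - mvfderiv (𝓡 m) (fun y => g.inner y (X y) (Y y)) x (Z x)
      + g.inner x (VectorField.mlieBracket (𝓡 m) X Y x) (Z x)
      - g.inner x (VectorField.mlieBracket (𝓡 m) X Z x) (Y x)
      - g.inner x (VectorField.mlieBracket (𝓡 m) Y Z x) (X x))

/-- The Levi-Civita connection: `leviCivita g Y x v` is `∇_v Y` at the point `x`, the vector
obtained from the Koszul expression by raising an index. -/
def leviCivita (g : RiemMetric m M) (Y : (y : M) → TangentSpace (𝓡 m) y) (x : M)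
    (v : TangentSpace (𝓡 m) x) : TangentSpace (𝓡 m) x :=
  metricTrace g x fun z w => koszul g (extendVec v) Y (extendVec z) x • w

/-- The curvature `R(u, v) w = ∇_U ∇_V W - ∇_V ∇_U W - ∇_{[U, V]} W` at `x`, where `U, V, W` are
local extensions of `u, v, w`. -/
def curvature (g : RiemMetric m M) (x : M) (u v w : TangentSpace (𝓡 m) x) :
    TangentSpace (𝓡 m) x :=
  leviCivita g (fun y => leviCivita g (extendVec w) y (extendVec v y)) x u
    - leviCivita g (fun y => leviCivita g (extendVec w) y (extendVec u y)) x v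
    - leviCivita g (extendVec w) x
        (VectorField.mlieBracket (𝓡 m) (extendVec u) (extendVec v) x)

/-- The sectional curvature of the plane spanned by two linearly independent vectors. -/
def sectionalCurvature (g : RiemMetric m M) (x : M) (u v : TangentSpace (𝓡 m) x) : ℝ :=
  g.inner x (curvature g x u v v) u
    / (g.inner x u u * g.inner x v v - g.inner x u v ^ 2)

end Metric

/-! ## Harmonic and biharmonic maps, isometric immersions -/

section Maps

variable {m k : ℕ} {M : Type*} [TopologicalSpace M]
  [ChartedSpace (EuclideanSpace ℝ (Fin m)) M] [IsManifold (𝓡 m) ∞ M]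
  {N : Type*} [TopologicalSpace N]
  [ChartedSpace (EuclideanSpace ℝ (Fin k)) N] [IsManifold (𝓡 k) ∞ N]

/-- The pull-back connection on `f⁻¹ TN`: `pullbackConnection h f V x v` is `∇^f_v V` at `x`, for a
section `V` of `f⁻¹ TN`. Writing `V = ∑ V^a (E_a ∘ f)` near `x`, where `E_a` is the frame of the
local trivialization of `TN` at `f x`, the first summand is `∑ dV^a(v) E_a` and the second one
is `∑ V^a(x) ∇_{df(v)} E_a`. -/
def pullbackConnection (h : RiemMetric k N) (f : M → N)
    (V : (x : M) → TangentSpace (𝓡 k) (f x)) (x : M) (v : TangentSpace (𝓡 m) x) :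
    TangentSpace (𝓡 k) (f x) :=
  (trivializationAt (EuclideanSpace ℝ (Fin k)) (TangentSpace (𝓡 k) : N → Type _) (f x)).symm (f x)
      (mvfderiv (𝓡 m) (fun y =>
        (trivializationAt (EuclideanSpace ℝ (Fin k)) (TangentSpace (𝓡 k) : N → Type _) (f x)
          (⟨f y, V y⟩ : TangentBundle (𝓡 k) N)).2) x v)
    + leviCivita h (extendVec (V x)) (f x) (mfderiv (𝓡 m) (𝓡 k) f x v)

/-- The second fundamental form `(∇df)(u, v) = ∇^f_u (df(V)) - df(∇_u V)` of a map `f` at `x`, with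
`V` a local extension of `v`. For an isometric immersion this is the usual, normal-valued, second
fundamental form `B(u, v) = (∇^N_u V)^⊥`. -/
def secondFundamentalForm (g : RiemMetric m M) (h : RiemMetric k N) (f : M → N) (x : M)
    (u v : TangentSpace (𝓡 m) x) : TangentSpace (𝓡 k) (f x) :=
  pullbackConnection h f (fun y => mfderiv (𝓡 m) (𝓡 k) f y (extendVec v y)) x u
    - mfderiv (𝓡 m) (𝓡 k) f x (leviCivita g (extendVec v) x u)

/-- The tension field `τ(f) = trace_g ∇df`. -/
def tensionField (g : RiemMetric m M) (h : RiemMetric k N) (f : M → N) (x : M) :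
    TangentSpace (𝓡 k) (f x) :=
  metricTrace g x (secondFundamentalForm g h f x)

/-- The Laplacian `Δ^f V = - trace_g (∇^f ∇^f V - ∇^f_∇ V)` on sections of `f⁻¹ TN`. -/
def roughLaplacian (g : RiemMetric m M) (h : RiemMetric k N) (f : M → N)
    (V : (x : M) → TangentSpace (𝓡 k) (f x)) (x : M) : TangentSpace (𝓡 k) (f x) :=
  - metricTrace g x fun u v =>
      pullbackConnection h f (fun y => pullbackConnection h f V y (extendVec v y)) x u
        - pullbackConnection h f V x (leviCivita g (extendVec v) x u)

/-- The bitension field `τ₂(f) = - Δ^f τ(f) - trace_g R^N(df, τ(f)) df`. -/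
def bitensionField (g : RiemMetric m M) (h : RiemMetric k N) (f : M → N) (x : M) :
    TangentSpace (𝓡 k) (f x) :=
  - roughLaplacian g h f (tensionField g h f) x
    - metricTrace g x fun u v =>
        curvature h (f x) (mfderiv (𝓡 m) (𝓡 k) f x u) (tensionField g h f x)
          (mfderiv (𝓡 m) (𝓡 k) f x v)

/-- Harmonic maps. -/
def IsHarmonicMap (g : RiemMetric m M) (h : RiemMetric k N) (f : M → N) : Prop :=
  ∀ x, tensionField g h f x = 0

/-- Biharmonic maps. -/
def IsBiharmonicMap (g : RiemMetric m M) (h : RiemMetric k N) (f : M → N) : Prop :=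
  ∀ x, bitensionField g h f x = 0

/-- Proper-biharmonic maps: biharmonic and not harmonic. -/
def IsProperBiharmonic (g : RiemMetric m M) (h : RiemMetric k N) (f : M → N) : Prop :=
  IsBiharmonicMap g h f ∧ ¬ IsHarmonicMap g h f

/-- `f : (M, g) → (N, h)` is a smooth isometric immersion (`g` is the metric induced by `f`). -/
structure IsIsometricImmersion (g : RiemMetric m M) (h : RiemMetric k N) (f : M → N) : Prop where
  contMDiff : ContMDiff (𝓡 m) (𝓡 k) ∞ f
  isometric : ∀ (x : M) (u v : TangentSpace (𝓡 m) x),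
    h.inner (f x) (mfderiv (𝓡 m) (𝓡 k) f x u) (mfderiv (𝓡 m) (𝓡 k) f x v) = g.inner x u v

/-- The mean curvature vector field `H = (1/m) trace_g B` of an immersion of an `m`-dimensional
manifold. -/
def meanCurvatureVector (g : RiemMetric m M) (h : RiemMetric k N) (f : M → N) (x : M) :
    TangentSpace (𝓡 k) (f x) :=
  (1 / (m : ℝ)) • metricTrace g x (secondFundamentalForm g h f x)

/-- The mean curvature `‖H‖`. -/
def meanCurvature (g : RiemMetric m M) (h : RiemMetric k N) (f : M → N) (x : M) : ℝ :=
  Real.sqrt (h.inner (f x) (meanCurvatureVector g h f x) (meanCurvatureVector g h f x))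

/-- The squared norm `‖B‖²` of the second fundamental form, that is `∑ |B(E_i, E_j)|²` over an
orthonormal basis. -/
def normSqSecondFundamentalForm (g : RiemMetric m M) (h : RiemMetric k N) (f : M → N)
    (x : M) : ℝ :=
  metricTrace g x fun u u' => metricTrace g x fun v v' =>
    h.inner (f x) (secondFundamentalForm g h f x u v) (secondFundamentalForm g h f x u' v')

end Maps

/-! ## Sasakian space forms -/

section Sasakian

variable {m : ℕ} {N : Type*} [TopologicalSpace N]
  [ChartedSpace (EuclideanSpace ℝ (Fin m)) N] [IsManifold (𝓡 m) ∞ N]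

/-- A vector field is smooth at `x`. -/
def SmoothFieldAt (X : (y : N) → TangentSpace (𝓡 m) y) (x : N) : Prop :=
  ContMDiffAt (𝓡 m) (𝓡 m).tangent ∞ (fun y => (⟨y, X y⟩ : TangentBundle (𝓡 m) N)) x

/-- The exterior derivative of a 1-form,
`dη(X, Y) = (1/2) (X η(Y) - Y η(X) - η([X, Y]))`, with the factor `1/2` that is customary in
contact metric geometry. -/
def extDeriv₁ (η : (y : N) → TangentSpace (𝓡 m) y →L[ℝ] ℝ)
    (X Y : (y : N) → TangentSpace (𝓡 m) y) (x : N) : ℝ :=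
  (1 / 2) * (mvfderiv (𝓡 m) (fun y => η y (Y y)) x (X x)
    - mvfderiv (𝓡 m) (fun y => η y (X y)) x (Y x)
    - η x (VectorField.mlieBracket (𝓡 m) X Y x))

/-- The Nijenhuis tensor
`N_φ(X, Y) = [φX, φY] - φ[φX, Y] - φ[X, φY] + φ²[X, Y]`. -/
def nijenhuis (φ : (y : N) → TangentSpace (𝓡 m) y →L[ℝ] TangentSpace (𝓡 m) y)
    (X Y : (y : N) → TangentSpace (𝓡 m) y) (x : N) : TangentSpace (𝓡 m) x :=
  VectorField.mlieBracket (𝓡 m) (fun y => φ y (X y)) (fun y => φ y (Y y)) x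
    - φ x (VectorField.mlieBracket (𝓡 m) (fun y => φ y (X y)) Y x)
    - φ x (VectorField.mlieBracket (𝓡 m) X (fun y => φ y (Y y)) x)
    + φ x (φ x (VectorField.mlieBracket (𝓡 m) X Y x))

/-- `(φ, ξ, η, g)` is a contact metric structure. -/
structure IsContactMetric
    (φ : (y : N) → TangentSpace (𝓡 m) y →L[ℝ] TangentSpace (𝓡 m) y)
    (ξ : (y : N) → TangentSpace (𝓡 m) y) (η : (y : N) → TangentSpace (𝓡 m) y →L[ℝ] ℝ)
    (g : RiemMetric m N) : Prop where
  smooth_phi : ContMDiff (𝓡 m)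
    ((𝓡 m).prod 𝓘(ℝ, EuclideanSpace ℝ (Fin m) →L[ℝ] EuclideanSpace ℝ (Fin m))) ∞
    (fun y => TotalSpace.mk' (EuclideanSpace ℝ (Fin m) →L[ℝ] EuclideanSpace ℝ (Fin m))
      (E := fun y : N => TangentSpace (𝓡 m) y →L[ℝ] TangentSpace (𝓡 m) y) y (φ y))
  smooth_xi : ∀ x, SmoothFieldAt ξ x
  smooth_eta : ContMDiff (𝓡 m) ((𝓡 m).prod 𝓘(ℝ, EuclideanSpace ℝ (Fin m) →L[ℝ] ℝ)) ∞
    (fun y => TotalSpace.mk' (EuclideanSpace ℝ (Fin m) →L[ℝ] ℝ)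
      (E := fun y : N => TangentSpace (𝓡 m) y →L[ℝ] ℝ) y (η y))
  phi_sq : ∀ (x : N) (u : TangentSpace (𝓡 m) x), φ x (φ x u) = - u + η x u • ξ x
  eta_xi : ∀ x : N, η x (ξ x) = 1
  phi_metric : ∀ (x : N) (u v : TangentSpace (𝓡 m) x),
    g.inner x (φ x u) (φ x v) = g.inner x u v - η x u * η x v
  metric_phi : ∀ (X Y : (y : N) → TangentSpace (𝓡 m) y) (x : N),
    SmoothFieldAt X x → SmoothFieldAt Y x →
      g.inner x (X x) (φ x (Y x)) = extDeriv₁ η X Y x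

/-- `(φ, ξ, η, g)` is a Sasakian structure: a normal contact metric structure. -/
structure IsSasakian
    (φ : (y : N) → TangentSpace (𝓡 m) y →L[ℝ] TangentSpace (𝓡 m) y)
    (ξ : (y : N) → TangentSpace (𝓡 m) y) (η : (y : N) → TangentSpace (𝓡 m) y →L[ℝ] ℝ)
    (g : RiemMetric m N) : Prop extends IsContactMetric φ ξ η g where
  normal : ∀ (X Y : (y : N) → TangentSpace (𝓡 m) y) (x : N),
    SmoothFieldAt X x → SmoothFieldAt Y x →
      nijenhuis φ X Y x + (2 * extDeriv₁ η X Y x) • ξ x = 0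

/-- The `φ`-sectional curvature is constant, equal to `c`: every plane spanned by `u` and `φ u`
with `u` a unit vector orthogonal to `ξ` has sectional curvature `c`. -/
def HasPhiSectionalCurvature
    (φ : (y : N) → TangentSpace (𝓡 m) y →L[ℝ] TangentSpace (𝓡 m) y)
    (ξ : (y : N) → TangentSpace (𝓡 m) y) (g : RiemMetric m N) (c : ℝ) : Prop :=
  ∀ (x : N) (u : TangentSpace (𝓡 m) x), g.inner x u u = 1 → g.inner x u (ξ x) = 0 →
    sectionalCurvature g x u (φ x u) = c

end Sasakian

/-! ## The orbit space, the Boothby-Wang fibration, Hopf cylinders -/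

section Orbits

variable {m : ℕ} {N : Type*} [TopologicalSpace N]
  [ChartedSpace (EuclideanSpace ℝ (Fin m)) N]

/-- `p` and `q` lie on a common integral curve of `ξ`, defined on an open interval. -/
def OnCommonIntegralCurve (ξ : (y : N) → TangentSpace (𝓡 m) y) (p q : N) : Prop :=
  ∃ (γ : ℝ → N) (a b : ℝ), IsMIntegralCurveOn γ ξ (Set.Ioo a b) ∧
    (∃ s ∈ Set.Ioo a b, γ s = p) ∧ (∃ t ∈ Set.Ioo a b, γ t = q)

/-- The equivalence relation whose classes are the (maximal) integral curves of `ξ`. -/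
def orbitSetoid (ξ : (y : N) → TangentSpace (𝓡 m) y) : Setoid N :=
  Relation.EqvGen.setoid (OnCommonIntegralCurve ξ)

/-- The orbit space `N / ξ`, with the quotient topology. -/
def OrbitSpace (ξ : (y : N) → TangentSpace (𝓡 m) y) : Type _ := Quotient (orbitSetoid ξ)

instance (ξ : (y : N) → TangentSpace (𝓡 m) y) : TopologicalSpace (OrbitSpace ξ) :=
  inferInstanceAs (TopologicalSpace (Quotient (orbitSetoid ξ)))

/-- The projection `π : N → N / ξ`. -/
def orbitProj (ξ : (y : N) → TangentSpace (𝓡 m) y) (p : N) : OrbitSpace ξ :=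
  Quotient.mk (orbitSetoid ξ) p

/-- The integral curve of `ξ` through `p`, as a subset of `N`. -/
def orbit (ξ : (y : N) → TangentSpace (𝓡 m) y) (p : N) : Set N :=
  {q | orbitProj ξ q = orbitProj ξ p}

/-- `ξ` is regular: every point has a cubic coordinate neighbourhood through which every integral
curve of `ξ` passes at most once, that is, in which the integral curves are exactly the coordinate
lines of one of the coordinates. -/
def IsRegularField (ξ : (y : N) → TangentSpace (𝓡 m) y) : Prop :=
  ∀ p : N, ∃ e ∈ IsManifold.maximalAtlas (𝓡 m) ∞ N, ∃ (a : ℝ) (i₀ : Fin m),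
    p ∈ e.source ∧ e.target = {z | ∀ i, |z i| < a} ∧
      ∀ q ∈ e.source, ∀ q' ∈ e.source, q' ∈ orbit ξ q ↔ ∀ i, i ≠ i₀ → e q' i = e q i

/-- `ξ` is strictly regular: it is regular and all its integral curves are homeomorphic to each
other. -/
def IsStrictlyRegularField (ξ : (y : N) → TangentSpace (𝓡 m) y) : Prop :=
  IsRegularField ξ ∧ ∀ p q : N, Nonempty (orbit ξ p ≃ₜ orbit ξ q)

/-- The Hopf cylinder `π⁻¹(M̄)` over `ι : M̄ → N / ξ`: the fibre product of `N` and `M̄` over the orbit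
space. If `ι` is the inclusion of an embedded submanifold, its projection to `N` identifies
it with the preimage of that submanifold. -/
def HopfCylinder (ξ : (y : N) → TangentSpace (𝓡 m) y) {Mbar : Type*} [TopologicalSpace Mbar]
    (ι : Mbar → OrbitSpace ξ) : Type _ :=
  {x : N × Mbar // orbitProj ξ x.1 = ι x.2}

instance (ξ : (y : N) → TangentSpace (𝓡 m) y) {Mbar : Type*} [TopologicalSpace Mbar]
    (ι : Mbar → OrbitSpace ξ) : TopologicalSpace (HopfCylinder ξ ι) :=
  inferInstanceAs (TopologicalSpace {x : N × Mbar // orbitProj ξ x.1 = ι x.2})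

/-- The immersion of the Hopf cylinder into `N`. -/
def HopfCylinder.incl (ξ : (y : N) → TangentSpace (𝓡 m) y) {Mbar : Type*} [TopologicalSpace Mbar]
    (ι : Mbar → OrbitSpace ξ) (x : HopfCylinder ξ ι) : N := x.1.1

/-- The projection of the Hopf cylinder to its base `M̄`. -/
def HopfCylinder.base (ξ : (y : N) → TangentSpace (𝓡 m) y) {Mbar : Type*} [TopologicalSpace Mbar]
    (ι : Mbar → OrbitSpace ξ) (x : HopfCylinder ξ ι) : Mbar := x.1.2

end Orbits

section Fibration

variable {m k : ℕ} {N : Type*} [TopologicalSpace N]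
  [ChartedSpace (EuclideanSpace ℝ (Fin m)) N] [IsManifold (𝓡 m) ∞ N]

/-- The smooth structure and the metric `gbar` on the orbit space are the natural ones: `π` is a
smooth submersion (this determines the smooth structure), and it is a Riemannian submersion: `dπ` is
isometric on the horizontal spaces `ker η` (this determines `gbar`). -/
structure IsBoothbyWang (ξ : (y : N) → TangentSpace (𝓡 m) y)
    (η : (y : N) → TangentSpace (𝓡 m) y →L[ℝ] ℝ) (g : RiemMetric m N)
    [ChartedSpace (EuclideanSpace ℝ (Fin k)) (OrbitSpace ξ)] [IsManifold (𝓡 k) ∞ (OrbitSpace ξ)]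
    (gbar : RiemMetric k (OrbitSpace ξ)) : Prop where
  contMDiff : ContMDiff (𝓡 m) (𝓡 k) ∞ (orbitProj ξ)
  submersion : ∀ x : N, Function.Surjective (mfderiv (𝓡 m) (𝓡 k) (orbitProj ξ) x)
  isometric : ∀ (x : N) (u v : TangentSpace (𝓡 m) x), η x u = 0 → η x v = 0 →
    gbar.inner (orbitProj ξ x) (mfderiv (𝓡 m) (𝓡 k) (orbitProj ξ) x u)
      (mfderiv (𝓡 m) (𝓡 k) (orbitProj ξ) x v) = g.inner x u v

end Fibration

end

open scoped Manifold ContDiff Bundle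
open Bundle

noncomputable section

set_option linter.unusedSectionVars false
set_option linter.unusedSimpArgs false
set_option maxSynthPendingDepth 3

/-! ## Vector fields and derivatives in charts -/

/-! For any hypersurface whose tension field `τ` has constant nonzero length, the equation `τ₂ = 0`
reduces to one scalar equation. Since `|τ|` is constant and the codimension is one, `∇τ` is tangent
and given by the second fundamental form `B` (Weingarten). Hence the trace of the Hessian of `τ`,
paired with `τ`, is `-∑ ⟨B(e_i, e_j), τ⟩²`. Its tangential part, by the Ricci identity and constancy
of the trace of the shape operator, equals the curvature sum `∑ ⟨R(e_i, w)τ, e_i⟩`. If this sum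
vanishes and `∑ R(e_i, τ)e_i = -l τ`, then `τ₂ = 0` exactly when `‖B‖² = l`; this is the root-level
`bitens_eq_zero_iff`.

The number `l` comes from the curvature tensor of a Sasakian space form. Normality, `g(·, φ·) = dη`
and the closedness of `dη` give `∇ξ = -φ` (`IsContactAlg.nabla_xi`) and `(∇_u φ)v = g(u, v)ξ -
η(v)u` (`IsContactAlg.nabla_phi`). The Ricci identity then determines `R(u, v)ξ` and how `R(u, v)`
commutes with `φ`. Subtracting the model tensor leaves a Kähler-type tensor that vanishes on
`φ`-sections, hence is zero (`kahler_eq_zero`, `IsSasakian.curv_eq`). The unit normal `ν` of a Hopf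
cylinder is orthogonal to `ξ`, which gives `l = ((c + 3)·2n + 2(c - 1))/4`, and the tangential sum
vanishes (`sum_curv`, `sum_curv_tangent`).

The two second fundamental forms are compared by computing `∇d(π ∘ i) = ∇d(ι ∘ b)` with the
composition formula, where `∇dπ(u, v) = dπ(η(u)φv + η(v)φu)`. On horizontal vectors `B` agrees with
`B̄`, while `⟨B(ξ, u), ν⟩ = -⟨φu, ν⟩`. So the tension fields have equal length, and `‖B‖² = ‖B̄‖² +
2`, one for each mixed block because `|φν| = 1`. Thus the condition is `‖B̄‖² = l - 2 = (c(n+1) + 3n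
- 5)/2`.

Each geometric object is first rewritten as a function with values in the model space and then
computed in a chart, where the connection is `christoffel` and the arguments become calculus with
`fderiv`. -/

/-- The model space `ℝᵐ`. -/
abbrev Model (m : ℕ) := EuclideanSpace ℝ (Fin m)

section Charts

variable {m : ℕ} {M : Type*} [TopologicalSpace M]
  [ChartedSpace (EuclideanSpace ℝ (Fin m)) M] [IsManifold (𝓡 m) ∞ M]

variable (m) in
/-- The chart at `x`, as a partial equivalence with the model space. -/
abbrev crd (x : M) : PartialEquiv M (Model m) := extChartAt (𝓡 m) x

variable (m) in
/-- Coordinates of tangent vectors at `y` in the chart at `x`. -/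
def toCoord (x y : M) : Model m →L[ℝ] Model m := tangentCoordChange (𝓡 m) y x y

variable (m) in
/-- The tangent vector at `y` with given coordinates in the chart at `x`. -/
def ofCoord (x y : M) : Model m →L[ℝ] Model m := tangentCoordChange (𝓡 m) x y y

variable (m) in
lemma mem_crd_source (x : M) : x ∈ (crd m x).source := mem_extChartAt_source x

lemma crd_source_mem_nhds {x y : M} (h : y ∈ (crd m x).source) : (crd m x).source ∈ nhds y :=
  (isOpen_extChartAt_source x).mem_nhds h

variable (m) in
lemma crd_target_isOpen (x : M) : IsOpen (crd m x).target := isOpen_extChartAt_target x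

lemma crd_target_mem_nhds {x y : M} (h : y ∈ (crd m x).source) :
    (crd m x).target ∈ nhds (crd m x y) :=
  (crd_target_isOpen m x).mem_nhds ((crd m x).map_source h)

lemma mem_chartAt_of_mem_crd {x y : M} (h : y ∈ (crd m x).source) : y ∈ (chartAt (Model m) x).source := by
  simpa using h

lemma toCoord_ofCoord {x y : M} (h : y ∈ (crd m x).source) (v : Model m) :
    toCoord m x y (ofCoord m x y v) = v := by
  unfold toCoord ofCoord
  rw [tangentCoordChange_comp ⟨⟨h, mem_crd_source m y⟩, h⟩, tangentCoordChange_self h]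

lemma ofCoord_toCoord {x y : M} (h : y ∈ (crd m x).source) (v : Model m) :
    ofCoord m x y (toCoord m x y v) = v := by
  unfold toCoord ofCoord
  rw [tangentCoordChange_comp ⟨⟨mem_crd_source m y, h⟩, mem_crd_source m y⟩,
    tangentCoordChange_self (mem_crd_source m y)]

variable (m) in
@[simp] lemma toCoord_self (x : M) (v : Model m) : toCoord m x x v = v :=
  tangentCoordChange_self (mem_crd_source m x)

variable (m) in
@[simp] lemma ofCoord_self (x : M) (v : Model m) : ofCoord m x x v = v :=
  tangentCoordChange_self (mem_crd_source m x)

/-- Change of coordinates of tangent vectors, from the chart at `x` to the chart at `x'`. -/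
lemma toCoord_ofCoord_eq_fderiv {x x' y : M} (h : y ∈ (crd m x).source) (h' : y ∈ (crd m x').source)
    (v : Model m) : toCoord m x' y (ofCoord m x y v) = fderiv ℝ (crd m x' ∘ (crd m x).symm) (crd m x y) v := by
  unfold toCoord ofCoord
  rw [tangentCoordChange_comp ⟨⟨h, mem_crd_source m y⟩, h'⟩, tangentCoordChange_def]
  simp [fderivWithin_univ]

lemma contDiffAt_transition {x x' y : M} (h : y ∈ (crd m x).source) (h' : y ∈ (crd m x').source) :
    ContDiffAt ℝ ∞ (crd m x' ∘ (crd m x).symm) (crd m x y) := by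
  have := contDiffWithinAt_ext_coord_change (I := 𝓡 m) (n := ∞) x' x
    (y := crd m x y) ⟨(crd m x).map_source h, by
      change (crd m x).symm (crd m x y) ∈ (crd m x').source
      rwa [(crd m x).left_inv h]⟩
  rwa [ModelWithCorners.range_eq_univ, contDiffWithinAt_univ] at this

lemma trivializationAt_symm {x y : M} (h : y ∈ (crd m x).source) (w : Model m) :
    (trivializationAt (Model m) (TangentSpace (𝓡 m) : M → Type _) x).symm y w = ofCoord m x y w := by
  have := TangentBundle.symmL_trivializationAt_eq_core (I := 𝓡 m) (mem_chartAt_of_mem_crd h)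
  exact (Bundle.Trivialization.symmL_apply (R := ℝ) _ (mem_chartAt_of_mem_crd h) w).symm.trans
    (congrArg (fun L => L w) this)

/-- The extension has constant coefficients in the chart at its base point. Its coordinate
derivative and all brackets of such fields therefore vanish there, which keeps the pointwise
curvature formulas short. -/
lemma extendVec_eq {x y : M} (h : y ∈ (crd m x).source) (v : Model m) :
    (extendVec (x := x) v : (y : M) → TangentSpace (𝓡 m) y) y = ofCoord m x y v := by
  unfold extendVec FiberBundle.extend
  refine (trivializationAt_symm h _).trans (congrArg _ ?_)
  exact toCoord_self m x v

lemma toCoord_eq_mfderiv {x y : M} (h : y ∈ (crd m x).source) :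
    toCoord m x y = mfderiv (𝓡 m) 𝓘(ℝ, Model m) (crd m x) y := by
  rw [← TangentBundle.continuousLinearMapAt_trivializationAt (mem_chartAt_of_mem_crd h),
    TangentBundle.continuousLinearMapAt_trivializationAt_eq_core (mem_chartAt_of_mem_crd h)]
  rfl

lemma ofCoord_eq_mfderiv {x y : M} (h : y ∈ (crd m x).source) :
    ofCoord m x y = mfderiv 𝓘(ℝ, Model m) (𝓡 m) (crd m x).symm (crd m x y) := by
  rw [← mfderivWithin_univ, ← ModelWithCorners.range_eq_univ (𝓡 m),
   ← TangentBundle.symmL_trivializationAt (mem_chartAt_of_mem_crd h),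
    TangentBundle.symmL_trivializationAt_eq_core (mem_chartAt_of_mem_crd h)]
  rfl

lemma mdifferentiableAt_crd_symm {x y : M} (h : y ∈ (crd m x).source) :
    MDifferentiableAt 𝓘(ℝ, Model m) (𝓡 m) (crd m x).symm (crd m x y) := by
  have := mdifferentiableWithinAt_extChartAt_symm (I := 𝓡 m) ((crd m x).map_source h)
  simpa [mdifferentiableWithinAt_univ] using this

/-- Chain rule through the inverse chart; the chart may be centred at any `x` whose domain contains
`y`. -/
lemma mvfderiv_eq {F : Type*} [NormedAddCommGroup F] [NormedSpace ℝ F] {f : M → F} {x y : M}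
    (h : y ∈ (crd m x).source) (hf : MDifferentiableAt (𝓡 m) 𝓘(ℝ, F) f y) (v : Model m) :
    mvfderiv (𝓡 m) f y v = fderiv ℝ (f ∘ (crd m x).symm) (crd m x y) (toCoord m x y v) := by
  have h1 : MDifferentiableAt (𝓡 m) 𝓘(ℝ, F) f ((crd m x).symm (crd m x y)) := by
    rwa [(crd m x).left_inv h]
  have := mfderiv_comp (crd m x y) h1 (mdifferentiableAt_crd_symm h)
  rw [← mfderiv_eq_fderiv, this, ← ofCoord_eq_mfderiv h, (crd m x).left_inv h]
  change _ = mfderiv (𝓡 m) 𝓘(ℝ, F) f y (ofCoord m x y (toCoord m x y v))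
  rw [ofCoord_toCoord h]
  rfl

end Charts

/-! ### Maps, vector fields and Lie brackets read in charts. -/

section Charts

variable {m k : ℕ} {M : Type*} [TopologicalSpace M]
  [ChartedSpace (EuclideanSpace ℝ (Fin m)) M] [IsManifold (𝓡 m) ∞ M]
  {N : Type*} [TopologicalSpace N]
  [ChartedSpace (EuclideanSpace ℝ (Fin k)) N] [IsManifold (𝓡 k) ∞ N]

variable (m k) in
/-- A map between manifolds, read in the charts at `x` and `q`. -/
def crdMap (x : M) (q : N) (f : M → N) : Model m → Model k := crd k q ∘ f ∘ (crd m x).symm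

variable (m) in
/-- A vector field, read in the chart at `x`. -/
def crdField (x : M) (X : M → Model m) : Model m → Model m :=
  fun z => toCoord m x ((crd m x).symm z) (X ((crd m x).symm z))

variable (m) in
/-- The local extension of a tangent vector, as a function with values in the model space. -/
def extVec (x : M) (v : Model m) : M → Model m := extendVec (x := x) v

variable (m) in
/-- Smoothness of a vector field, given as a function with values in the model space. -/
def SmoothVF (X : M → Model m) (y : M) : Prop := SmoothFieldAt (m := m) X y

variable (m) in
/-- The Lie bracket of vector fields, given as functions with values in the model space. -/
def brk (X Y : M → Model m) (y : M) : Model m := VectorField.mlieBracket (𝓡 m) X Y y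

/-- The differential of a map, as a linear map between model spaces. -/
def dmap (f : M → N) (y : M) : Model m →L[ℝ] Model k := mfderiv (𝓡 m) (𝓡 k) f y

lemma crdMap_crd {x y : M} {q : N} {f : M → N} (h : y ∈ (crd m x).source) :
    crdMap m k x q f (crd m x y) = crd k q (f y) := by
  simp only [crdMap, Function.comp_apply, (crd m x).left_inv h]

lemma crdField_crd {x y : M} (X : M → Model m) (h : y ∈ (crd m x).source) :
    crdField m x X (crd m x y) = toCoord m x y (X y) := by
  simp only [crdField]
  rw [(crd m x).left_inv h]

lemma toCoord_mfderiv {x y : M} {q : N} {f : M → N} (h : y ∈ (crd m x).source)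
    (hq : f y ∈ (crd k q).source) (hf : MDifferentiableAt (𝓡 m) (𝓡 k) f y) (v : Model m) :
    toCoord k q (f y) (dmap f y v)
      = fderiv ℝ (crdMap m k x q f) (crd m x y) (toCoord m x y v) := by
  have h2 : MDifferentiableAt (𝓡 k) 𝓘(ℝ, Model k) (crd k q) (f y) :=
    mdifferentiableAt_extChartAt (mem_chartAt_of_mem_crd hq)
  have h3 := mvfderiv_eq h (h2.comp y hf) v
  refine Eq.trans ?_ h3
  refine (congrArg (fun L : Model k →L[ℝ] Model k => L (dmap f y v)) (toCoord_eq_mfderiv hq)).trans ?_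
  exact (congrArg (fun L : Model m →L[ℝ] Model k => L v) (mfderiv_comp y h2 hf)).symm

/-- A map to a vector space is smooth if and only if it is so in a chart. -/
lemma contMDiffAt_iff_crd {F : Type*} [NormedAddCommGroup F] [NormedSpace ℝ F] {f : M → F}
    {x y : M} {n : ℕ∞ω} [IsManifold (𝓡 m) n M] (h : y ∈ (crd m x).source) :
    ContMDiffAt (𝓡 m) 𝓘(ℝ, F) n f y ↔ ContDiffAt ℝ n (f ∘ (crd m x).symm) (crd m x y) := by
  rw [contMDiffAt_iff_source_of_mem_source (mem_chartAt_of_mem_crd h), ModelWithCorners.range_eq_univ,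
    contMDiffWithinAt_univ, contMDiffAt_iff_contDiffAt]

lemma mdifferentiableAt_iff_crd {F : Type*} [NormedAddCommGroup F] [NormedSpace ℝ F] {f : M → F}
    {x y : M} (h : y ∈ (crd m x).source) :
    MDifferentiableAt (𝓡 m) 𝓘(ℝ, F) f y ↔ DifferentiableAt ℝ (f ∘ (crd m x).symm) (crd m x y) := by
  rw [mdifferentiableAt_iff_source_of_mem_source (mem_chartAt_of_mem_crd h), ModelWithCorners.range_eq_univ,
    mdifferentiableWithinAt_univ, mdifferentiableAt_iff_differentiableAt]

lemma contDiffAt_crdMap {x y : M} {q : N} {f : M → N} (h : y ∈ (crd m x).source)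
    (hq : f y ∈ (crd k q).source) (hf : ContMDiffAt (𝓡 m) (𝓡 k) ∞ f y) :
    ContDiffAt ℝ ∞ (crdMap m k x q f) (crd m x y) := by
  have h2 : ContMDiffAt (𝓡 k) 𝓘(ℝ, Model k) ∞ (crd k q) (f y) :=
    contMDiffAt_extChartAt' (mem_chartAt_of_mem_crd hq)
  exact (contMDiffAt_iff_crd h).1 (h2.comp y hf)

lemma smoothVF_iff {X : M → Model m} {x y : M}
    (h : y ∈ (crd m x).source) :
    SmoothVF m X y ↔ ContDiffAt ℝ ∞ (crdField m x X) (crd m x y) := by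
  have key : ∀ X : (y : M) → TangentSpace (𝓡 m) y, SmoothFieldAt X y ↔
      ContDiffAt ℝ ∞ (crdField m x X) (crd m x y) := fun X =>
    ((trivializationAt (Model m) (TangentSpace (𝓡 m) : M → Type _) x).contMDiffAt_section_iff
      (IB := 𝓡 m) (n := ∞) (s := X) (mem_chartAt_of_mem_crd h)).trans (contMDiffAt_iff_crd h)
  exact key X

lemma mdifferentiableAt_field {X : M → Model m} {x y : M}
    (h : y ∈ (crd m x).source) (hX : DifferentiableAt ℝ (crdField m x X) (crd m x y)) :
    MDifferentiableAt (𝓡 m) (𝓡 m).tangent (fun y => (⟨y, X y⟩ : TangentBundle (𝓡 m) M)) y := by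
  have := (trivializationAt (Model m) (TangentSpace (𝓡 m) : M → Type _) x).mdifferentiableAt_section_iff
    (𝓡 m) X (mem_chartAt_of_mem_crd h)
  exact this.2 ((mdifferentiableAt_iff_crd h).2 hX)

lemma extVec_eq {x y : M} (h : y ∈ (crd m x).source) (v : Model m) :
    extVec m x v y = ofCoord m x y v := extendVec_eq h v

lemma extVec_self {y : M} (v : Model m) : extVec m y v y = v :=
  FiberBundle.extend_apply_self (E := (TangentSpace (𝓡 m) : M → Type _)) (Model m) (x := y) v

lemma crdField_extVec_self {x : M} (v : Model m) {z : Model m} (hz : z ∈ (crd m x).target) :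
    crdField m x (extVec m x v) z = v := by
  simp only [crdField]
  rw [extVec_eq ((crd m x).map_target hz), toCoord_ofCoord ((crd m x).map_target hz)]

lemma smoothVF_extVec {y : M} (v : Model m) :
    SmoothVF m (extVec m y v) y := by
  rw [smoothVF_iff (mem_crd_source m y)]
  apply (contDiffAt_const (c := v)).congr_of_eventuallyEq
  filter_upwards [crd_target_mem_nhds (mem_crd_source m y)] with z hz
  exact crdField_extVec_self v hz

lemma differentiableAt_crdField_extVec {x y : M} (h : y ∈ (crd m x).source) (v : Model m) :
    DifferentiableAt ℝ (crdField m x (extVec m y v)) (crd m x y) :=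
  ((smoothVF_iff h).1 (smoothVF_extVec v)).differentiableAt (by simp)

/-- The derivative of the inverse chart is `ofCoord`, whose inverse is `toCoord`; so pulling a field
back along the inverse chart just reads off its coordinates. -/
lemma mpullback_crd_symm (X : (y : M) → TangentSpace (𝓡 m) y) {x : M} {z : Model m}
    (hz : z ∈ (crd m x).target) :
    VectorField.mpullback 𝓘(ℝ, Model m) (𝓡 m) (crd m x).symm X z = crdField m x X z := by
  have hy := (crd m x).map_target hz
  have := ofCoord_eq_mfderiv hy
  rw [(crd m x).right_inv hz] at this
  rw [VectorField.mpullback_apply, ← this]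
  apply (congrArg (fun L : Model m →L[ℝ] Model m => L (X ((crd m x).symm z))))
  apply ContinuousLinearMap.inverse_eq
  · ext v : 1
    exact ofCoord_toCoord hy v
  · ext v : 1
    exact toCoord_ofCoord hy v

lemma mlieBracket_eq_lieBracket (V W : Model m → Model m) (z : Model m) :
    VectorField.mlieBracket 𝓘(ℝ, Model m) V W z = VectorField.lieBracket ℝ V W z := by
  have h := congrFun (VectorField.mlieBracketWithin_eq_lieBracketWithin (𝕜 := ℝ) (V := V) (W := W)
    (s := Set.univ)) z
  exact (congrFun (VectorField.mlieBracketWithin_univ (V := V) (W := W)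
    (I := 𝓘(ℝ, Model m))) z).symm.trans <| h.trans (congrFun VectorField.lieBracketWithin_univ z)

/-- The Lie bracket is natural under pull-back along the inverse chart, and on a vector space it is
the flat formula. -/
lemma toCoord_mlieBracket {X Y : M → Model m} {x y : M}
    (h : y ∈ (crd m x).source) (hX : DifferentiableAt ℝ (crdField m x X) (crd m x y))
    (hY : DifferentiableAt ℝ (crdField m x Y) (crd m x y)) :
    toCoord m x y (brk m X Y y) =
      fderiv ℝ (crdField m x Y) (crd m x y) (toCoord m x y (X y))
        - fderiv ℝ (crdField m x X) (crd m x y) (toCoord m x y (Y y)) := by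
  have h1 := mdifferentiableAt_field h hX
  have h2 := mdifferentiableAt_field h hY
  rw [← (crd m x).left_inv h] at h1 h2
  have h3 : ContMDiffAt 𝓘(ℝ, Model m) (𝓡 m) ∞ (crd m x).symm (crd m x y) := by
    have := contMDiffWithinAt_extChartAt_symm_range (I := 𝓡 m) (n := ∞) x ((crd m x).map_source h)
    rwa [ModelWithCorners.range_eq_univ, contMDiffWithinAt_univ] at this
  have : IsManifold (𝓡 m) (minSmoothness ℝ 2) M := by
    rw [minSmoothness_of_isRCLikeNormedField]; infer_instance
  have h4 := VectorField.mpullback_mlieBracket (n := ∞) h1 h2 h3 (by simp; exact WithTop.coe_le_coe.2 le_top)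
  have h6 := (mpullback_crd_symm (fun y => brk m X Y y) ((crd m x).map_source h)).trans (crdField_crd _ h)
  have e : ∀ X : (y : M) → TangentSpace (𝓡 m) y,
      VectorField.mpullback 𝓘(ℝ, Model m) (𝓡 m) (crd m x).symm X =ᶠ[nhds (crd m x y)]
      crdField m x X := fun X => by
    filter_upwards [crd_target_mem_nhds h] with z hz using mpullback_crd_symm X hz
  have h5 := Filter.EventuallyEq.lieBracket_vectorField_eq (𝕜 := ℝ) (e X) (e Y)
  refine (h6.symm.trans (h4.trans ((mlieBracket_eq_lieBracket _ _ _).trans h5))).trans ?_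
  rw [VectorField.lieBracket_eq]
  simp only [crdField_crd _ h]
  rfl

end Charts

/-! ## Christoffel symbols of a metric on an open subset of a vector space -/

section Christoffel

variable {E : Type*} [NormedAddCommGroup E] [NormedSpace ℝ E]

/-- The Christoffel symbols of the first kind. -/
def christoffelLower (G : E → E →L[ℝ] E →L[ℝ] ℝ) (z : E) : E →L[ℝ] E →L[ℝ] E →L[ℝ] ℝ :=
  (1 / 2 : ℝ) • (fderiv ℝ G z + (fderiv ℝ G z).flip
    - (ContinuousLinearMap.flipₗᵢ ℝ E E ℝ : (E →L[ℝ] E →L[ℝ] ℝ) →L[ℝ] (E →L[ℝ] E →L[ℝ] ℝ)).comp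
        (fderiv ℝ G z).flip)

/-- The Christoffel symbols of the second kind, as a bilinear map. -/
def christoffel (G : E → E →L[ℝ] E →L[ℝ] ℝ) (z : E) : E →L[ℝ] E →L[ℝ] E :=
  (ContinuousLinearMap.compL ℝ E (E →L[ℝ] ℝ) E (G z).inverse).comp (christoffelLower G z)

/-- A smooth Riemannian metric on an open set. -/
structure IsMetricOn (G : E → E →L[ℝ] E →L[ℝ] ℝ) (U : Set E) : Prop where
  isOpen : IsOpen U
  smooth : ContDiffOn ℝ ∞ G U
  symm : ∀ z ∈ U, ∀ u v, G z u v = G z v u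
  pos : ∀ z ∈ U, ∀ u, u ≠ 0 → 0 < G z u u

lemma christoffelLower_apply (G : E → E →L[ℝ] E →L[ℝ] ℝ) (z u v w : E) :
    christoffelLower G z u v w = (1 / 2) *
      (fderiv ℝ G z u v w + fderiv ℝ G z v u w - fderiv ℝ G z w u v) := by
  simp [christoffelLower]

namespace IsMetricOn

variable {G : E → E →L[ℝ] E →L[ℝ] ℝ} {U : Set E} (hG : IsMetricOn G U) {z : E} (hz : z ∈ U)
include hG hz

lemma contDiffAt : ContDiffAt ℝ ∞ G z := hG.smooth.contDiffAt (hG.isOpen.mem_nhds hz)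

lemma differentiableAt : DifferentiableAt ℝ G z := (hG.contDiffAt hz).differentiableAt (by simp)

lemma eq_of_forall {u v : E} (h : ∀ w, G z u w = G z v w) : u = v := by
  by_contra hne
  have := hG.pos z hz (u - v) (sub_ne_zero.2 hne)
  simp [h] at this

lemma fderiv_symm (u v w : E) : fderiv ℝ G z u v w = fderiv ℝ G z u w v := by
  have h := (hG.differentiableAt hz).hasFDerivAt
  have h1 : HasFDerivAt (fun z => G z v w) _ z := (h.clm_apply (hasFDerivAt_const v z)).clm_apply
    (hasFDerivAt_const w z)
  have h2 : HasFDerivAt (fun z => G z w v) _ z := (h.clm_apply (hasFDerivAt_const w z)).clm_apply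
    (hasFDerivAt_const v z)
  have h3 : (fun z => G z v w) =ᶠ[nhds z] fun z => G z w v := by
    filter_upwards [hG.isOpen.mem_nhds hz] with y hy using hG.symm y hy v w
  have := congrArg (fun L => L u) (h1.unique (h2.congr_of_eventuallyEq h3))
  simpa using this

variable [FiniteDimensional ℝ E]

lemma isInvertible : (G z).IsInvertible := by
  have hinj : Function.Injective (G z) := by
    rw [injective_iff_map_eq_zero]
    intro u hu
    exact hG.eq_of_forall hz fun w => by simp [hu]
  have hd : Module.finrank ℝ E = Module.finrank ℝ (E →L[ℝ] ℝ) := by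
    rw [← Module.finrank_linearMap_self ℝ ℝ E]
    exact LinearEquiv.finrank_eq LinearMap.toContinuousLinearMap
  exact ⟨(LinearEquiv.ofInjectiveOfFinrankEq (G z : E →ₗ[ℝ] (E →L[ℝ] ℝ)) hinj hd).toContinuousLinearEquiv,
    by ext; rfl⟩

lemma apply_inverse (α : E →L[ℝ] ℝ) : G z ((G z).inverse α) = α := by
  obtain ⟨e, he⟩ := hG.isInvertible hz
  rw [← he, ContinuousLinearMap.inverse_equiv]
  simp

lemma apply_christoffel (u v w : E) : G z (christoffel G z u v) w = (1 / 2) *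
      (fderiv ℝ G z u v w + fderiv ℝ G z v u w - fderiv ℝ G z w u v) := by
  simp only [christoffel, ContinuousLinearMap.comp_apply, ContinuousLinearMap.compL_apply]
  rw [hG.apply_inverse hz, christoffelLower_apply]

lemma christoffel_symm (u v : E) : christoffel G z u v = christoffel G z v u := by
  apply hG.eq_of_forall hz
  intro w
  rw [hG.apply_christoffel hz, hG.apply_christoffel hz, hG.fderiv_symm hz w u v]
  ring

/-- Compatibility of the metric with its Christoffel symbols. It eliminates every derivative of the
metric in later computations. -/
lemma fderiv_eq (u v w : E) :
    fderiv ℝ G z u v w = G z (christoffel G z u v) w + G z v (christoffel G z u w) := by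
  rw [hG.symm z hz v, hG.apply_christoffel hz, hG.apply_christoffel hz, hG.fderiv_symm hz u w v,
    hG.fderiv_symm hz v u w, hG.fderiv_symm hz w u v]
  ring

lemma contDiffAt_inverse : ContDiffAt ℝ ∞ (fun z => (G z).inverse) z := by
  obtain ⟨e, he⟩ := hG.isInvertible hz
  have := contDiffAt_map_inverse (n := ∞) (𝕜 := ℝ) e
  rw [he] at this
  exact this.comp z (hG.contDiffAt hz)

set_option synthInstance.maxHeartbeats 200000 in
lemma contDiffAt_christoffel : ContDiffAt ℝ ∞ (christoffel G) z := by
  have hD : ContDiffAt ℝ ∞ (fderiv ℝ G) z := (hG.contDiffAt hz).fderiv_right (by simp)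
  have hF : ContDiffAt ℝ ∞ (fun z => (fderiv ℝ G z).flip) z :=
    (ContinuousLinearMap.flipₗᵢ ℝ E E (E →L[ℝ] ℝ)).contDiff.contDiffAt.comp z hD
  have hX : ContDiffAt ℝ ∞ (fun z => (ContinuousLinearMap.flipₗᵢ ℝ E E ℝ :
      (E →L[ℝ] E →L[ℝ] ℝ) →L[ℝ] (E →L[ℝ] E →L[ℝ] ℝ)).comp (fderiv ℝ G z).flip) z :=
    contDiffAt_const.clm_comp hF
  have hL : ContDiffAt ℝ ∞ (christoffelLower G) z :=
    (contDiffAt_const (c := (1 / 2 : ℝ))).smul ((hD.add hF).sub hX)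
  exact ((ContinuousLinearMap.compL ℝ E (E →L[ℝ] ℝ) E).contDiff.contDiffAt.comp z
    (hG.contDiffAt_inverse hz)).clm_comp hL

end IsMetricOn

end Christoffel

/-! ## The metric and the metric trace in a chart -/

/-- Bilinearity of a map of two variables. -/
structure IsBilin {V W : Type*} [AddCommGroup V] [Module ℝ V] [AddCommGroup W] [Module ℝ W]
    (b : V → V → W) : Prop where
  add_left : ∀ u u' v, b (u + u') v = b u v + b u' v
  smul_left : ∀ (a : ℝ) u v, b (a • u) v = a • b u v
  add_right : ∀ u v v', b u (v + v') = b u v + b u v'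
  smul_right : ∀ (a : ℝ) u v, b u (a • v) = a • b u v

namespace IsBilin

variable {V W : Type*} [AddCommGroup V] [Module ℝ V] [AddCommGroup W] [Module ℝ W]
  {b : V → V → W} (hb : IsBilin b)
include hb

lemma sum_sum {ι κ : Type*} (s : Finset ι) (t : Finset κ) (a : ι → ℝ) (c : κ → ℝ) (e : ι → V) (f : κ → V) :
    b (∑ i ∈ s, a i • e i) (∑ j ∈ t, c j • f j) = ∑ i ∈ s, ∑ j ∈ t, (a i * c j) • b (e i) (f j) := by
  let B := LinearMap.mk₂ ℝ b hb.add_left hb.smul_left hb.add_right hb.smul_right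
  change B _ _ = ∑ i ∈ s, ∑ j ∈ t, (a i * c j) • B (e i) (f j)
  simp only [map_sum, LinearMap.sum_apply, map_smul, LinearMap.smul_apply, Finset.smul_sum, mul_smul]
  rw [Finset.sum_comm]
  exact Finset.sum_congr rfl fun i _ => Finset.sum_congr rfl fun j _ => smul_comm _ _ _

end IsBilin

section Metric

variable {m : ℕ} {M : Type*} [TopologicalSpace M]
  [ChartedSpace (EuclideanSpace ℝ (Fin m)) M] [IsManifold (𝓡 m) ∞ M]

/-- The inner product of the tangent space at `y`, as a bilinear form on the model space. -/
def met (g : RiemMetric m M) (y : M) : Model m →L[ℝ] Model m →L[ℝ] ℝ := g.inner y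

lemma met_symm (g : RiemMetric m M) (y : M) (u v : Model m) : met g y u v = met g y v u :=
  g.symm y u v

lemma met_pos (g : RiemMetric m M) (y : M) {u : Model m} (h : u ≠ 0) : 0 < met g y u u :=
  g.pos y u h

lemma met_eq_of_forall (g : RiemMetric m M) (y : M) {u v : Model m}
    (h : ∀ w, met g y u w = met g y v w) : u = v := by
  by_contra hne
  have := met_pos g y (sub_ne_zero.2 hne)
  simp [h] at this

/-- The metric, read in the chart at `x`. -/
def crdMetric (g : RiemMetric m M) (x : M) (z : Model m) : Model m →L[ℝ] Model m →L[ℝ] ℝ :=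
  (met g ((crd m x).symm z)).bilinearComp
    (ofCoord m x ((crd m x).symm z)) (ofCoord m x ((crd m x).symm z))

lemma crdMetric_apply (g : RiemMetric m M) (x : M) (z u v : Model m) :
    crdMetric g x z u v = met g ((crd m x).symm z) (ofCoord m x ((crd m x).symm z) u)
      (ofCoord m x ((crd m x).symm z) v) := rfl

lemma crdMetric_crd (g : RiemMetric m M) {x y : M} (h : y ∈ (crd m x).source) (u v : Model m) :
    crdMetric g x (crd m x y) u v = met g y (ofCoord m x y u) (ofCoord m x y v) := by
  rw [crdMetric_apply, (crd m x).left_inv h]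

lemma crdMetric_toCoord (g : RiemMetric m M) {x y : M} (h : y ∈ (crd m x).source)
    (u v : Model m) :
    crdMetric g x (crd m x y) (toCoord m x y u) (toCoord m x y v) = met g y u v := by
  rw [crdMetric_crd g h, ofCoord_toCoord h, ofCoord_toCoord h]

lemma smoothVF_ofCoord {x y : M} (h : y ∈ (crd m x).source) (a : Model m) :
    SmoothVF m (fun y => ofCoord m x y a) y := by
  refine (smoothVF_iff (X := fun y => ofCoord m x y a) h).2 ?_
  apply (contDiffAt_const (c := a)).congr_of_eventuallyEq
  filter_upwards [crd_target_mem_nhds h] with z hz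
  exact toCoord_ofCoord ((crd m x).map_target hz) a

lemma contDiffOn_crdMetric (g : RiemMetric m M) (x : M) :
    ContDiffOn ℝ ∞ (crdMetric g x) (crd m x).target := by
  rw [contDiffOn_clm_apply]
  intro a
  rw [contDiffOn_clm_apply]
  intro b z hz
  apply ContDiffAt.contDiffWithinAt
  have hy := (crd m x).map_target hz
  have ha := smoothVF_ofCoord hy a
  have hb := smoothVF_ofCoord hy b
  have := ContMDiffAt.clm_bundle_apply₂ (F₁ := Model m) (F₂ := Model m) (F₃ := ℝ)
    (E₃ := fun _ : M => ℝ) g.contMDiff.contMDiffAt ha hb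
  rw [Bundle.contMDiffAt_totalSpace] at this
  have h2 := (contMDiffAt_iff_crd hy).1 this.2
  rw [(crd m x).right_inv hz] at h2
  exact h2

lemma isMetricOn_crdMetric (g : RiemMetric m M) (x : M) :
    IsMetricOn (crdMetric g x) (crd m x).target where
  isOpen := crd_target_isOpen m x
  smooth := contDiffOn_crdMetric g x
  symm z _ u v := met_symm g _ _ _
  pos z hz u hu := by
    rw [crdMetric_apply]
    refine met_pos g _ fun h => hu ?_
    rw [← toCoord_ofCoord ((crd m x).map_target hz) u, h, map_zero]

/-- The metric trace of a map on the model space, regarded as the tangent space at `y`. -/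
def mtr (g : RiemMetric m M) (y : M) {W : Type*} [AddCommGroup W] [Module ℝ W]
    (b : Model m → Model m → W) : W := metricTrace g y b

lemma sum_single (v : Model m) : v = ∑ i, v i • (EuclideanSpace.single i 1 : Model m) := by
  have := (EuclideanSpace.basisFun (Fin m) ℝ).sum_repr v
  simp only [EuclideanSpace.basisFun_repr, EuclideanSpace.basisFun_apply] at this
  exact this.symm

lemma mtr_eq (g : RiemMetric m M) (y : M) {W : Type*} [AddCommGroup W] [Module ℝ W]
    (b : Model m → Model m → W) : mtr g y b = ∑ i, ∑ j, (gramMatrix g y)⁻¹ i j •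
      b (EuclideanSpace.single i 1) (EuclideanSpace.single j 1) := rfl

/-- The metric trace in terms of a pair of dual bases. -/
lemma mtr_eq_sum (g : RiemMetric m M) (y : M) {W : Type*} [AddCommGroup W] [Module ℝ W]
    {b : Model m → Model m → W} (hb : IsBilin b)
    {ι : Type*} [Fintype ι] [DecidableEq ι] (hι : Fintype.card ι = m) {s e : ι → Model m}
    (h : ∀ i j, met g y (e i) (s j) = if i = j then 1 else 0) :
    mtr g y b = ∑ i, b (s i) (e i) := by
  let S : Matrix ι (Fin m) ℝ := Matrix.of fun i a => (s i) a
  let T : Matrix ι (Fin m) ℝ := Matrix.of fun i a => (e i) a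
  have hg : IsBilin fun u v => met g y u v :=
    ⟨by simp, by simp, by simp, by simp⟩
  have hgr : ∀ a b, gramMatrix g y a b = met g y (EuclideanSpace.single a 1)
    (EuclideanSpace.single b 1) := fun a b => rfl
  -- Duality of the two families says `T · (Gram · Sᵀ) = 1`. The matrices are square up to
  -- reindexing, so the factors commute and the inverse Gram matrix is `Sᵀ · T`.
  have h1 : T * (gramMatrix g y * S.transpose) = 1 := by
    ext i j
    rw [Matrix.one_apply, ← h i j, sum_single (e i), sum_single (s j), hg.sum_sum]
    simp only [Matrix.mul_apply, Matrix.transpose_apply, hgr, Matrix.of_apply, T, S, Finset.mul_sum]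
    refine Finset.sum_congr rfl fun a _ => Finset.sum_congr rfl fun b _ => ?_
    simp only [smul_eq_mul]
    ring
  have h2 := (Matrix.mul_eq_one_comm_of_equiv (Fintype.equivFinOfCardEq hι)).1 h1
  rw [Matrix.mul_assoc] at h2
  have h3 := Matrix.inv_eq_right_inv h2
  rw [mtr_eq, h3]
  have h4 : ∀ i, b (s i) (e i) = ∑ a, ∑ c, (S i a * T i c) •
      b (EuclideanSpace.single a 1) (EuclideanSpace.single c 1) := by
    intro i
    conv_lhs => rw [sum_single (s i), sum_single (e i), hb.sum_sum]
    rfl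
  simp only [h4, Matrix.mul_apply, Matrix.transpose_apply, Finset.sum_smul]
  rw [Finset.sum_comm (s := (Finset.univ : Finset ι))]
  refine Finset.sum_congr rfl fun a _ => ?_
  rw [Finset.sum_comm]

end Metric

/-! ### The Levi-Civita connection and the curvature tensor in charts. -/

section LeviCivita

variable {m : ℕ} {M : Type*} [TopologicalSpace M]
  [ChartedSpace (EuclideanSpace ℝ (Fin m)) M] [IsManifold (𝓡 m) ∞ M]

/-- The covariant derivative of a vector field in a chart. -/
def crdCov {E : Type*} [NormedAddCommGroup E] [NormedSpace ℝ E] (G : E → E →L[ℝ] E →L[ℝ] ℝ)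
    (Y : E → E) (z u : E) : E := fderiv ℝ Y z u + christoffel G z u (Y z)

/-- The derivative of the inner product of two vector fields. -/
def dinner (g : RiemMetric m M) (Y Z : M → Model m) (y : M) (v : Model m) : ℝ :=
  mvfderiv (𝓡 m) (fun y => met g y (Y y) (Z y)) y v

/-- The Koszul expression for vector fields with values in the model space. -/
def ksz (g : RiemMetric m M) (X Y Z : M → Model m) (y : M) : ℝ := koszul g X Y Z y

lemma ksz_eq (g : RiemMetric m M) (X Y Z : M → Model m) (y : M) :
    ksz g X Y Z y = (1 / 2) * (dinner g Y Z y (X y) + dinner g X Z y (Y y) - dinner g X Y y (Z y)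
      + met g y (brk m X Y y) (Z y) - met g y (brk m X Z y) (Y y)
      - met g y (brk m Y Z y) (X y)) := rfl

/-- The Levi-Civita connection for vector fields with values in the model space. -/
def lc (g : RiemMetric m M) (Y : M → Model m) (y : M) (v : Model m) : Model m := leviCivita g Y y v

lemma lc_eq (g : RiemMetric m M) (Y : M → Model m) (y : M) (v : Model m) :
    lc g Y y v = mtr g y fun z w => ksz g (extVec m y v) Y (extVec m y z) y • w := rfl

lemma dinner_eq (g : RiemMetric m M) {Y Z : M → Model m} {x y : M} (h : y ∈ (crd m x).source)
    (hY : DifferentiableAt ℝ (crdField m x Y) (crd m x y))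
    (hZ : DifferentiableAt ℝ (crdField m x Z) (crd m x y)) (v : Model m) :
    dinner g Y Z y v =
      crdMetric g x (crd m x y) (crdCov (crdMetric g x) (crdField m x Y) (crd m x y) (toCoord m x y v))
        (toCoord m x y (Z y))
      + crdMetric g x (crd m x y) (toCoord m x y (Y y))
        (crdCov (crdMetric g x) (crdField m x Z) (crd m x y) (toCoord m x y v)) := by
  have hG := isMetricOn_crdMetric g x
  have hz := (crd m x).map_source h
  have e : (fun y => met g y (Y y) (Z y)) ∘ (crd m x).symm =ᶠ[nhds (crd m x y)]
      fun z => crdMetric g x z (crdField m x Y z) (crdField m x Z z) := by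
    filter_upwards [crd_target_mem_nhds h] with z hz
    have := crdMetric_toCoord g ((crd m x).map_target hz) (Y ((crd m x).symm z)) (Z ((crd m x).symm z))
    rw [(crd m x).right_inv hz] at this
    exact this.symm
  have hd := (((hG.differentiableAt hz).hasFDerivAt.clm_apply hY.hasFDerivAt).clm_apply
    hZ.hasFDerivAt).congr_of_eventuallyEq e
  rw [dinner, mvfderiv_eq h ((mdifferentiableAt_iff_crd h).2 hd.differentiableAt), hd.fderiv]
  simp only [crdCov, add_apply, ContinuousLinearMap.comp_apply,
    ContinuousLinearMap.flip_apply, hG.fderiv_eq hz, map_add, crdField_crd _ h]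
  ring

/-- Each derivative of an inner product splits by metric compatibility, each bracket is a difference
of covariant derivatives by symmetry of the Christoffel symbols, and all but one term cancel. -/
lemma ksz_crd (g : RiemMetric m M) {X Y Z : M → Model m} {x y : M} (h : y ∈ (crd m x).source)
    (hX : DifferentiableAt ℝ (crdField m x X) (crd m x y))
    (hY : DifferentiableAt ℝ (crdField m x Y) (crd m x y))
    (hZ : DifferentiableAt ℝ (crdField m x Z) (crd m x y)) :
    ksz g X Y Z y = crdMetric g x (crd m x y)
      (crdCov (crdMetric g x) (crdField m x Y) (crd m x y) (toCoord m x y (X y)))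
      (toCoord m x y (Z y)) := by
  have hG := isMetricOn_crdMetric g x
  have hz := (crd m x).map_source h
  rw [ksz_eq, dinner_eq g h hY hZ, dinner_eq g h hX hZ, dinner_eq g h hX hY]
  simp only [← crdMetric_toCoord g h, toCoord_mlieBracket h hX hY, toCoord_mlieBracket h hX hZ,
    toCoord_mlieBracket h hY hZ, crdCov, crdField_crd _ h, map_add, map_sub,
    add_apply, sub_apply]
  rw [hG.christoffel_symm hz (toCoord m x y (Y y)) (toCoord m x y (X y)),
    hG.christoffel_symm hz (toCoord m x y (Z y)) (toCoord m x y (X y)),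
    hG.christoffel_symm hz (toCoord m x y (Z y)) (toCoord m x y (Y y))]
  simp only [hG.symm _ hz (toCoord m x y (Y y)), hG.symm _ hz (toCoord m x y (X y))]
  ring

/-- The vectors dual to the coordinate basis, with respect to a bilinear form. -/
def dualVec (G : Model m →L[ℝ] Model m →L[ℝ] ℝ) (i : Fin m) : Model m :=
  G.inverse (EuclideanSpace.proj i)

lemma apply_dualVec {G : Model m → Model m →L[ℝ] Model m →L[ℝ] ℝ} {U : Set (Model m)}
    (hG : IsMetricOn G U) {z : Model m} (hz : z ∈ U) (i : Fin m) (w : Model m) :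
    G z (dualVec (G z) i) w = w i := by
  rw [dualVec, hG.apply_inverse hz]
  rfl

/-- The metric trace, in a chart. -/
lemma mtr_crd (g : RiemMetric m M) {x y : M} (h : y ∈ (crd m x).source) {W : Type*}
    [AddCommGroup W] [Module ℝ W] {b : Model m → Model m → W} (hb : IsBilin b) :
    mtr g y b = ∑ i, b (ofCoord m x y (EuclideanSpace.single i 1))
      (ofCoord m x y (dualVec (crdMetric g x (crd m x y)) i)) := by
  refine mtr_eq_sum g y hb (Fintype.card_fin m) fun i j => ?_
  rw [← crdMetric_crd g h, apply_dualVec (isMetricOn_crdMetric g x) ((crd m x).map_source h)]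
  simp

/-- The metric trace in the definition raises the index of the Koszul form, so a vector that
represents this form is the covariant derivative. -/
lemma lc_unique (g : RiemMetric m M) {Y : M → Model m} {y : M} {v w : Model m}
    (h : ∀ z, ksz g (extVec m y v) Y (extVec m y z) y = met g y w z) : lc g Y y v = w := by
  rw [lc_eq]
  simp only [h]
  have hb : IsBilin fun z w' : Model m => met g y w z • w' :=
    ⟨by simp [add_smul], by simp [mul_smul], by simp, fun a u v => smul_comm _ _ _⟩
  rw [mtr_crd g (mem_crd_source m y) hb]
  apply met_eq_of_forall g y
  intro u
  have hG := isMetricOn_crdMetric g y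
  have hz := (crd m y).map_source (mem_crd_source m y)
  have hm : ∀ u v, met g y u v = crdMetric g y (crd m y y) u v := fun u v => by
    rw [crdMetric_crd g (mem_crd_source m y), ofCoord_self, ofCoord_self]
  simp only [ofCoord_self, map_sum, map_smul, hm, sum_apply,
    smul_apply, apply_dualVec hG hz]
  conv_rhs => rw [sum_single u]
  simp only [map_sum, map_smul, smul_eq_mul]
  exact Finset.sum_congr rfl fun i _ => mul_comm _ _

/-- The Levi-Civita connection in a chart. -/
lemma toCoord_lc (g : RiemMetric m M) {Y : M → Model m} {x y : M} (h : y ∈ (crd m x).source)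
    (hY : DifferentiableAt ℝ (crdField m x Y) (crd m x y)) (v : Model m) :
    toCoord m x y (lc g Y y v) =
      crdCov (crdMetric g x) (crdField m x Y) (crd m x y) (toCoord m x y v) := by
  -- The definition uses extensions and a basis centred at `y`, but the Koszul expression may be
  -- evaluated in any chart around `y`; this makes the formula valid for every `x`.
  have h1 : lc g Y y v = ofCoord m x y
      (crdCov (crdMetric g x) (crdField m x Y) (crd m x y) (toCoord m x y v)) := by
    apply lc_unique
    intro z
    rw [ksz_crd g h (differentiableAt_crdField_extVec h v) hY (differentiableAt_crdField_extVec h z),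
      extVec_self, extVec_self, crdMetric_crd g h, ofCoord_toCoord h]
  rw [h1, toCoord_ofCoord h]

lemma crdField_lc (g : RiemMetric m M) {Y V : M → Model m} {x : M} {z : Model m}
    (hz : z ∈ (crd m x).target) (hY : DifferentiableAt ℝ (crdField m x Y) z) :
    crdField m x (fun y => lc g Y y (V y)) z =
      crdCov (crdMetric g x) (crdField m x Y) z (crdField m x V z) := by
  have hy := (crd m x).map_target hz
  rw [← (crd m x).right_inv hz] at hY ⊢
  rw [crdField_crd _ hy, toCoord_lc g hy hY, crdField_crd _ hy]

/-- The curvature tensor of a metric on an open set. -/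
def crdCurv {E : Type*} [NormedAddCommGroup E] [NormedSpace ℝ E] (G : E → E →L[ℝ] E →L[ℝ] ℝ)
    (z u v w : E) : E :=
  fderiv ℝ (christoffel G) z u v w - fderiv ℝ (christoffel G) z v u w
    + christoffel G z u (christoffel G z v w) - christoffel G z v (christoffel G z u w)

/-- The curvature tensor, on the model space. -/
def curv (g : RiemMetric m M) (x : M) (u v w : Model m) : Model m := curvature g x u v w

lemma curv_eq (g : RiemMetric m M) (x : M) (u v w : Model m) : curv g x u v w =
    lc g (fun y => lc g (extVec m x w) y (extVec m x v y)) x u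
    - lc g (fun y => lc g (extVec m x w) y (extVec m x u y)) x v
    - lc g (extVec m x w) x (brk m (extVec m x u) (extVec m x v) x) := rfl

lemma crdField_extVec_eventuallyEq (x : M) (v : Model m) :
    crdField m x (extVec m x v) =ᶠ[nhds (crd m x x)] fun _ => v := by
  filter_upwards [crd_target_mem_nhds (mem_crd_source m x)] with z hz
  exact crdField_extVec_self v hz

lemma fderiv_crdField_extVec (x : M) (v : Model m) :
    fderiv ℝ (crdField m x (extVec m x v)) (crd m x x) = 0 := by
  rw [(crdField_extVec_eventuallyEq x v).fderiv_eq]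
  simp

/-- With extensions constant in the chart at `x`, the bracket term vanishes, and each iterated
derivative is one derivative of `christoffel` plus one quadratic term. -/
lemma curv_crd (g : RiemMetric m M) (x : M) (u v w : Model m) :
    curv g x u v w = crdCurv (crdMetric g x) (crd m x x) u v w := by
  have hx := mem_crd_source m x
  have hz := (crd m x).map_source hx
  have hG := isMetricOn_crdMetric g x
  have hD : HasFDerivAt (christoffel (crdMetric g x)) _ (crd m x x) :=
    ((hG.contDiffAt_christoffel hz).differentiableAt (by simp)).hasFDerivAt
  have hE : ∀ v w, crdField m x (fun y => lc g (extVec m x w) y (extVec m x v y))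
      =ᶠ[nhds (crd m x x)] fun z => christoffel (crdMetric g x) z v w := by
    intro v w
    filter_upwards [crd_target_mem_nhds hx, (crdField_extVec_eventuallyEq x w).eventually_nhds]
      with z hz h2'
    have h2 : crdField m x (extVec m x w) =ᶠ[nhds z] fun _ => w := h2'
    rw [crdField_lc g hz ((differentiableAt_const w).congr_of_eventuallyEq h2), crdCov,
      h2.fderiv_eq, crdField_extVec_self _ hz, crdField_extVec_self _ hz]
    simp
  have hF : ∀ v w, HasFDerivAt (crdField m x (fun y => lc g (extVec m x w) y (extVec m x v y)))
      _ (crd m x x) := fun v w =>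
    ((hD.clm_apply (hasFDerivAt_const v _)).clm_apply (hasFDerivAt_const w _)).congr_of_eventuallyEq (hE v w)
  have h1 : ∀ u v w, lc g (fun y => lc g (extVec m x w) y (extVec m x v y)) x u =
      fderiv ℝ (christoffel (crdMetric g x)) (crd m x x) u v w
      + christoffel (crdMetric g x) (crd m x x) u (christoffel (crdMetric g x) (crd m x x) v w) := by
    intro u v w
    have := toCoord_lc g hx (hF v w).differentiableAt u
    rw [toCoord_self, toCoord_self, crdCov, (hF v w).fderiv, (hE v w).self_of_nhds] at this
    rw [this]
    simp
  have h2 : brk m (extVec m x u) (extVec m x v) x = 0 := by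
    have := toCoord_mlieBracket hx (differentiableAt_crdField_extVec hx u)
      (differentiableAt_crdField_extVec hx v)
    rw [toCoord_self, fderiv_crdField_extVec, fderiv_crdField_extVec] at this
    rw [this]
    simp
  have h3 : lc g (extVec m x w) x 0 = 0 := by
    have := toCoord_lc g hx (differentiableAt_crdField_extVec hx w) 0
    rw [toCoord_self] at this
    rw [this]
    simp [crdCov]
  rw [curv_eq, h1, h1, h2, h3, crdCurv]
  abel

end LeviCivita

/-! ## Fields along maps, second fundamental form and bitension field in charts -/

section Model

variable {E F : Type*} [NormedAddCommGroup E] [NormedSpace ℝ E]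
  [NormedAddCommGroup F] [NormedSpace ℝ F]

/-- The covariant derivative of a vector field `V` along a map `f`, in charts. -/
def crdPbc (H : F → F →L[ℝ] F →L[ℝ] ℝ) (f V : E → F) (z u : E) : F :=
  fderiv ℝ V z u + christoffel H (f z) (fderiv ℝ f z u) (V z)

/-- The second covariant derivative of a map, in charts. -/
def crdSff (G : E → E →L[ℝ] E →L[ℝ] ℝ) (H : F → F →L[ℝ] F →L[ℝ] ℝ) (f : E → F) (z u v : E) : F :=
  fderiv ℝ (fderiv ℝ f) z u v + christoffel H (f z) (fderiv ℝ f z u) (fderiv ℝ f z v)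
    - fderiv ℝ f z (christoffel G z u v)

/-- The second covariant derivative of a vector field `V` along a map `f`, in charts. -/
def crdHess (G : E → E →L[ℝ] E →L[ℝ] ℝ) (H : F → F →L[ℝ] F →L[ℝ] ℝ) (f V : E → F) (z u v : E) : F :=
  fderiv ℝ (fun z => crdPbc H f V z v) z u
    + christoffel H (f z) (fderiv ℝ f z u) (crdPbc H f V z v)
    - crdPbc H f V z (christoffel G z u v)

lemma isBilin_crdSff (G : E → E →L[ℝ] E →L[ℝ] ℝ) (H : F → F →L[ℝ] F →L[ℝ] ℝ) (f : E → F) (z : E) :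
    IsBilin (crdSff G H f z) where
  add_left u u' v := by simp [crdSff]; abel
  smul_left a u v := by simp [crdSff, smul_add, smul_sub]
  add_right u v v' := by simp [crdSff]; abel
  smul_right a u v := by simp [crdSff, smul_add, smul_sub]

end Model

/-- The tension field, in charts. -/
def crdTens {m : ℕ} {F : Type*} [NormedAddCommGroup F] [NormedSpace ℝ F]
    (G : Model m → Model m →L[ℝ] Model m →L[ℝ] ℝ)
    (H : F → F →L[ℝ] F →L[ℝ] ℝ) (f : Model m → F) (z : Model m) : F :=
  ∑ i, crdSff G H f z (EuclideanSpace.single i 1) (dualVec (G z) i)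

section Maps

variable {m k : ℕ} {M : Type*} [TopologicalSpace M]
  [ChartedSpace (EuclideanSpace ℝ (Fin m)) M] [IsManifold (𝓡 m) ∞ M]
  {N : Type*} [TopologicalSpace N]
  [ChartedSpace (EuclideanSpace ℝ (Fin k)) N] [IsManifold (𝓡 k) ∞ N]

variable (m k) in
/-- A vector field along a map, read in charts. -/
def crdAlong (x : M) (q : N) (f : M → N) (V : M → Model k) : Model m → Model k :=
  fun z => toCoord k q (f ((crd m x).symm z)) (V ((crd m x).symm z))

lemma crdAlong_crd {x y : M} (q : N) (f : M → N) (V : M → Model k) (h : y ∈ (crd m x).source) :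
    crdAlong m k x q f V (crd m x y) = toCoord k q (f y) (V y) := by
  simp only [crdAlong]
  rw [(crd m x).left_inv h]

/-- The pull-back connection, for fields with values in the model space. -/
def pbc (h : RiemMetric k N) (f : M → N) (V : M → Model k) (x : M) (v : Model m) : Model k :=
  pullbackConnection (m := m) h f V x v

lemma pbc_eq (h : RiemMetric k N) (f : M → N) (V : M → Model k) (x : M) (v : Model m) :
    pbc h f V x v = mvfderiv (𝓡 m) (fun y => toCoord k (f x) (f y) (V y)) x v
      + lc h (extVec k (f x) (V x)) (f x) (dmap f x v) := by
  exact congrArg (fun w : Model k => w + lc h (extVec k (f x) (V x)) (f x) (dmap f x v))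
    ((trivializationAt_symm (mem_crd_source k (f x)) _).trans (ofCoord_self k _ _))

lemma eventually_mem_source {x y : M} {q : N} {f : M → N} (hy : y ∈ (crd m x).source)
    (hq : f y ∈ (crd k q).source) (hf : ContinuousAt f y) :
    ∀ᶠ z in nhds (crd m x y), z ∈ (crd m x).target ∧ f ((crd m x).symm z) ∈ (crd k q).source := by
  have h1 : ContinuousAt (crd m x).symm (crd m x y) := continuousAt_extChartAt_symm' hy
  have h2 : ContinuousAt (f ∘ (crd m x).symm) (crd m x y) :=
    ContinuousAt.comp (by rwa [(crd m x).left_inv hy]) h1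
  refine Filter.inter_mem (crd_target_mem_nhds hy) (h2.preimage_mem_nhds ?_)
  simp only [Function.comp_apply, (crd m x).left_inv hy]
  exact crd_source_mem_nhds hq

/-- The pull-back connection in charts. -/
lemma toCoord_pbc (h : RiemMetric k N) {f : M → N} {V : M → Model k} {x y : M} {q : N}
    (hy : y ∈ (crd m x).source) (hq : f y ∈ (crd k q).source)
    (hf : ContMDiffAt (𝓡 m) (𝓡 k) ∞ f y)
    (hV : DifferentiableAt ℝ (crdAlong m k x q f V) (crd m x y)) (v : Model m) :
    toCoord k q (f y) (pbc h f V y v) =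
      crdPbc (crdMetric h q) (crdMap m k x q f) (crdAlong m k x q f V) (crd m x y)
        (toCoord m x y v) := by
  have hF : HasFDerivAt (𝕜 := ℝ) (crdMap m k x q f) _ (crd m x y) :=
    ((contDiffAt_crdMap hy hq hf).differentiableAt (by simp)).hasFDerivAt
  -- The pull-back connection at `y` is defined through the frame of the chart at `f y`, whereas the
  -- claim is about the chart at `q`; `κ` is the transition map between them.
  set κ : Model k → Model k := crd k (f y) ∘ (crd k q).symm with hκ
  have hFz : crdMap m k x q f (crd m x y) = crd k q (f y) := crdMap_crd hy
  have hκd' : DifferentiableAt ℝ (fderiv ℝ κ) (crdMap m k x q f (crd m x y)) := by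
    rw [hFz]
    have hκ1 : ContDiffAt ℝ ∞ κ (crd k q (f y)) := contDiffAt_transition hq (mem_crd_source k (f y))
    exact (hκ1.fderiv_right (m := ∞) (by simp)).differentiableAt (by simp)
  have hκd := hκd'.hasFDerivAt
  have e1 : (fun y' => toCoord k (f y) (f y') (V y')) ∘ (crd m x).symm =ᶠ[nhds (crd m x y)]
      fun z => fderiv ℝ κ (crdMap m k x q f z) (crdAlong m k x q f V z) := by
    have h1 : ContinuousAt (crd m x).symm (crd m x y) := continuousAt_extChartAt_symm' hy
    have h2 : ContinuousAt (f ∘ (crd m x).symm) (crd m x y) :=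
      ContinuousAt.comp (by rw [(crd m x).left_inv hy]; exact hf.continuousAt) h1
    filter_upwards [eventually_mem_source hy hq hf.continuousAt,
      eventually_mem_source hy (mem_crd_source k (f y)) hf.continuousAt] with z hz hz'
    simp only [Function.comp_apply, crdMap, crdAlong]
    rw [← toCoord_ofCoord_eq_fderiv hz.2 hz'.2, ofCoord_toCoord hz.2]
  have d1 := ((hκd.comp (crd m x y) hF).clm_apply hV.hasFDerivAt).congr_of_eventuallyEq e1
  set R := crdField k q (extVec k (f y) (V y)) with hR
  have hRd' : DifferentiableAt ℝ R (crdMap m k x q f (crd m x y)) := by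
    rw [hFz]
    exact differentiableAt_crdField_extVec hq (V y)
  have hRd := hRd'.hasFDerivAt
  -- The extension of `V y` is constant in the chart at `f y`. Differentiating this identity
  -- expresses the second derivative of `κ` through the derivative of `R`, which is the
  -- transformation law that makes the two frame-dependent terms cancel.
  have e2 : (fun z => fderiv ℝ κ z (R z)) =ᶠ[nhds (crdMap m k x q f (crd m x y))] fun _ => V y := by
    rw [hFz]
    have h1 : ContinuousAt (crd k q).symm (crd k q (f y)) := continuousAt_extChartAt_symm' hq
    have h2 : (crd k q).symm ⁻¹' (crd k (f y)).source ∈ nhds (crd k q (f y)) := by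
      apply h1.preimage_mem_nhds
      rw [(crd k q).left_inv hq]
      exact crd_source_mem_nhds (mem_crd_source k (f y))
    filter_upwards [h2, crd_target_mem_nhds hq] with z hz hz'
    simp only [hR, crdField]
    rw [← toCoord_ofCoord ((crd k (f y)).map_source hz |> fun _ => hz) (V y)]
    have hs := (crd k q).map_target hz'
    have := toCoord_ofCoord_eq_fderiv hs hz (toCoord k q ((crd k q).symm z)
      (ofCoord k (f y) ((crd k q).symm z) (V y)))
    rw [(crd k q).right_inv hz', ofCoord_toCoord hs, toCoord_ofCoord hz] at this
    rw [extVec_eq hz, toCoord_ofCoord hz]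
    exact this.symm
  have d2 := (hκd.clm_apply hRd).unique ((hasFDerivAt_const (V y) _).congr_of_eventuallyEq e2)
  have hRz : R (crdMap m k x q f (crd m x y)) = crdAlong m k x q f V (crd m x y) := by
    rw [hFz, crdAlong_crd _ _ _ hy, hR, crdField_crd _ hq, extVec_self]
  have hL : ∀ w, toCoord k q (f y) (fderiv ℝ κ (crdMap m k x q f (crd m x y)) w) = w := by
    intro w
    rw [hFz, hκ, ← toCoord_ofCoord_eq_fderiv hq (mem_crd_source k (f y)), toCoord_self,
      toCoord_ofCoord hq]
  have hlc := toCoord_lc h hq (differentiableAt_crdField_extVec hq (V y)) (dmap f y v)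
  rw [toCoord_mfderiv hy hq (hf.mdifferentiableAt (by simp)), crdCov, crdField_crd _ hq, extVec_self,
    ← hFz, ← hR, ← crdAlong_crd q f V hy] at hlc
  rw [pbc_eq, map_add, hlc, mvfderiv_eq hy ((mdifferentiableAt_iff_crd hy).2 d1.differentiableAt),
    d1.fderiv, crdPbc]
  have d3 := congrArg (fun L : Model k →L[ℝ] Model k => toCoord k q (f y)
    (L (fderiv ℝ (crdMap m k x q f) (crd m x y) (toCoord m x y v)))) d2
  simp only [add_apply, ContinuousLinearMap.comp_apply, ContinuousLinearMap.flip_apply, map_add, hL,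
    hRz, Function.comp_apply, zero_apply, map_zero] at d3 ⊢
  rw [← add_assoc]
  congr 1
  rw [eq_neg_of_add_eq_zero_left d3]
  abel

lemma crdAlong_pbc (h : RiemMetric k N) {f : M → N} {V : M → Model k} {Y : M → Model m} {x : M} {q : N}
    {z : Model m} (hz : z ∈ (crd m x).target) (hq : f ((crd m x).symm z) ∈ (crd k q).source)
    (hf : ContMDiff (𝓡 m) (𝓡 k) ∞ f)
    (hV : DifferentiableAt ℝ (crdAlong m k x q f V) z) :
    crdAlong m k x q f (fun y => pbc h f V y (Y y)) z =
      crdPbc (crdMetric h q) (crdMap m k x q f) (crdAlong m k x q f V) z (crdField m x Y z) := by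
  have hy := (crd m x).map_target hz
  rw [← (crd m x).right_inv hz] at hV ⊢
  rw [crdAlong_crd _ _ _ hy, toCoord_pbc h hy hq hf.contMDiffAt hV, crdField_crd _ hy]

/-- The second fundamental form, for vectors in the model space. -/
def sff (g : RiemMetric m M) (h : RiemMetric k N) (f : M → N) (x : M) (u v : Model m) : Model k :=
  secondFundamentalForm g h f x u v

lemma sff_eq (g : RiemMetric m M) (h : RiemMetric k N) (f : M → N) (x : M) (u v : Model m) :
    sff g h f x u v = pbc h f (fun y => dmap f y (extVec m x v y)) x u
      - dmap f x (lc g (extVec m x v) x u) := rfl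

/-- The second fundamental form in charts. -/
lemma toCoord_sff (g : RiemMetric m M) (h : RiemMetric k N) {f : M → N} {x y : M} {q : N}
    (hy : y ∈ (crd m x).source) (hq : f y ∈ (crd k q).source)
    (hf : ContMDiff (𝓡 m) (𝓡 k) ∞ f) (u v : Model m) :
    toCoord k q (f y) (sff g h f y u v) =
      crdSff (crdMetric g x) (crdMetric h q) (crdMap m k x q f) (crd m x y)
        (toCoord m x y u) (toCoord m x y v) := by
  have hXd := differentiableAt_crdField_extVec hy v
  have hF := contDiffAt_crdMap hy hq hf.contMDiffAt
  have hDF := ((hF.fderiv_right (m := ∞) (by simp)).differentiableAt (by simp)).hasFDerivAt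
  have e1 : crdAlong m k x q f (fun y' => dmap f y' (extVec m y v y')) =ᶠ[nhds (crd m x y)]
      fun z => fderiv ℝ (crdMap m k x q f) z (crdField m x (extVec m y v) z) := by
    filter_upwards [eventually_mem_source hy hq hf.continuous.continuousAt] with z hz
    have hs := (crd m x).map_target hz.1
    simp only [crdAlong]
    rw [toCoord_mfderiv hs hz.2 (hf.mdifferentiableAt (by simp)), (crd m x).right_inv hz.1]
    rfl
  have d1 := (hDF.clm_apply hXd.hasFDerivAt).congr_of_eventuallyEq e1
  rw [sff_eq, map_sub, toCoord_pbc h hy hq hf.contMDiffAt d1.differentiableAt,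
    toCoord_mfderiv hy hq (hf.mdifferentiableAt (by simp)), toCoord_lc g hy hXd, crdPbc, d1.fderiv,
    e1.self_of_nhds, crdField_crd _ hy, extVec_self, crdSff, crdCov, crdField_crd _ hy, extVec_self]
  simp only [add_apply, ContinuousLinearMap.comp_apply, ContinuousLinearMap.flip_apply, map_add,
    crdField_crd _ hy, extVec_self]
  abel

/-- The second fundamental form in the preferred charts. -/
lemma sff_crd (g : RiemMetric m M) (h : RiemMetric k N) {f : M → N} (hf : ContMDiff (𝓡 m) (𝓡 k) ∞ f)
    (x : M) (u v : Model m) : sff g h f x u v =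
      crdSff (crdMetric g x) (crdMetric h (f x)) (crdMap m k x (f x) f) (crd m x x) u v := by
  have := toCoord_sff g h (mem_crd_source m x) (mem_crd_source k (f x)) hf u v
  rwa [toCoord_self, toCoord_self, toCoord_self] at this

lemma isBilin_sff (g : RiemMetric m M) (h : RiemMetric k N) {f : M → N}
    (hf : ContMDiff (𝓡 m) (𝓡 k) ∞ f) (x : M) : IsBilin (sff g h f x) := by
  have : sff g h f x = crdSff (crdMetric g x) (crdMetric h (f x)) (crdMap m k x (f x) f) (crd m x x) := by
    ext1 u
    ext1 v
    exact sff_crd g h hf x u v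
  rw [this]
  exact isBilin_crdSff _ _ _ _

/-- The tension field, with values in the model space. -/
def tens (g : RiemMetric m M) (h : RiemMetric k N) (f : M → N) (x : M) : Model k :=
  tensionField g h f x

lemma tens_eq (g : RiemMetric m M) (h : RiemMetric k N) (f : M → N) (x : M) :
    tens g h f x = mtr g x (sff g h f x) := rfl

/-- The tension field in charts. -/
lemma toCoord_tens (g : RiemMetric m M) (h : RiemMetric k N) {f : M → N} {x y : M} {q : N}
    (hy : y ∈ (crd m x).source) (hq : f y ∈ (crd k q).source) (hf : ContMDiff (𝓡 m) (𝓡 k) ∞ f) :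
    toCoord k q (f y) (tens g h f y) =
      crdTens (crdMetric g x) (crdMetric h q) (crdMap m k x q f) (crd m x y) := by
  rw [tens_eq, mtr_crd g hy (isBilin_sff g h hf y), map_sum, crdTens]
  refine Finset.sum_congr rfl fun i _ => ?_
  rw [toCoord_sff g h hy hq hf, toCoord_ofCoord hy, toCoord_ofCoord hy]

lemma crdAlong_tens (g : RiemMetric m M) (h : RiemMetric k N) {f : M → N} {x : M} {q : N}
    {z : Model m} (hz : z ∈ (crd m x).target) (hq : f ((crd m x).symm z) ∈ (crd k q).source)
    (hf : ContMDiff (𝓡 m) (𝓡 k) ∞ f) : crdAlong m k x q f (tens g h f) z =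
      crdTens (crdMetric g x) (crdMetric h q) (crdMap m k x q f) z := by
  have := toCoord_tens g h ((crd m x).map_target hz) hq hf
  rw [(crd m x).right_inv hz] at this
  exact this

/-- The second covariant derivative of a vector field along a map. -/
def hess (g : RiemMetric m M) (h : RiemMetric k N) (f : M → N) (V : M → Model k) (x : M)
    (u v : Model m) : Model k :=
  pbc h f (fun y => pbc h f V y (extVec m x v y)) x u - pbc h f V x (lc g (extVec m x v) x u)

/-- The bitension field, with values in the model space. -/
def bitens (g : RiemMetric m M) (h : RiemMetric k N) (f : M → N) (x : M) : Model k :=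
  bitensionField g h f x

lemma bitens_eq (g : RiemMetric m M) (h : RiemMetric k N) (f : M → N) (x : M) :
    bitens g h f x = mtr g x (hess g h f (tens g h f) x) - mtr g x fun u v =>
      curv h (f x) (dmap f x u) (tens g h f x) (dmap f x v) := by
  have : bitens g h f x = - - mtr g x (hess g h f (tens g h f) x) - mtr g x fun u v =>
      curv h (f x) (dmap f x u) (tens g h f x) (dmap f x v) := rfl
  rw [this, neg_neg]

/-- The second covariant derivative in charts. -/
lemma hess_crd (g : RiemMetric m M) (h : RiemMetric k N) {f : M → N} {V : M → Model k} {x : M}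
    (hf : ContMDiff (𝓡 m) (𝓡 k) ∞ f)
    (hV : ContDiffAt ℝ ∞ (crdAlong m k x (f x) f V) (crd m x x)) (u v : Model m) :
    hess g h f V x u v = crdHess (crdMetric g x) (crdMetric h (f x)) (crdMap m k x (f x) f)
      (crdAlong m k x (f x) f V) (crd m x x) u v := by
  have hx := mem_crd_source m x
  have hq := mem_crd_source k (f x)
  have hF := contDiffAt_crdMap hx hq hf.contMDiffAt
  have hz := (crd m x).map_source hx
  have hH := isMetricOn_crdMetric h (f x)
  have hΓ : ContDiffAt ℝ ∞ (fun z => christoffel (crdMetric h (f x)) (crdMap m k x (f x) f z))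
      (crd m x x) := by
    apply ContDiffAt.comp (g := christoffel (crdMetric h (f x))) (crd m x x) _ hF
    rw [crdMap_crd hx]
    exact hH.contDiffAt_christoffel ((crd k (f x)).map_source hq)
  have hP : ContDiffAt ℝ ∞ (fun z => crdPbc (crdMetric h (f x)) (crdMap m k x (f x) f)
      (crdAlong m k x (f x) f V) z v) (crd m x x) :=
    ((hV.fderiv_right (m := ∞) (by simp)).clm_apply contDiffAt_const).add
      ((hΓ.clm_apply ((hF.fderiv_right (m := ∞) (by simp)).clm_apply contDiffAt_const)).clm_apply hV)
  -- The outer derivative needs the inner one on a whole neighbourhood, so the chart formula for the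
  -- pull-back connection is used near `x` and not only at `x`.
  have e1 : crdAlong m k x (f x) f (fun y => pbc h f V y (extVec m x v y)) =ᶠ[nhds (crd m x x)]
      fun z => crdPbc (crdMetric h (f x)) (crdMap m k x (f x) f) (crdAlong m k x (f x) f V) z v := by
    filter_upwards [eventually_mem_source hx hq hf.continuous.continuousAt,
      (hV.of_le (m := 1) (WithTop.coe_le_coe.2 le_top)).eventually (by simp)] with z hz h1
    rw [crdAlong_pbc h hz.1 hz.2 hf (h1.differentiableAt (by simp)), crdField_extVec_self v hz.1]
  have hd := (hP.differentiableAt (by simp)).congr_of_eventuallyEq e1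
  have h1 := toCoord_pbc h hx hq hf.contMDiffAt hd u
  have h2 := toCoord_pbc h hx hq hf.contMDiffAt (hV.differentiableAt (by simp))
    (lc g (extVec m x v) x u)
  have h3 := toCoord_lc g hx (differentiableAt_crdField_extVec hx v) u
  rw [toCoord_self, toCoord_self, crdCov, fderiv_crdField_extVec, crdField_extVec_self v hz, zero_apply,
    zero_add] at h3
  rw [toCoord_self, toCoord_self, crdPbc, e1.fderiv_eq, e1.self_of_nhds] at h1
  rw [toCoord_self, toCoord_self, h3] at h2
  rw [hess, h1, h3, h2, crdHess]

lemma dmap_crd {f : M → N} (hf : ContMDiff (𝓡 m) (𝓡 k) ∞ f) (x : M) :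
    dmap f x = fderiv ℝ (crdMap m k x (f x) f) (crd m x x) := by
  ext1 v
  have := toCoord_mfderiv (mem_crd_source m x) (mem_crd_source k (f x))
    (hf.mdifferentiableAt (by simp)) v
  rwa [toCoord_self, toCoord_self] at this

lemma met_crd (g : RiemMetric m M) (x : M) : met g x = crdMetric g x (crd m x x) := by
  ext u v
  rw [crdMetric_crd g (mem_crd_source m x), ofCoord_self, ofCoord_self]

end Maps

/-! ## Riemannian geometry of maps between open subsets of vector spaces -/

section Model

variable {E F K : Type*} [NormedAddCommGroup E] [NormedSpace ℝ E] [FiniteDimensional ℝ E]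
  [NormedAddCommGroup F] [NormedSpace ℝ F] [FiniteDimensional ℝ F]
  [NormedAddCommGroup K] [NormedSpace ℝ K]
  {G : E → E →L[ℝ] E →L[ℝ] ℝ} {H : F → F →L[ℝ] F →L[ℝ] ℝ} {L : K → K →L[ℝ] K →L[ℝ] ℝ}
  {U : Set E} {W : Set F} {f V V' : E → F} {h : F → K} {z : E}

/-- Metric compatibility of the pull-back connection. The derivative is stated existentially so that
it can be compared, by uniqueness, with the derivative of a known function. -/
lemma hasFDerivAt_inner_along (hH : IsMetricOn H W) (hz : f z ∈ W) (hf : DifferentiableAt ℝ f z)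
    (hV : DifferentiableAt ℝ V z) (hV' : DifferentiableAt ℝ V' z) :
    ∃ A : E →L[ℝ] ℝ, HasFDerivAt (fun z => H (f z) (V z) (V' z)) A z ∧ ∀ u, A u =
      H (f z) (crdPbc H f V z u) (V' z) + H (f z) (V z) (crdPbc H f V' z u) := by
  refine ⟨_, (((hH.differentiableAt hz).hasFDerivAt.comp z hf.hasFDerivAt).clm_apply
    hV.hasFDerivAt).clm_apply hV'.hasFDerivAt, fun u => ?_⟩
  simp only [add_apply, ContinuousLinearMap.comp_apply, ContinuousLinearMap.flip_apply,
    Function.comp_apply, hH.fderiv_eq hz, crdPbc, map_add]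
  ring

/-- The Gauss formula: the derivative of a tangent field splits into the second fundamental form and
the intrinsic derivative. It holds for every `G`, since the two terms with `G` cancel. -/
lemma crdPbc_fderiv (hf : ContDiffAt ℝ 2 f z) (G : E → E →L[ℝ] E →L[ℝ] ℝ) (u v : E) :
    crdPbc H f (fun z => fderiv ℝ f z v) z u
      = crdSff G H f z u v + fderiv ℝ f z (christoffel G z u v) := by
  have h1 := ((hf.fderiv_right (m := 1) (by norm_num)).differentiableAt (by simp)).hasFDerivAt.clm_apply
    (hasFDerivAt_const v z)
  rw [crdPbc, crdSff, h1.fderiv]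
  simp

lemma differentiableAt_fderiv_apply (hf : ContDiffAt ℝ 2 f z) (v : E) :
    DifferentiableAt ℝ (fun z => fderiv ℝ f z v) z :=
  ((hf.fderiv_right (m := 1) (by norm_num)).differentiableAt (by simp)).clm_apply
    (differentiableAt_const v)

lemma snd_fderiv_symm (hf : ContDiffAt ℝ 2 f z) (u v : E) :
    fderiv ℝ (fderiv ℝ f) z u v = fderiv ℝ (fderiv ℝ f) z v u :=
  (hf.isSymmSndFDerivAt (by simp)).eq u v

lemma crdSff_symm (hG : IsMetricOn G U) (hH : IsMetricOn H W) (hz : z ∈ U) (hfz : f z ∈ W)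
    (hf : ContDiffAt ℝ 2 f z) (u v : E) : crdSff G H f z u v = crdSff G H f z v u := by
  rw [crdSff, crdSff, snd_fderiv_symm hf, hH.christoffel_symm hfz, hG.christoffel_symm hz]

/-- The covariant derivative of the pull-back of a metric. -/
lemma inner_crdSff_add (hH : IsMetricOn H W) (hfz : f z ∈ W) (hf : ContDiffAt ℝ 2 f z)
    (G : E → E →L[ℝ] E →L[ℝ] ℝ)
    {S : E → ℝ} {v w : E} (hS : ∀ᶠ z in nhds z, H (f z) (fderiv ℝ f z v) (fderiv ℝ f z w) = S z) (u : E) :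
    H (f z) (crdSff G H f z u v) (fderiv ℝ f z w) + H (f z) (fderiv ℝ f z v) (crdSff G H f z u w)
      = fderiv ℝ S z u - H (f z) (fderiv ℝ f z (christoffel G z u v)) (fderiv ℝ f z w)
        - H (f z) (fderiv ℝ f z v) (fderiv ℝ f z (christoffel G z u w)) := by
  obtain ⟨A, hA, hA'⟩ := hasFDerivAt_inner_along hH hfz (hf.differentiableAt (by simp))
    (differentiableAt_fderiv_apply hf v) (differentiableAt_fderiv_apply hf w)
  have hS' : S =ᶠ[nhds z] fun z => H (f z) (fderiv ℝ f z v) (fderiv ℝ f z w) :=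
    hS.mono fun z hz => hz.symm
  rw [hS'.fderiv_eq, hA.fderiv, hA', crdPbc_fderiv hf G, crdPbc_fderiv hf G]
  simp only [map_add, add_apply]
  ring

/-- The second fundamental form of an isometric immersion takes values in the normal bundle. -/
lemma inner_crdSff_eq_zero (hG : IsMetricOn G U) (hH : IsMetricOn H W) (hz : z ∈ U) (hfz : f z ∈ W)
    (hf : ContDiffAt ℝ 2 f z)
    (hS : ∀ᶠ z in nhds z, ∀ v w, H (f z) (fderiv ℝ f z v) (fderiv ℝ f z w) = G z v w) (u v w : E) :
    H (f z) (crdSff G H f z u v) (fderiv ℝ f z w) = 0 := by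
  -- Since the pull-back of `H` is the parallel metric `G`, the trilinear form `⟨B(u, v), df w⟩` is
  -- skew in `v, w`. It is also symmetric in `u, v`, and such a form vanishes.
  have key : ∀ u v w, H (f z) (crdSff G H f z u v) (fderiv ℝ f z w)
      + H (f z) (crdSff G H f z u w) (fderiv ℝ f z v) = 0 := by
    intro u v w
    have h1 := inner_crdSff_add hH hfz hf G (hS.mono fun z hz => hz v w) u
    have h2 : HasFDerivAt (fun z => G z v w) _ z := ((hG.differentiableAt hz).hasFDerivAt.clm_apply
      (hasFDerivAt_const v z)).clm_apply (hasFDerivAt_const w z)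
    rw [hS.self_of_nhds, hS.self_of_nhds, h2.fderiv, hH.symm _ hfz (fderiv ℝ f z v)] at h1
    simp [hG.fderiv_eq hz] at h1
    linarith
  have hs := crdSff_symm (G := G) (H := H) hG hH hz hfz hf
  have h1 := key u v w
  have h2 := key v w u
  have h3 := key w u v
  rw [hs v u] at h2
  rw [hs w u, hs w v] at h3
  linarith

/-- The second covariant derivative of a composition. -/
lemma crdSff_comp (hf : ContDiffAt ℝ 2 f z) (hh : ContDiffAt ℝ 2 h (f z)) (u v : E) :
    crdSff G L (h ∘ f) z u v = fderiv ℝ h (f z) (crdSff G H f z u v)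
      + crdSff H L h (f z) (fderiv ℝ f z u) (fderiv ℝ f z v) := by
  have e1 : fderiv ℝ (h ∘ f) =ᶠ[nhds z] fun z => (fderiv ℝ h (f z)).comp (fderiv ℝ f z) := by
    filter_upwards [hf.eventually (by simp), hf.continuousAt.eventually (hh.eventually (by simp))]
      with y h1 h2
    exact fderiv_comp y (h2.differentiableAt (by simp)) (h1.differentiableAt (by simp))
  have d1 := ((hh.fderiv_right (m := 1) (by norm_num)).differentiableAt (by simp)).hasFDerivAt.comp z
    (hf.differentiableAt (by simp)).hasFDerivAt
  have d2 := ((hf.fderiv_right (m := 1) (by norm_num)).differentiableAt (by simp)).hasFDerivAt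
  have d3 := (d1.clm_comp d2).congr_of_eventuallyEq e1
  rw [crdSff, d3.fderiv, e1.self_of_nhds]
  simp only [crdSff, add_apply, ContinuousLinearMap.comp_apply, map_add, map_sub, Function.comp_apply,
    ContinuousLinearMap.compL_apply, ContinuousLinearMap.flip_apply]
  abel

/-- The expanded second derivative, from which the Ricci identity follows: the symmetric second
derivatives cancel under exchange of `u` and `v`, leaving the curvature. -/
lemma hasFDerivAt_crdPbc_apply (hH : IsMetricOn H W) (hfz : f z ∈ W) (hf : ContDiffAt ℝ 2 f z)
    (hV : ContDiffAt ℝ 2 V z) (v : E) :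
    ∃ A : E →L[ℝ] F, HasFDerivAt (fun z => crdPbc H f V z v) A z ∧ ∀ u, A u =
      fderiv ℝ (fderiv ℝ V) z u v
      + fderiv ℝ (christoffel H) (f z) (fderiv ℝ f z u) (fderiv ℝ f z v) (V z)
      + christoffel H (f z) (fderiv ℝ (fderiv ℝ f) z u v) (V z)
      + christoffel H (f z) (fderiv ℝ f z v) (fderiv ℝ V z u) := by
  have d1 := ((hH.contDiffAt_christoffel hfz).differentiableAt (by simp)).hasFDerivAt.comp z
    (hf.differentiableAt (by simp)).hasFDerivAt
  have d2 := ((hf.fderiv_right (m := 1) (by norm_num)).differentiableAt (by simp)).hasFDerivAt.clm_apply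
    (hasFDerivAt_const v z)
  have d3 := ((hV.fderiv_right (m := 1) (by norm_num)).differentiableAt (by simp)).hasFDerivAt.clm_apply
    (hasFDerivAt_const v z)
  have d4 := (hV.differentiableAt (by simp)).hasFDerivAt
  refine ⟨_, d3.add ((d1.clm_apply d2).clm_apply d4), fun u => ?_⟩
  simp only [add_apply, ContinuousLinearMap.comp_apply, ContinuousLinearMap.flip_apply,
    Function.comp_apply, zero_apply, map_zero, zero_add]
  abel

/-- The Ricci identity for a vector field along a map. -/
lemma crdHess_sub (hG : IsMetricOn G U) (hH : IsMetricOn H W) (hz : z ∈ U) (hfz : f z ∈ W)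
    (hf : ContDiffAt ℝ 2 f z) (hV : ContDiffAt ℝ 2 V z) (u v : E) :
    crdHess G H f V z u v - crdHess G H f V z v u =
      crdCurv H (f z) (fderiv ℝ f z u) (fderiv ℝ f z v) (V z) := by
  obtain ⟨A, hA, hA'⟩ := hasFDerivAt_crdPbc_apply hH hfz hf hV v
  obtain ⟨B, hB, hB'⟩ := hasFDerivAt_crdPbc_apply hH hfz hf hV u
  rw [crdHess, crdHess, hA.fderiv, hB.fderiv, hA', hB', hG.christoffel_symm hz v u,
    snd_fderiv_symm hV v u, snd_fderiv_symm hf v u, crdCurv]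
  simp only [crdPbc, map_add]
  abel

end Model

namespace IsBilin

variable {V W : Type*} [AddCommGroup V] [Module ℝ V] [AddCommGroup W] [Module ℝ W]
  {b : V → V → W}

lemma neg_right (hb : IsBilin b) (u v : V) : b u (-v) = - b u v := by
  rw [← neg_one_smul ℝ v, hb.smul_right, neg_one_smul]

lemma sum_left {ι : Type*} (hb : IsBilin b) (s : Finset ι) (e : ι → V) (v : V) :
    b (∑ i ∈ s, e i) v = ∑ i ∈ s, b (e i) v :=
  map_sum (LinearMap.mk₂ ℝ b hb.add_left hb.smul_left hb.add_right hb.smul_right |>.flip v) e s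

lemma sum_right {ι : Type*} (hb : IsBilin b) (s : Finset ι) (u : V) (e : ι → V) :
    b u (∑ i ∈ s, e i) = ∑ i ∈ s, b u (e i) :=
  map_sum (LinearMap.mk₂ ℝ b hb.add_left hb.smul_left hb.add_right hb.smul_right u) e s

end IsBilin

/-! ### Differentiating a metric trace. -/

section Trace

variable {m : ℕ} {G : Model m → Model m →L[ℝ] Model m →L[ℝ] ℝ} {U : Set (Model m)} {z : Model m}

lemma contDiffAt_dualVec (hG : IsMetricOn G U) (hz : z ∈ U) (i : Fin m) :
    ContDiffAt ℝ ∞ (fun z => dualVec (G z) i) z :=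
  (hG.contDiffAt_inverse hz).clm_apply contDiffAt_const

/-- Differentiate the defining relation `G (dualVec i) v = v i` and eliminate the derivative of `G`
by metric compatibility. -/
lemma fderiv_dualVec (hG : IsMetricOn G U) (hz : z ∈ U) (i : Fin m) (w v : Model m) :
    G z (fderiv ℝ (fun z => dualVec (G z) i) z w) v
      = - G z (christoffel G z w (dualVec (G z) i)) v - christoffel G z w v i := by
  have d1 := ((contDiffAt_dualVec hG hz i).differentiableAt (by simp)).hasFDerivAt
  have d2 := ((hG.differentiableAt hz).hasFDerivAt.clm_apply d1).clm_apply (hasFDerivAt_const v z)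
  have e : (fun z => G z (dualVec (G z) i) v) =ᶠ[nhds z] fun _ => v i := by
    filter_upwards [hG.isOpen.mem_nhds hz] with y hy using apply_dualVec hG hy i v
  have := congrArg (fun L => L w) (d2.unique ((hasFDerivAt_const (v i) z).congr_of_eventuallyEq e))
  have h0 : (0 : Model m →L[ℝ] Model m) w = 0 := rfl
  have h1 : (0 : Model m →L[ℝ] ℝ) w = 0 := rfl
  simp only [add_apply, ContinuousLinearMap.comp_apply, ContinuousLinearMap.flip_apply,
    hG.fderiv_eq hz, apply_dualVec hG hz, h0, h1, PiLp.zero_apply] at this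
  linarith

/-- The metric trace commutes with covariant derivatives. -/
lemma fderiv_trace (hG : IsMetricOn G U) (hz : z ∈ U) {T : Model m → Model m → Model m → ℝ}
    {T' : Model m → Model m → Model m →L[ℝ] ℝ}
    (hT : ∀ᶠ z in nhds z, IsBilin (T z)) (hT' : ∀ u v, HasFDerivAt (fun z => T z u v) (T' u v) z)
    (w : Model m) :
    fderiv ℝ (fun z => ∑ i, T z (EuclideanSpace.single i 1) (dualVec (G z) i)) z w =
      ∑ i, (T' (EuclideanSpace.single i 1) (dualVec (G z) i) w
        - T z (christoffel G z w (EuclideanSpace.single i 1)) (dualVec (G z) i)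
        - T z (EuclideanSpace.single i 1) (christoffel G z w (dualVec (G z) i))) := by
  set e : Fin m → Model m := fun i => EuclideanSpace.single i 1 with he
  set s : Fin m → Model m → Model m := fun i z => dualVec (G z) i with hs
  -- Differentiability of `T` is known only for fixed arguments, so the moving dual vector is
  -- expanded in the fixed coordinate basis.
  have hex : ∀ z, IsBilin (T z) → ∀ u v, T z u v = ∑ j, v j • T z u (e j) := by
    intro z hb u v
    conv_lhs => rw [sum_single v]
    rw [hb.sum_right]
    exact Finset.sum_congr rfl fun j _ => hb.smul_right _ _ _
  have hb := hT.self_of_nhds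
  have hT'v : ∀ u v, T' u v w = ∑ j, v j • T' u (e j) w := by
    intro u v
    have h1 : HasFDerivAt (fun z => ∑ j, v j • T z u (e j)) (∑ j, v j • T' u (e j)) z :=
      HasFDerivAt.fun_sum fun j _ => (hT' u (e j)).const_smul (v j)
    have h2 := (hT' u v).unique (h1.congr_of_eventuallyEq (hT.mono fun z hz => hex z hz u v))
    rw [h2]
    simp
  have ds := fun i => ((contDiffAt_dualVec hG hz i).differentiableAt (by simp)).hasFDerivAt
  have dF : HasFDerivAt (fun z => ∑ i, ∑ j, s i z j • T z (e i) (e j))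
      (∑ i, ∑ j, (s i z j • T' (e i) (e j) +
        ((PiLp.proj (𝕜 := ℝ) 2 (fun _ : Fin m => ℝ) j).comp (fderiv ℝ (s i) z)).smulRight (T z (e i) (e j)))) z := by
    refine HasFDerivAt.fun_sum fun i _ => HasFDerivAt.fun_sum fun j _ => ?_
    exact HasFDerivAt.fun_smul (((PiLp.proj (𝕜 := ℝ) 2 (fun _ : Fin m => ℝ) j).hasFDerivAt).comp z (ds i)) (hT' (e i) (e j))
  have heq : (fun z => ∑ i, T z (e i) (s i z)) =ᶠ[nhds z]
      fun z => ∑ i, ∑ j, s i z j • T z (e i) (e j) :=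
    hT.mono fun z hz => Finset.sum_congr rfl fun i _ => hex z hz _ _
  rw [heq.fderiv_eq, dF.fderiv]
  have hA : ∀ i, fderiv ℝ (s i) z w = - christoffel G z w (s i z)
      - ∑ j, christoffel G z w (e j) i • s j z := by
    intro i
    apply hG.eq_of_forall hz
    intro v
    rw [fderiv_dualVec hG hz]
    simp only [map_sub, map_neg, sub_apply, neg_apply, map_sum, map_smul, sum_apply, smul_apply, hs,
      apply_dualVec hG hz, smul_eq_mul]
    congr 1
    conv_lhs => rw [sum_single v]
    simp [mul_comm, he]
  have hTs : ∀ i, T z (e i) (fderiv ℝ (s i) z w) = - T z (e i) (christoffel G z w (s i z))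
      - ∑ j, christoffel G z w (e j) i • T z (e i) (s j z) := by
    intro i
    rw [hA, sub_eq_add_neg, hb.add_right, hb.neg_right, hb.neg_right, hb.sum_right, sub_eq_add_neg]
    simp only [hb.smul_right]
  -- The part of the derivative of the dual basis that involves the coordinate basis becomes, after
  -- exchanging the sums, the Christoffel correction in the first argument of `T`.
  have hsw : ∑ i, ∑ j, christoffel G z w (e j) i • T z (e i) (s j z)
      = ∑ j, T z (christoffel G z w (e j)) (s j z) := by
    rw [Finset.sum_comm]
    refine Finset.sum_congr rfl fun j _ => ?_
    conv_rhs => rw [sum_single (christoffel G z w (e j))]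
    rw [hb.sum_left]
    exact Finset.sum_congr rfl fun i _ => (hb.smul_left _ _ _).symm
  simp only [Finset.sum_sub_distrib]
  rw [← hsw]
  have h3 : ∀ i, (∑ j, (s i z j • T' (e i) (e j) +
        ((PiLp.proj (𝕜 := ℝ) 2 (fun _ : Fin m => ℝ) j).comp (fderiv ℝ (s i) z)).smulRight (T z (e i) (e j)))) w
        = T' (e i) (s i z) w + T z (e i) (fderiv ℝ (s i) z w) := by
    intro i
    rw [hT'v, hex z hb _ (fderiv ℝ (s i) z w), ← Finset.sum_add_distrib]
    simp
  rw [sum_apply, Finset.sum_congr rfl fun i _ => h3 i]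
  simp only [hTs, Finset.sum_add_distrib, Finset.sum_sub_distrib, Finset.sum_neg_distrib]
  ring

end Trace

/-! ## Hypersurfaces of constant mean curvature -/

section Cmc

variable {m : ℕ} {F : Type*} [NormedAddCommGroup F] [NormedSpace ℝ F] [FiniteDimensional ℝ F]

/-- `f` is, near `z`, an isometric immersion of codimension one whose tension field `V` has
constant nonzero length. -/
structure IsCmcNear (G : Model m → Model m →L[ℝ] Model m →L[ℝ] ℝ) (U : Set (Model m))
    (H : F → F →L[ℝ] F →L[ℝ] ℝ) (W : Set F) (f V : Model m → F) (z : Model m) : Prop where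
  metric_dom : IsMetricOn G U
  metric_cod : IsMetricOn H W
  mem_dom : z ∈ U
  mem_cod : f z ∈ W
  contDiffAt : ContDiffAt ℝ ∞ f z
  contDiffAt_field : ContDiffAt ℝ ∞ V z
  isometric : ∀ᶠ z in nhds z, ∀ v w, H (f z) (fderiv ℝ f z v) (fderiv ℝ f z w) = G z v w
  field_eq : ∀ᶠ z in nhds z, V z = crdTens G H f z
  const : ∃ C, ∀ᶠ z in nhds z, H (f z) (V z) (V z) = C
  ne_zero : V z ≠ 0
  codim_one : ∀ a, (∀ w, H (f z) a (fderiv ℝ f z w) = 0) → H (f z) a (V z) = 0 → a = 0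

namespace IsCmcNear

variable {G : Model m → Model m →L[ℝ] Model m →L[ℝ] ℝ} {U : Set (Model m)}
  {H : F → F →L[ℝ] F →L[ℝ] ℝ} {W : Set F} {f V : Model m → F} {z : Model m}

lemma contDiffAt_two (h : IsCmcNear G U H W f V z) : ContDiffAt ℝ 2 f z :=
  h.contDiffAt.of_le (WithTop.coe_le_coe.2 le_top)

lemma contDiffAt_field_two (h : IsCmcNear G U H W f V z) : ContDiffAt ℝ 2 V z :=
  h.contDiffAt_field.of_le (WithTop.coe_le_coe.2 le_top)

lemma eventually_smooth (h : IsCmcNear G U H W f V z) :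
    ∀ᶠ z in nhds z, z ∈ U ∧ f z ∈ W ∧ ContDiffAt ℝ 2 f z ∧ ContDiffAt ℝ 2 V z := by
  filter_upwards [h.metric_dom.isOpen.mem_nhds h.mem_dom,
    h.contDiffAt.continuousAt (h.metric_cod.isOpen.mem_nhds h.mem_cod),
    h.contDiffAt_two.eventually (by simp), h.contDiffAt_field_two.eventually (by simp)]
    with y h1 h2 h3 h4 using ⟨h1, h2, h3, h4⟩

lemma eventually_normal (h : IsCmcNear G U H W f V z) :
    ∀ᶠ z in nhds z, ∀ u v w, H (f z) (crdSff G H f z u v) (fderiv ℝ f z w) = 0 := by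
  filter_upwards [h.eventually_smooth, h.isometric.eventually_nhds] with y h1 h2
  exact inner_crdSff_eq_zero h.metric_dom h.metric_cod h1.1 h1.2.1 h1.2.2.1 h2

lemma eventually_field_normal (h : IsCmcNear G U H W f V z) :
    ∀ᶠ z in nhds z, ∀ w, H (f z) (V z) (fderiv ℝ f z w) = 0 := by
  filter_upwards [h.eventually_normal, h.field_eq] with y h1 h2 w
  simp [h2, crdTens, h1]

/-- Constant length of `V`: its covariant derivative is orthogonal to it. -/
lemma eventually_pbc_field (h : IsCmcNear G U H W f V z) :
    ∀ᶠ z in nhds z, ∀ u, H (f z) (crdPbc H f V z u) (V z) = 0 := by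
  obtain ⟨C, hC⟩ := h.const
  filter_upwards [h.eventually_smooth, hC.eventually_nhds] with y h1 h2 u
  obtain ⟨A, hA, hA'⟩ := hasFDerivAt_inner_along h.metric_cod h1.2.1
    (h1.2.2.1.differentiableAt (by simp)) (h1.2.2.2.differentiableAt (by simp))
    (h1.2.2.2.differentiableAt (by simp))
  have h3 := hA.unique ((hasFDerivAt_const C y).congr_of_eventuallyEq h2)
  have h4 := hA' u
  rw [h3, h.metric_cod.symm _ h1.2.1 (V y)] at h4
  have h5 : (0 : Model m →L[ℝ] ℝ) u = 0 := rfl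
  linarith

/-- The Weingarten equation, from differentiating the orthogonality of `V` to the image of `df`. -/
lemma eventually_pbc_tangent (h : IsCmcNear G U H W f V z) :
    ∀ᶠ z in nhds z, ∀ u w, H (f z) (crdPbc H f V z u) (fderiv ℝ f z w)
      = - H (f z) (V z) (crdSff G H f z u w) := by
  filter_upwards [h.eventually_smooth, h.eventually_field_normal.eventually_nhds] with y h1 h2 u w
  obtain ⟨A, hA, hA'⟩ := hasFDerivAt_inner_along h.metric_cod h1.2.1
    (h1.2.2.1.differentiableAt (by simp)) (h1.2.2.2.differentiableAt (by simp))
    (differentiableAt_fderiv_apply h1.2.2.1 w)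
  have h3 := hA.unique ((hasFDerivAt_const 0 y).congr_of_eventuallyEq (h2.mono fun z hz => hz w))
  have h4 := hA' u
  rw [h3, crdPbc_fderiv h1.2.2.1 G, map_add, h2.self_of_nhds] at h4
  have h5 : (0 : Model m →L[ℝ] ℝ) u = 0 := rfl
  linarith

lemma differentiableAt_pbc (h : IsCmcNear G U H W f V z) (v : Model m) :
    DifferentiableAt ℝ (fun z => crdPbc H f V z v) z :=
  let ⟨_, hA, _⟩ := hasFDerivAt_crdPbc_apply h.metric_cod h.mem_cod h.contDiffAt_two
    h.contDiffAt_field_two v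
  hA.differentiableAt

/-- Obtained by differentiating `⟨∇_v V, V⟩ = 0` once more. -/
lemma inner_hess_field (h : IsCmcNear G U H W f V z) (u v : Model m) :
    H (f z) (crdHess G H f V z u v) (V z) =
      - H (f z) (crdPbc H f V z u) (crdPbc H f V z v) := by
  obtain ⟨A, hA, hA'⟩ := hasFDerivAt_inner_along h.metric_cod h.mem_cod
    (h.contDiffAt.differentiableAt (by simp)) (h.differentiableAt_pbc v)
    (h.contDiffAt_field.differentiableAt (by simp))
  have h3 := hA.unique ((hasFDerivAt_const 0 z).congr_of_eventuallyEq
    (h.eventually_pbc_field.mono fun z hz => hz v))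
  have h4 := hA' u
  have h5 : (0 : Model m →L[ℝ] ℝ) u = 0 := rfl
  have h6 := h.eventually_pbc_field.self_of_nhds (christoffel G z u v)
  have h7 : crdHess G H f V z u v = crdPbc H f (fun z => crdPbc H f V z v) z u
    - crdPbc H f V z (christoffel G z u v) := rfl
  rw [h3, h.metric_cod.symm _ h.mem_cod (crdPbc H f V z v)] at h4
  rw [h7, map_sub, sub_apply]
  linarith

/-- In codimension one the nonzero normal field `V` spans the normal space. -/
lemma crdSff_eq_smul (h : IsCmcNear G U H W f V z) (u v : Model m) :
    ∃ a : ℝ, crdSff G H f z u v = a • V z := by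
  have hp := h.metric_cod.pos _ h.mem_cod _ h.ne_zero
  refine ⟨H (f z) (crdSff G H f z u v) (V z) / H (f z) (V z) (V z), sub_eq_zero.1 ?_⟩
  apply h.codim_one
  · intro w
    simp [h.eventually_normal.self_of_nhds, h.eventually_field_normal.self_of_nhds]
  · simp [hp.ne']

/-- In the product rule, the normal component of the derivative of `df w` is a multiple of `V`,
hence orthogonal to `∇_v V`; only the Christoffel part survives. -/
lemma hasFDerivAt_inner_pbc (h : IsCmcNear G U H W f V z) (v w : Model m) :
    ∃ A : Model m →L[ℝ] ℝ, HasFDerivAt (fun z => H (f z) (crdPbc H f V z v) (fderiv ℝ f z w)) A z ∧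
      ∀ u, A u = H (f z) (crdHess G H f V z u v) (fderiv ℝ f z w)
        + H (f z) (crdPbc H f V z (christoffel G z u v)) (fderiv ℝ f z w)
        + H (f z) (crdPbc H f V z v) (fderiv ℝ f z (christoffel G z u w)) := by
  obtain ⟨A, hA, hA'⟩ := hasFDerivAt_inner_along h.metric_cod h.mem_cod
    (h.contDiffAt.differentiableAt (by simp)) (h.differentiableAt_pbc v)
    (differentiableAt_fderiv_apply h.contDiffAt_two w)
  refine ⟨A, hA, fun u => ?_⟩
  have h7 : crdPbc H f (fun z => crdPbc H f V z v) z u = crdHess G H f V z u v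
    + crdPbc H f V z (christoffel G z u v) := (sub_add_cancel _ _).symm
  obtain ⟨a, ha⟩ := h.crdSff_eq_smul u w
  rw [hA', h7, crdPbc_fderiv h.contDiffAt_two G, ha]
  simp [h.eventually_pbc_field.self_of_nhds]

lemma eventually_inner_pbc_symm (h : IsCmcNear G U H W f V z) :
    ∀ᶠ z in nhds z, ∀ v w, H (f z) (crdPbc H f V z v) (fderiv ℝ f z w) =
      H (f z) (crdPbc H f V z w) (fderiv ℝ f z v) := by
  filter_upwards [h.eventually_smooth, h.eventually_pbc_tangent] with y h1 h2 v w
  rw [h2, h2, crdSff_symm h.metric_dom h.metric_cod h1.1 h1.2.1 h1.2.2.1]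

/-- The shape form `⟨∇_v V, df w⟩` is symmetric, hence so is its covariant derivative in the
direction `u`. -/
lemma inner_hess_tangent_symm (h : IsCmcNear G U H W f V z) (u v w : Model m) :
    H (f z) (crdHess G H f V z u v) (fderiv ℝ f z w) =
      H (f z) (crdHess G H f V z u w) (fderiv ℝ f z v) := by
  obtain ⟨A, hA, hA'⟩ := h.hasFDerivAt_inner_pbc v w
  obtain ⟨B, hB, hB'⟩ := h.hasFDerivAt_inner_pbc w v
  have h3 := hA.unique (hB.congr_of_eventuallyEq
    (h.eventually_inner_pbc_symm.mono fun z hz => hz v w))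
  have h4 := hA' u
  have hs := h.eventually_inner_pbc_symm.self_of_nhds
  rw [h3, hB', hs w, hs _ v] at h4
  linarith

lemma isBilin_inner_pbc (H : F → F →L[ℝ] F →L[ℝ] ℝ) (f V : Model m → F) (z : Model m) :
    IsBilin fun v w => H (f z) (crdPbc H f V z v) (fderiv ℝ f z w) where
  add_left u u' v := by simp [crdPbc]; ring
  smul_left a u v := by simp [crdPbc]; ring
  add_right u v v' := by simp
  smul_right a u v := by simp

/-- The trace of `⟨∇V, df⟩` is `-⟨V, τ⟩ = -|V|²`, a constant, and the trace commutes with covariant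
differentiation. -/
lemma sum_inner_hess (h : IsCmcNear G U H W f V z) (u : Model m) :
    ∑ i, H (f z) (crdHess G H f V z u (EuclideanSpace.single i 1))
      (fderiv ℝ f z (dualVec (G z) i)) = 0 := by
  choose A hA hA' using h.hasFDerivAt_inner_pbc
  have h1 := fderiv_trace h.metric_dom h.mem_dom
    (Filter.Eventually.of_forall fun z => isBilin_inner_pbc H f V z) hA u
  obtain ⟨C, hC⟩ := h.const
  have h2 : (fun z => ∑ i, H (f z) (crdPbc H f V z (EuclideanSpace.single i 1))
      (fderiv ℝ f z (dualVec (G z) i))) =ᶠ[nhds z] fun _ => - C := by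
    filter_upwards [hC, h.field_eq, h.eventually_pbc_tangent] with y h1 h2 h3
    simp only [h3, Finset.sum_neg_distrib]
    rw [← map_sum, ← crdTens, ← h2, h1]
  rw [h2.fderiv_eq, fderiv_const_apply] at h1
  have h5 : (0 : Model m →L[ℝ] ℝ) u = 0 := rfl
  rw [h5] at h1
  rw [h1]
  refine Finset.sum_congr rfl fun i _ => ?_
  rw [hA']
  ring

/-- The tangential part of the Laplacian of the tension field. -/
lemma sum_inner_hess_tangent (h : IsCmcNear G U H W f V z) (w : Model m) :
    ∑ i, H (f z) (crdHess G H f V z (EuclideanSpace.single i 1) (dualVec (G z) i)) (fderiv ℝ f z w)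
      = ∑ i, H (f z) (crdCurv H (f z) (fderiv ℝ f z (EuclideanSpace.single i 1)) (fderiv ℝ f z w)
        (V z)) (fderiv ℝ f z (dualVec (G z) i)) := by
  -- The vanishing trace is subtracted after swapping the last two arguments of the Hessian; what
  -- remains is the antisymmetrised Hessian, a curvature term by the Ricci identity. This is the
  -- traced Codazzi equation.
  rw [← sub_zero (∑ i, _), ← h.sum_inner_hess w, ← Finset.sum_sub_distrib]
  refine Finset.sum_congr rfl fun i _ => ?_
  rw [h.inner_hess_tangent_symm, ← crdHess_sub h.metric_dom h.metric_cod h.mem_dom h.mem_cod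
    h.contDiffAt_two h.contDiffAt_field_two, map_sub, sub_apply]

end IsCmcNear

end Cmc

/-! ### Smoothness of the tension field in charts. -/

section Smooth

variable {m : ℕ} {F : Type*} [NormedAddCommGroup F] [NormedSpace ℝ F] [FiniteDimensional ℝ F]
  {G : Model m → Model m →L[ℝ] Model m →L[ℝ] ℝ} {U : Set (Model m)}
  {H : F → F →L[ℝ] F →L[ℝ] ℝ} {W : Set F} {f : Model m → F} {z : Model m}

lemma contDiffAt_crdSff (hG : IsMetricOn G U) (hH : IsMetricOn H W) (hz : z ∈ U) (hfz : f z ∈ W)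
    (hf : ContDiffAt ℝ ∞ f z) {X Y : Model m → Model m} (hX : ContDiffAt ℝ ∞ X z)
    (hY : ContDiffAt ℝ ∞ Y z) : ContDiffAt ℝ ∞ (fun z => crdSff G H f z (X z) (Y z)) z := by
  have h1 : ContDiffAt ℝ ∞ (fderiv ℝ f) z := hf.fderiv_right (m := ∞) (by simp)
  have h2 : ContDiffAt ℝ ∞ (fderiv ℝ (fderiv ℝ f)) z := h1.fderiv_right (m := ∞) (by simp)
  have h3 : ContDiffAt ℝ ∞ (fun z => christoffel H (f z)) z :=
    (hH.contDiffAt_christoffel hfz).comp z hf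
  have h4 := hG.contDiffAt_christoffel hz
  exact (((h2.clm_apply hX).clm_apply hY).add
    ((h3.clm_apply (h1.clm_apply hX)).clm_apply (h1.clm_apply hY))).sub
    (h1.clm_apply ((h4.clm_apply hX).clm_apply hY))

lemma contDiffAt_crdTens (hG : IsMetricOn G U) (hH : IsMetricOn H W) (hz : z ∈ U) (hfz : f z ∈ W)
    (hf : ContDiffAt ℝ ∞ f z) : ContDiffAt ℝ ∞ (crdTens G H f) z :=
  ContDiffAt.sum fun i _ => contDiffAt_crdSff hG hH hz hfz hf contDiffAt_const
    (contDiffAt_dualVec hG hz i)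

end Smooth

/-! ### Orthonormal frames. -/

section Orthonormal

variable {m : ℕ} {M : Type*} [TopologicalSpace M]
  [ChartedSpace (EuclideanSpace ℝ (Fin m)) M] [IsManifold (𝓡 m) ∞ M]

/-- A family of tangent vectors that is orthonormal with respect to the metric. -/
def IsOrtho (g : RiemMetric m M) (x : M) {ι : Type*} [DecidableEq ι] (e : ι → Model m) : Prop :=
  ∀ i j, met g x (e i) (e j) = if i = j then 1 else 0

lemma exists_isOrtho (g : RiemMetric m M) (x : M) : ∃ e : Fin m → Model m, IsOrtho g x e := by
  let B : LinearMap.BilinForm ℝ (Model m) := LinearMap.mk₂ ℝ (fun u v => met g x u v)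
    (by simp) (by simp) (by simp) (by simp)
  have hB : ∀ u v, B u v = met g x u v := fun u v => rfl
  obtain ⟨v, hv⟩ := LinearMap.BilinForm.exists_orthogonal_basis (B := B)
    ⟨fun u v => by rw [hB, hB, met_symm]; rfl⟩
  have hd : m = Module.finrank ℝ (Model m) := by simp
  let w : Fin m → Model m := fun i => v (Fin.cast hd i)
  have hw : ∀ i, 0 < met g x (w i) (w i) := fun i => met_pos g x (v.ne_zero _)
  refine ⟨fun i => (Real.sqrt (met g x (w i) (w i)))⁻¹ • w i, fun i j => ?_⟩
  simp only [map_smul, smul_apply, smul_eq_mul]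
  split_ifs with h
  · subst h
    have h1 := Real.mul_self_sqrt (hw i).le
    have h2 := (Real.sqrt_pos.2 (hw i)).ne'
    field_simp
    rw [pow_two, h1]
  · have : met g x (w i) (w j) = 0 := hv (fun h' => h (by simpa using h'))
    simp [this]

namespace IsOrtho

variable {g : RiemMetric m M} {x : M} {ι : Type*} [Fintype ι] [DecidableEq ι] {e : ι → Model m}

lemma mtr_eq (he : IsOrtho g x e) (hι : Fintype.card ι = m) {W : Type*} [AddCommGroup W]
    [Module ℝ W] {b : Model m → Model m → W} (hb : IsBilin b) :
    mtr g x b = ∑ i, b (e i) (e i) :=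
  mtr_eq_sum g x hb hι he

lemma linearIndependent (he : IsOrtho g x e) : LinearIndependent ℝ e := by
  rw [Fintype.linearIndependent_iff]
  intro a ha i
  have := congrArg (fun v => met g x v (e i)) ha
  simpa [he _ _] using this

/-- The expansion of a vector in an orthonormal basis. -/
lemma sum_eq (he : IsOrtho g x e) (hι : Fintype.card ι = m) (v : Model m) :
    v = ∑ i, met g x v (e i) • e i := by
  have hs : Submodule.span ℝ (Set.range e) = ⊤ :=
    he.linearIndependent.span_eq_top_of_card_eq_finrank' (by simp [hι])
  have hv : v ∈ Submodule.span ℝ (Set.range e) := hs ▸ Submodule.mem_top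
  obtain ⟨a, rfl⟩ := (Submodule.mem_span_range_iff_exists_fun ℝ).1 hv
  refine Finset.sum_congr rfl fun i _ => ?_
  simp [he _ _]

lemma sum_mul (he : IsOrtho g x e) (hι : Fintype.card ι = m) (v w : Model m) :
    ∑ i, met g x v (e i) * met g x w (e i) = met g x v w := by
  conv_rhs => rw [he.sum_eq hι w]
  simp [mul_comm]

end IsOrtho

end Orthonormal

/-! ### The biharmonic equation of a hypersurface of constant mean curvature. -/

section Maps

variable {m k : ℕ} {M : Type*} [TopologicalSpace M]
  [ChartedSpace (EuclideanSpace ℝ (Fin m)) M] [IsManifold (𝓡 m) ∞ M]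
  {N : Type*} [TopologicalSpace N]
  [ChartedSpace (EuclideanSpace ℝ (Fin k)) N] [IsManifold (𝓡 k) ∞ N]
  {g : RiemMetric m M} {h : RiemMetric k N} {f : M → N}

lemma met_dmap (hf : IsIsometricImmersion g h f) (x : M) (u v : Model m) :
    met h (f x) (dmap f x u) (dmap f x v) = met g x u v := hf.isometric x u v

lemma eventually_crdMetric_dmap (h : RiemMetric k N) (hf : ContMDiff (𝓡 m) (𝓡 k) ∞ f) (x : M) :
    ∀ᶠ z in nhds (crd m x x), ∀ v w, crdMetric h (f x) (crdMap m k x (f x) f z)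
      (fderiv ℝ (crdMap m k x (f x) f) z v) (fderiv ℝ (crdMap m k x (f x) f) z w)
      = met h (f ((crd m x).symm z)) (dmap f ((crd m x).symm z) (ofCoord m x ((crd m x).symm z) v))
        (dmap f ((crd m x).symm z) (ofCoord m x ((crd m x).symm z) w)) := by
  filter_upwards [eventually_mem_source (mem_crd_source m x) (mem_crd_source k (f x))
    hf.continuous.continuousAt] with z hz v w
  have hy := (crd m x).map_target hz.1
  have key := fun v => toCoord_mfderiv hy hz.2 (hf.mdifferentiableAt (by simp))
    (ofCoord m x ((crd m x).symm z) v)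
  simp only [toCoord_ofCoord hy, (crd m x).right_inv hz.1] at key
  rw [← key, ← key, ← crdMetric_toCoord h hz.2]
  rfl

lemma isometric_crd (hf : IsIsometricImmersion g h f) (x : M) :
    ∀ᶠ z in nhds (crd m x x), ∀ v w, crdMetric h (f x) (crdMap m k x (f x) f z)
      (fderiv ℝ (crdMap m k x (f x) f) z v) (fderiv ℝ (crdMap m k x (f x) f) z w)
      = crdMetric g x z v w := by
  filter_upwards [eventually_crdMetric_dmap h hf.contMDiff x] with z hz v w
  rw [hz, met_dmap hf]
  rfl

lemma met_sff_dmap (hf : IsIsometricImmersion g h f) (x : M) (u v w : Model m) :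
    met h (f x) (sff g h f x u v) (dmap f x w) = 0 := by
  have hx := mem_crd_source m x
  have hq := mem_crd_source k (f x)
  rw [sff_crd g h hf.contMDiff, dmap_crd hf.contMDiff, met_crd h, ← crdMap_crd hx]
  refine inner_crdSff_eq_zero (isMetricOn_crdMetric g x) (isMetricOn_crdMetric h (f x))
    ((crd m x).map_source hx) ?_ ?_ (isometric_crd hf x) u v w
  · rw [crdMap_crd hx]
    exact (crd k (f x)).map_source hq
  · exact (contDiffAt_crdMap hx hq hf.contMDiff.contMDiffAt).of_le (WithTop.coe_le_coe.2 le_top)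

/-- Transfers the global hypotheses to the chart centred at `x`. The codimension condition is needed
at `x` only. -/
lemma isCmcNear (hf : IsIsometricImmersion g h f) {C : ℝ} (hC0 : C ≠ 0)
    (hC : ∀ y, met h (f y) (tens g h f y) (tens g h f y) = C) (x : M)
    (hcod : ∀ a, (∀ w : Model m, met h (f x) a (dmap f x w) = 0) → met h (f x) a (tens g h f x) = 0 → a = 0) :
    IsCmcNear (crdMetric g x) (crd m x).target (crdMetric h (f x)) (crd k (f x)).target
      (crdMap m k x (f x) f) (crdAlong m k x (f x) f (tens g h f)) (crd m x x) := by
  have hx := mem_crd_source m x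
  have hq := mem_crd_source k (f x)
  have hz := (crd m x).map_source hx
  have hfz : crdMap m k x (f x) f (crd m x x) ∈ (crd k (f x)).target := by
    rw [crdMap_crd hx]
    exact (crd k (f x)).map_source hq
  have hev := eventually_mem_source hx hq hf.contMDiff.continuous.continuousAt
  have htens : crdAlong m k x (f x) f (tens g h f) =ᶠ[nhds (crd m x x)]
      crdTens (crdMetric g x) (crdMetric h (f x)) (crdMap m k x (f x) f) :=
    hev.mono fun z hz => crdAlong_tens g h hz.1 hz.2 hf.contMDiff
  have hfs := contDiffAt_crdMap hx hq hf.contMDiff.contMDiffAt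
  have hV0 : crdAlong m k x (f x) f (tens g h f) (crd m x x) = tens g h f x := by
    rw [crdAlong_crd _ _ _ hx, toCoord_self]
  refine ⟨isMetricOn_crdMetric g x, isMetricOn_crdMetric h (f x), hz, hfz, hfs,
    (contDiffAt_crdTens (isMetricOn_crdMetric g x) (isMetricOn_crdMetric h (f x)) hz hfz
      hfs).congr_of_eventuallyEq htens, isometric_crd hf x, htens, ⟨C, ?_⟩, ?_, ?_⟩
  · filter_upwards [hev] with z hz
    rw [← hC ((crd m x).symm z), ← crdMetric_toCoord h hz.2]
    rfl
  · rw [hV0]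
    intro h0
    apply hC0
    rw [← hC x, h0, map_zero]
  · rw [hV0, crdMap_crd hx, ← met_crd h, ← dmap_crd hf.contMDiff]
    exact hcod

lemma pbc_crd (hf : ContMDiff (𝓡 m) (𝓡 k) ∞ f) {V : M → Model k} {x : M}
    (hV : DifferentiableAt ℝ (crdAlong m k x (f x) f V) (crd m x x)) (v : Model m) :
    pbc h f V x v = crdPbc (crdMetric h (f x)) (crdMap m k x (f x) f)
      (crdAlong m k x (f x) f V) (crd m x x) v := by
  have := toCoord_pbc h (mem_crd_source m x) (mem_crd_source k (f x)) hf.contMDiffAt hV v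
  rwa [toCoord_self, toCoord_self] at this

lemma isBilin_met_sff (g : RiemMetric m M) (h : RiemMetric k N) 
    (hf : ContMDiff (𝓡 m) (𝓡 k) ∞ f) (x : M) (a : Model k) :
    IsBilin fun u v => met h (f x) (sff g h f x u v) a where
  add_left u u' v := by simp [(isBilin_sff g h hf x).add_left]
  smul_left c u v := by simp [(isBilin_sff g h hf x).smul_left]
  add_right u u' v := by simp [(isBilin_sff g h hf x).add_right]
  smul_right c u v := by simp [(isBilin_sff g h hf x).smul_right]

lemma isBilin_curv (h : RiemMetric k N) (f : M → N) (x : M) (a : Model k) :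
    IsBilin fun u v : Model m => curv h (f x) (dmap f x u) a (dmap f x v) where
  add_left u u' v := by simp [curv_crd, crdCurv]; abel
  smul_left c u v := by simp [curv_crd, crdCurv, smul_sub, smul_add]
  add_right u u' v := by simp [curv_crd, crdCurv]; abel
  smul_right c u v := by simp [curv_crd, crdCurv, smul_sub, smul_add]

lemma isBilin_crdHess {E F : Type*} [NormedAddCommGroup E] [NormedSpace ℝ E] [FiniteDimensional ℝ E]
    [NormedAddCommGroup F] [NormedSpace ℝ F] [FiniteDimensional ℝ F]
    (G : E → E →L[ℝ] E →L[ℝ] ℝ) {H : F → F →L[ℝ] F →L[ℝ] ℝ} {W : Set F} {f V : E → F} {z : E}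
    (hH : IsMetricOn H W) (hfz : f z ∈ W)
    (hf : ContDiffAt ℝ 2 f z) (hV : ContDiffAt ℝ 2 V z) : IsBilin (crdHess G H f V z) := by
  choose A hA hA' using hasFDerivAt_crdPbc_apply hH hfz hf hV
  have key : crdHess G H f V z = fun u v => fderiv ℝ (fderiv ℝ V) z u v
      + fderiv ℝ (christoffel H) (f z) (fderiv ℝ f z u) (fderiv ℝ f z v) (V z)
      + christoffel H (f z) (fderiv ℝ (fderiv ℝ f) z u v) (V z)
      + christoffel H (f z) (fderiv ℝ f z v) (fderiv ℝ V z u)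
      + christoffel H (f z) (fderiv ℝ f z u) (crdPbc H f V z v)
      - crdPbc H f V z (christoffel G z u v) := by
    ext1 u
    ext1 v
    rw [crdHess, (hA v).fderiv, hA']
  rw [key]
  constructor <;> intros <;> simp only [crdPbc, map_add, map_smul,
    add_apply, smul_apply, smul_sub, smul_add] <;> abel

/-- The biharmonic equation of a hypersurface with constant nonzero mean curvature, under a
condition on the Ricci curvature in the direction of the normal. -/
theorem bitens_eq_zero_iff (hf : IsIsometricImmersion g h f) {C : ℝ} (hC0 : C ≠ 0)
    (hC : ∀ y, met h (f y) (tens g h f y) (tens g h f y) = C) (x : M)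
    (hcod : ∀ a, (∀ w : Model m, met h (f x) a (dmap f x w) = 0) → met h (f x) a (tens g h f x) = 0 → a = 0)
    {ι : Type*} [Fintype ι] [DecidableEq ι] (hι : Fintype.card ι = m) {e : ι → Model m}
    (he : IsOrtho g x e) {l : ℝ}
    (hR : ∑ i, curv h (f x) (dmap f x (e i)) (tens g h f x) (dmap f x (e i)) = - l • tens g h f x)
    (hR' : ∀ w : Model m, ∑ i, met h (f x) (curv h (f x) (dmap f x (e i)) (dmap f x w) (tens g h f x))
      (dmap f x (e i)) = 0) :
    bitens g h f x = 0 ↔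
      ∑ i, ∑ j, met h (f x) (sff g h f x (e i) (e j)) (tens g h f x) ^ 2 = l * C := by
  have hx := mem_crd_source m x
  have hcm := isCmcNear hf hC0 hC x hcod
  have hV0 : crdAlong m k x (f x) f (tens g h f) (crd m x x) = tens g h f x := by
    rw [crdAlong_crd _ _ _ hx, toCoord_self]
  have hf0 : crdMap m k x (f x) f (crd m x x) = crd k (f x) (f x) := crdMap_crd hx
  have hhess := hess_crd g h hf.contMDiff hcm.contDiffAt_field
  have hpbc := pbc_crd (h := h) hf.contMDiff (hcm.contDiffAt_field.differentiableAt (by simp))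
  have hbil : IsBilin (hess g h f (tens g h f) x) := by
    have : hess g h f (tens g h f) x = crdHess (crdMetric g x) (crdMetric h (f x))
      (crdMap m k x (f x) f) (crdAlong m k x (f x) f (tens g h f)) (crd m x x) := by
      ext1 u
      ext1 v
      exact hhess u v
    rw [this]
    exact isBilin_crdHess _ hcm.metric_cod hcm.mem_cod hcm.contDiffAt_two hcm.contDiffAt_field_two
  have h1 : ∀ u v, met h (f x) (hess g h f (tens g h f) x u v) (tens g h f x)
      = - met h (f x) (pbc h f (tens g h f) x u) (pbc h f (tens g h f) x v) := by
    intro u v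
    have := hcm.inner_hess_field u v
    rwa [hV0, hf0, ← met_crd h, ← hhess, ← hpbc, ← hpbc] at this
  -- The tangential part of the trace of the Hessian is a curvature sum; `hR'` makes it vanish once
  -- the coordinate trace is rewritten in the frame `e`.
  have h2 : ∀ w : Model m, met h (f x) (mtr g x (hess g h f (tens g h f) x)) (dmap f x w) = 0 := by
    intro w
    have := hcm.sum_inner_hess_tangent w
    rw [hV0, hf0, ← met_crd h, ← dmap_crd hf.contMDiff] at this
    simp only [← curv_crd, ← hhess] at this
    rw [mtr_crd g hx hbil, map_sum, sum_apply]
    simp only [ofCoord_self]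
    rw [this, ← hR' w]
    have hb : IsBilin fun u v : Model m => met h (f x) (curv h (f x) (dmap f x u) (dmap f x w) (tens g h f x))
        (dmap f x v) :=
      { add_left := fun u u' v => by simp [curv_crd, crdCurv]; ring
        smul_left := fun c u v => by simp [curv_crd, crdCurv]; ring
        add_right := fun u u' v => by simp
        smul_right := fun c u v => by simp }
    rw [← he.mtr_eq hι hb, mtr_crd g hx hb]
    simp only [ofCoord_self]
  have hpV : ∀ u : Model m, met h (f x) (pbc h f (tens g h f) x u) (tens g h f x) = 0 := by
    intro u
    have := hcm.eventually_pbc_field.self_of_nhds u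
    rwa [hV0, hf0, ← met_crd h, ← hpbc] at this
  have hpT : ∀ u w : Model m, met h (f x) (pbc h f (tens g h f) x u) (dmap f x w)
      = - met h (f x) (sff g h f x u w) (tens g h f x) := by
    intro u w
    have := hcm.eventually_pbc_tangent.self_of_nhds u w
    rwa [hV0, hf0, ← met_crd h, ← hpbc, ← sff_crd g h hf.contMDiff, ← dmap_crd hf.contMDiff,
      met_symm h (f x) (tens g h f x)] at this
  have hVT : ∀ w : Model m, met h (f x) (tens g h f x) (dmap f x w) = 0 := by
    intro w
    have := hcm.eventually_field_normal.self_of_nhds w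
    rwa [hV0, hf0, ← met_crd h, ← dmap_crd hf.contMDiff] at this
  -- The derivative of `τ` has no component along `τ`, so the Weingarten equation determines it
  -- completely.
  have hp : ∀ u : Model m, pbc h f (tens g h f) x u
      = - ∑ j, met h (f x) (sff g h f x u (e j)) (tens g h f x) • dmap f x (e j) := by
    intro u
    rw [← sub_eq_zero]
    apply hcod
    · intro w
      rw [map_sub, sub_apply, hpT, map_neg, map_sum, neg_apply, sum_apply]
      simp only [map_smul, smul_apply, met_dmap hf, smul_eq_mul]
      have hb := isBilin_met_sff g h hf.contMDiff x (tens g h f x)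
      conv_lhs => rw [he.sum_eq hι w]
      rw [hb.sum_right]
      simp only [hb.smul_right, map_sum, map_smul, smul_eq_mul, he _ _]
      simp [mul_comm]
    · rw [map_sub, sub_apply, hpV, map_neg, map_sum, neg_apply, sum_apply]
      simp [met_symm h (f x) (dmap f x _), hVT]
  have hpp : ∀ u : Model m, met h (f x) (pbc h f (tens g h f) x u) (pbc h f (tens g h f) x u)
      = ∑ j, met h (f x) (sff g h f x u (e j)) (tens g h f x) ^ 2 := by
    intro u
    conv_lhs => rw [hp u]
    simp only [map_neg, neg_apply, neg_neg, map_sum, map_smul, sum_apply, smul_apply, met_dmap hf,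
      smul_eq_mul, he _ _]
    simp [pow_two]
  -- The sign convention of `τ₂` together with `hR` turns the curvature term into `+ l τ`. Its
  -- pairing with `τ` is the scalar equation, and the tangential part is already zero.
  have hbit : bitens g h f x = mtr g x (hess g h f (tens g h f) x) + l • tens g h f x := by
    rw [bitens_eq, he.mtr_eq hι (isBilin_curv h f x _), hR, neg_smul, sub_neg_eq_add]
  have hbV : met h (f x) (bitens g h f x) (tens g h f x)
      = l * C - ∑ i, ∑ j, met h (f x) (sff g h f x (e i) (e j)) (tens g h f x) ^ 2 := by
    rw [hbit, map_add, add_apply, map_smul, smul_apply, hC, he.mtr_eq hι hbil, map_sum, sum_apply]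
    simp only [h1, hpp, Finset.sum_neg_distrib, smul_eq_mul]
    ring
  constructor
  · intro h0
    rw [h0, map_zero] at hbV
    have h5 : (0 : Model k →L[ℝ] ℝ) (tens g h f x) = 0 := rfl
    linarith
  · intro hs
    apply hcod
    · intro w
      rw [hbit, map_add, add_apply, h2, map_smul, smul_apply, hVT]
      simp
    · rw [hbV, hs, sub_self]

end Maps

/-! ## Sasakian structures on open subsets of a vector space -/

section Algebra

variable {E : Type*} [NormedAddCommGroup E] [NormedSpace ℝ E]

/-- A contact metric structure on a vector space. -/
structure IsContactAlg (G : E →L[ℝ] E →L[ℝ] ℝ) (Φ : E →L[ℝ] E) (ξ : E) (η : E →L[ℝ] ℝ) : Prop where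
  symm : ∀ u v, G u v = G v u
  pos : ∀ u, u ≠ 0 → 0 < G u u
  phi_sq : ∀ u, Φ (Φ u) = - u + η u • ξ
  eta_xi : η ξ = 1
  phi_metric : ∀ u v, G (Φ u) (Φ v) = G u v - η u * η v
  skew : ∀ u v, G (Φ u) v = - G u (Φ v)

namespace IsContactAlg

variable {G : E →L[ℝ] E →L[ℝ] ℝ} {Φ : E →L[ℝ] E} {ξ : E} {η : E →L[ℝ] ℝ}

lemma eq_of_forall (h : IsContactAlg G Φ ξ η) {u v : E} (huv : ∀ w, G u w = G v w) : u = v := by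
  by_contra hne
  have := h.pos (u - v) (sub_ne_zero.2 hne)
  simp [huv] at this

lemma phi_xi (h : IsContactAlg G Φ ξ η) : Φ ξ = 0 := by
  by_contra hne
  have := h.pos _ hne
  rw [h.skew, h.phi_sq, h.eta_xi] at this
  simp at this

lemma eta_eq (h : IsContactAlg G Φ ξ η) (u : E) : η u = G u ξ := by
  have := h.phi_metric u ξ
  rw [h.phi_xi, map_zero, h.eta_xi] at this
  linarith

lemma eta_phi (h : IsContactAlg G Φ ξ η) (u : E) : η (Φ u) = 0 := by
  rw [h.eta_eq, h.skew, h.phi_xi, map_zero, neg_zero]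

lemma met_xi_xi (h : IsContactAlg G Φ ξ η) : G ξ ξ = 1 := by rw [← h.eta_eq, h.eta_xi]

lemma met_phi_self (h : IsContactAlg G Φ ξ η) (u : E) : G u (Φ u) = 0 := by
  have := h.skew u u
  rw [h.symm] at this
  linarith

/-- The covariant derivative of the Reeb field of a Sasakian structure. -/
lemma nabla_xi (h : IsContactAlg G Φ ξ η) {A : E → E →L[ℝ] E} {X : E → E}
    (hcyc : ∀ u v w, G (A u v) w + G (A v w) u + G (A w u) v = 0)
    (hskew : ∀ u v w, G (A u v) w = - G (A u w) v)
    (hA : ∀ u, A u ξ = - Φ (X u))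
    (hX : ∀ u, G (X u) ξ = 0)
    (hXadd : ∀ u v, X (u + v) = X u + X v) (hXsmul : ∀ (a : ℝ) u, X (a • u) = a • X u)
    (hd : ∀ u v, G (X u) v - G (X v) u = 2 * G u (Φ v))
    (hN : ∀ u v, A (Φ u) v - A (Φ v) u + Φ (A v u) - Φ (A u v) + (2 * G u (Φ v)) • ξ = 0) (u : E) :
    X u = - Φ u := by
  -- Here `A u` stands for `∇_u φ` and `X u` for `∇_u ξ`. This is normality evaluated on the pair
  -- `u, ξ`.
  have h1 : ∀ u w, G (X (Φ u)) (Φ w) - G (X u) w = G (A ξ u) (Φ w) := by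
    intro u w
    have h1 := congrArg (fun v => G v w) (hN u ξ)
    simp only [h.phi_xi, hA] at h1
    -- The term `A (Φ ξ) u` appears with `Φ ξ = 0`. Linearity of `A` in its first argument is not
    -- assumed, but skewness and the cyclic identity already force this value.
    have h2 : A 0 u = 0 := by
      have h3 := hskew 0 u
      have : ∀ w, G (A 0 u) w = G 0 w := by
        intro w
        have h4 := hcyc 0 u w
        have h5 := hcyc 0 w u
        simp at h4 h5 ⊢
        linarith [hskew 0 u w]
      exact h.eq_of_forall this
    simp only [h2, map_add, map_sub, map_neg, add_apply, sub_apply, neg_apply, h.phi_sq, h.skew,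
      map_zero, zero_apply, map_smul, smul_apply, h.eta_eq, hX, smul_eq_mul] at h1
    linarith
  have h2 : ∀ u w, G (A ξ u) w = G (X u) (Φ w) - G (X w) (Φ u) := by
    intro u w
    have h2 := hcyc ξ u w
    have h3 := hskew u w ξ
    have h4 := hA u
    have h5 := hA w
    rw [h3, h4, h5] at h2
    simp only [map_neg, neg_apply, h.skew] at h2
    linarith
  -- Normality and closedness together make `X` skew on the image of `Φ`. As `X ξ = 0` and `X` is
  -- orthogonal to `ξ`, it is skew everywhere, so `ξ` is Killing; then `hd` gives `X` itself.
  have h3 : ∀ u w, G (X (Φ u)) (Φ w) + G (X (Φ w)) (Φ u) = 0 := by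
    intro u w
    have h3 := h1 u w
    rw [h2, h.phi_sq] at h3
    simp only [map_add, map_neg, map_smul, hX, smul_eq_mul] at h3
    linarith
  have hXξ : X ξ = 0 := by
    apply h.eq_of_forall
    intro w
    have := hd ξ w
    rw [hX, ← neg_neg (G ξ (Φ w)), ← h.skew, h.phi_xi] at this
    simpa using this
  have h4 : ∀ u w, G (X u) w + G (X w) u = 0 := by
    intro u w
    have h4 := h3 (- Φ u) (- Φ w)
    have e : ∀ u, Φ (- Φ u) = u + (- η u) • ξ := by
      intro u
      rw [map_neg, h.phi_sq, neg_smul]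
      abel
    rw [e, e] at h4
    simpa only [hXadd, hXsmul, hXξ, hX, smul_zero, add_zero, map_add, map_smul, add_zero,
      mul_zero, smul_eq_mul] using h4
  apply h.eq_of_forall
  intro w
  have h5 := hd u w
  have h6 := h4 u w
  rw [map_neg, neg_apply, h.skew]
  linarith

/-- The covariant derivative of the structure tensor of a Sasakian structure. -/
lemma nabla_phi (h : IsContactAlg G Φ ξ η) {A : E → E →L[ℝ] E} {X : E → E}
    (hcyc : ∀ u v w, G (A u v) w + G (A v w) u + G (A w u) v = 0)
    (hskew : ∀ u v w, G (A u v) w = - G (A u w) v)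
    (hA : ∀ u, A u ξ = - Φ (X u)) (hX : ∀ u, X u = - Φ u)
    (hsq : ∀ u v, A u (Φ v) + Φ (A u v) = G (X u) v • ξ + η v • X u)
    (hN : ∀ u v, A (Φ u) v - A (Φ v) u + Φ (A v u) - Φ (A u v) + (2 * G u (Φ v)) • ξ = 0) (u v : E) :
    A u v = G u v • ξ - η v • u := by
  -- The difference between the actual and the claimed tensor. It satisfies the homogeneous versions
  -- of all the identities, so it remains to show that these have only the zero solution.
  set T : E → E → E → ℝ := fun u v w => G (A u v) w - (G u v * η w - η v * G u w) with hT
  have hs := h.symm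
  have hTs : ∀ u v w, T u v w = - T u w v := by
    intro u v w
    simp only [hT, hskew u v w]
    ring
  have hTc : ∀ u v w, T u v w + T v w u + T w u v = 0 := by
    intro u v w
    have := hcyc u v w
    simp only [hT]
    linear_combination this - η w * hs u v - η u * hs v w + η v * hs u w
  have hTΦ : ∀ u v w, T u (Φ v) w = T u v (Φ w) := by
    intro u v w
    have h1 := congrArg (fun v => G v w) (hsq u v)
    simp only [map_add, add_apply, map_smul, smul_apply, smul_eq_mul, hX, map_neg, neg_apply,
      h.skew] at h1
    have h2 := h.eta_eq w
    rw [h.symm] at h2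
    simp only [hT, h.eta_phi]
    rw [← h2] at h1
    linarith
  have hTN : ∀ u v w, T (Φ u) v w - T (Φ v) u w - T v u (Φ w) + T u v (Φ w) = 0 := by
    intro u v w
    have h1 := congrArg (fun v => G v w) (hN u v)
    simp only [map_add, add_apply, map_sub, sub_apply, map_smul, smul_apply, smul_eq_mul,
      h.skew, map_zero, zero_apply] at h1
    have h2 := h.eta_eq w
    rw [h.symm] at h2
    rw [← h2] at h1
    simp only [hT, h.eta_phi, h.skew]
    have h3 : G v (Φ u) = - G u (Φ v) := by rw [h.symm, h.skew]
    rw [h3]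
    linarith
  -- The left side is symmetric in `u, v` and skew in `v, w`, hence zero.
  have hab : ∀ u v w, T (Φ u) v w + T u v (Φ w) = 0 := by
    intro u v w
    have k1 : ∀ u v w, T (Φ u) v w + T u v (Φ w) = T (Φ v) u w + T v u (Φ w) := by
      intro u v w
      have := hTN u v w
      linarith
    have k2 : ∀ u v w, T (Φ u) v w + T u v (Φ w) = - (T (Φ u) w v + T u w (Φ v)) := by
      intro u v w
      rw [hTs (Φ u), hTs u v, hTΦ]
      ring
    have := k1 u v w
    have := k2 v u w
    have := k1 v w u
    have := k2 w v u
    have := k1 w u v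
    have := k2 u w v
    linarith
  have hb : ∀ u v w, T u v (Φ w) = 0 := by
    intro w u v
    have c1 := hTc (Φ u) v w
    have c2 := hTc u (Φ v) w
    have a1 := hab u v w
    have a2 := hab v w u
    have e1 := hTΦ u v w
    have e2 := hTΦ w u v
    linarith
  -- Every vector lies in the image of `Φ` up to a multiple of `ξ`, and the `ξ` component is
  -- computed directly from `hA` and `hX`.
  have hT0 : ∀ u v w, T u v w = 0 := by
    intro u v w
    have h1 := hb u v (- Φ w)
    have e : ∀ u, Φ (- Φ u) = u + (- η u) • ξ := by
      intro u
      rw [map_neg, h.phi_sq, neg_smul]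
      abel
    rw [e] at h1
    have h2 : T u v ξ = 0 := by
      rw [hTs]
      simp only [hT, hA, hX, map_neg, neg_neg, h.phi_sq, h.eta_xi, h.eta_eq u, map_add, map_smul,
        add_apply, neg_apply, smul_apply, smul_eq_mul, h.eta_eq v, hs ξ v]
      ring
    have h3 : T u v (w + (- η w) • ξ) = T u v w + (- η w) * T u v ξ := by
      simp only [hT, map_add, map_smul, smul_eq_mul]
      ring
    rw [h3, h2] at h1
    simpa using h1
  apply h.eq_of_forall
  intro w
  have h1 := hT0 u v w
  have h2 := h.eta_eq w
  rw [h.symm] at h2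
  simp only [map_sub, map_smul, sub_apply, smul_apply, smul_eq_mul, ← h2]
  simp only [hT] at h1
  linarith

/-- A curvature-like tensor that vanishes on `φ`-sections and has the symmetries of the curvature
tensor of a Kähler metric is zero. -/
lemma kahler_eq_zero (h : IsContactAlg G Φ ξ η) {Q : E → E → E → E → ℝ}
    (hadd : ∀ x y z w w', Q x y z (w + w') = Q x y z w + Q x y z w')
    (hsmul : ∀ x y z (a : ℝ) w, Q x y z (a • w) = a * Q x y z w)
    (h12 : ∀ x y z w, Q x y z w = - Q y x z w) (h34 : ∀ x y z w, Q x y z w = - Q x y w z)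
    (hcyc : ∀ x y z w, Q x y z w + Q y z x w + Q z x y w = 0)
    (hξ : ∀ x y w, Q x y ξ w = 0) (hΦ : ∀ x y z w, Q x y (Φ z) w = - Q x y z (Φ w))
    (hsec : ∀ x, η x = 0 → Q x (Φ x) (Φ x) x = 0) (x y z w : E) : Q x y z w = 0 := by
  have hpair : ∀ x y z w, Q x y z w = Q z w x y := by
    intro x y z w
    linarith [hcyc x y z w, hcyc y z w x, hcyc z w x y, hcyc w x y z, h12 x y z w, h12 y z w x,
      h12 z w x y, h12 w x y z, h34 x y z w, h34 y z w x, h34 z w x y, h34 w x y z,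
      h12 x z y w, h34 x z y w, h12 y w x z, h34 y w x z, h12 z x y w, h34 z x y w, h12 w y z x,
      h34 w y z x, h34 z x w y, h34 x z w y, h34 y w z x, h34 w y x z]
  have hξ4 : ∀ x y z, Q x y z ξ = 0 := fun x y z => by rw [h34, hξ, neg_zero]
  have a4 := hadd
  have a3 : ∀ x y z z' w, Q x y (z + z') w = Q x y z w + Q x y z' w := by
    intro x y z z' w
    rw [h34, hadd, h34 x y z, h34 x y z']
    ring
  have a2 : ∀ x y y' z w, Q x (y + y') z w = Q x y z w + Q x y' z w := by
    intro x y y' z w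
    rw [hpair, hadd, hpair x y, hpair x y']
  have a1 : ∀ x x' y z w, Q (x + x') y z w = Q x y z w + Q x' y z w := by
    intro x x' y z w
    rw [h12, a2, h12 x, h12 x']
    ring
  have s3 : ∀ x y z (a : ℝ) w, Q x y (a • z) w = a * Q x y z w := by
    intro x y z a w
    rw [h34, hsmul, h34 x y z]
    ring
  have s2 : ∀ x y z (a : ℝ) w, Q x (a • y) z w = a * Q x y z w := by
    intro x y z a w
    rw [hpair, hsmul, hpair x y]
  have s1 : ∀ x y z (a : ℝ) w, Q (a • x) y z w = a * Q x y z w := by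
    intro x y z a w
    rw [h12, s2, h12 x]
    ring
  have hξ2 : ∀ x z w, Q x ξ z w = 0 := fun x z w => by rw [hpair, hξ4]
  have hξ1 : ∀ y z w, Q ξ y z w = 0 := fun y z w => by rw [hpair, hξ]
  have hΦ12 : ∀ x y z w, Q (Φ x) y z w = - Q x (Φ y) z w := fun x y z w => by
    rw [hpair, hΦ, hpair x]
  have hsec' : ∀ x, Q x (Φ x) (Φ x) x = 0 := by
    intro x
    have h1 := hsec (x + (- η x) • ξ) (by simp [h.eta_xi])
    simpa only [map_add, map_smul, h.phi_xi, smul_zero, add_zero, a4, a1, hsmul, s1, hξ4, hξ1,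
      mul_zero] using h1
  -- Polarisation: adding the identity at `x + y` and at `x - y` isolates the part that is quadratic
  -- in both vectors.
  have hpol : ∀ x y, Q x (Φ x) (Φ y) y + 2 * Q x (Φ y) (Φ y) x = 0 := by
    intro x y
    have p1 := hsec' (x + y)
    have p2 := hsec' (x + (-1 : ℝ) • y)
    simp only [map_add, map_smul, a1, a2, a3, a4, s1, s2, s3, hsmul] at p1 p2
    have q1 := hsec' x
    have q2 := hsec' y
    have e1 : Q y (Φ y) (Φ x) x = Q x (Φ x) (Φ y) y := by
      rw [hpair, h12, h34, neg_neg]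
    have e2 : Q y (Φ x) (Φ y) x = Q x (Φ y) (Φ y) x := by
      rw [h12, hΦ12, neg_neg]
    have e3 : Q x (Φ y) (Φ x) y = Q x (Φ y) (Φ y) x := by
      rw [hΦ, h34, neg_neg]
    have e4 : Q y (Φ x) (Φ x) y = Q x (Φ y) (Φ y) x := by
      rw [hΦ, h34, neg_neg, e2]
    linarith
  have hsq : ∀ x y z w, Q x (Φ (Φ y)) z w = - Q x y z w := by
    intro x y z w
    rw [h.phi_sq, a2, s2, hξ2, ← neg_one_smul ℝ y, s2]
    ring
  -- The Bianchi identity eliminates the mixed term of `hpol`. This relation for `y` and for `Φ y`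
  -- is a nonsingular `2 × 2` system, so all sectional values vanish.
  have hlin : ∀ x y, Q x y y x + 3 * Q x (Φ y) (Φ y) x = 0 := by
    intro x y
    have p := hpol x y
    have b := hcyc x (Φ x) (Φ y) y
    have e1 : Q (Φ x) (Φ y) x y = - Q x y y x := by
      rw [hΦ12, hsq, neg_neg, h34]
    have e2 : Q (Φ y) x (Φ x) y = - Q x (Φ y) (Φ y) x := by
      rw [h12, hΦ, h34, neg_neg]
    linarith
  have h0 : ∀ x y, Q x y y x = 0 := by
    intro x y
    have p := hlin x y
    have q := hlin x (Φ y)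
    have e : Q x (Φ (Φ y)) (Φ (Φ y)) x = Q x y y x := by
      rw [hsq, h34, h.phi_sq, hadd, hsmul, hξ4, ← neg_one_smul ℝ y, hsmul, h34 x y y]
      ring
    linarith
  -- Polarising the vanishing sectional values makes `Q` alternating in all adjacent pairs of
  -- arguments, and the Bianchi identity then reads `3 Q = 0`.
  have h1 : ∀ x y w, Q x y w x = 0 := by
    intro x y w
    have p := h0 x (y + w)
    have e : Q x w y x = Q x y w x := by rw [hpair, h12, h34, neg_neg]
    simp only [a2, a3, h0] at p
    linarith
  have h14 : ∀ x y w z, Q x y w z = - Q z y w x := by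
    intro x y w z
    have p := h1 (x + z) y w
    simp only [a1, a4, h1] at p
    linarith
  have h23 : ∀ x y w z, Q x y w z = - Q x w y z := by
    intro x y w z
    rw [h12, h34, neg_neg, h14, h12, h34, neg_neg]
  linarith [hcyc x y z w, h12 y z x w, h23 y x z w, h12 x y z w, h12 z x y w, h23 x z y w,
    h12 y x z w]

end IsContactAlg

end Algebra

/-! ### Symmetries of the curvature tensor of a metric. -/

section Curvature

variable {E : Type*} [NormedAddCommGroup E] [NormedSpace ℝ E] [FiniteDimensional ℝ E]
  {G : E → E →L[ℝ] E →L[ℝ] ℝ} {U : Set E} {z : E}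

lemma crdCurv_skew (G : E → E →L[ℝ] E →L[ℝ] ℝ) (z u v w : E) :
    crdCurv G z u v w = - crdCurv G z v u w := by
  simp only [crdCurv]
  abel

namespace IsMetricOn

lemma hasFDerivAt_christoffel (hG : IsMetricOn G U) (hz : z ∈ U) :
    HasFDerivAt (christoffel G) (fderiv ℝ (christoffel G) z) z :=
  ((hG.contDiffAt_christoffel hz).differentiableAt (by simp)).hasFDerivAt

lemma fderiv_christoffel_symm (hG : IsMetricOn G U) (hz : z ∈ U) (w u v : E) :
    fderiv ℝ (christoffel G) z w u v = fderiv ℝ (christoffel G) z w v u := by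
  have h := hG.hasFDerivAt_christoffel hz
  have h1 := (h.clm_apply (hasFDerivAt_const u z)).clm_apply (hasFDerivAt_const v z)
  have h2 := (h.clm_apply (hasFDerivAt_const v z)).clm_apply (hasFDerivAt_const u z)
  have h3 : (fun z => christoffel G z u v) =ᶠ[nhds z] fun z => christoffel G z v u := by
    filter_upwards [hG.isOpen.mem_nhds hz] with y hy using hG.christoffel_symm hy u v
  have := congrArg (fun L => L w) (h1.unique (h2.congr_of_eventuallyEq h3))
  simpa using this

/-- The first Bianchi identity. -/
lemma crdCurv_cyclic (hG : IsMetricOn G U) (hz : z ∈ U) (u v w : E) :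
    crdCurv G z u v w + crdCurv G z v w u + crdCurv G z w u v = 0 := by
  simp only [crdCurv]
  rw [hG.fderiv_christoffel_symm hz u w v, hG.fderiv_christoffel_symm hz v w u,
    hG.fderiv_christoffel_symm hz w u v, hG.christoffel_symm hz v w, hG.christoffel_symm hz w u,
    hG.christoffel_symm hz u v]
  abel

/-- The second derivative of `G(w, w)`, with `w` constant, is symmetric; written through Christoffel
symbols, its antisymmetric part is twice this curvature pairing. -/
lemma crdCurv_metric (hG : IsMetricOn G U) (hz : z ∈ U) (u v w : E) :
    G z (crdCurv G z u v w) w = 0 := by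
  have hsnd : ∀ u v, fderiv ℝ (fderiv ℝ fun z => G z w w) z v u =
      2 * (G z (christoffel G z v (christoffel G z u w)) w
        + G z (christoffel G z u w) (christoffel G z v w)
        + G z (fderiv ℝ (christoffel G) z v u w) w) := by
    intro u v
    have h1 : (fun z => fderiv ℝ (fun z => G z w w) z u) =ᶠ[nhds z]
        fun z => 2 * G z (christoffel G z u w) w := by
      filter_upwards [hG.isOpen.mem_nhds hz] with y hy
      have h2 := (((hG.differentiableAt hy).hasFDerivAt).clm_apply (hasFDerivAt_const w y)).clm_apply
        (hasFDerivAt_const w y)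
      rw [h2.fderiv]
      simp only [add_apply, ContinuousLinearMap.comp_apply, ContinuousLinearMap.flip_apply, zero_apply,
        map_zero, zero_add, hG.fderiv_eq hy, hG.symm y hy w]
      ring
    have h2 : DifferentiableAt ℝ (fderiv ℝ fun z => G z w w) z := by
      have : ContDiffAt ℝ ∞ (fun z => G z w w) z :=
        ((hG.contDiffAt hz).clm_apply contDiffAt_const).clm_apply contDiffAt_const
      exact (this.fderiv_right (m := ∞) (by simp)).differentiableAt (by simp)
    have h3 := h2.hasFDerivAt.clm_apply (hasFDerivAt_const u z)
    have h4 := (hG.hasFDerivAt_christoffel hz).clm_apply (hasFDerivAt_const u z) |>.clm_apply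
      (hasFDerivAt_const w z)
    have h5 := ((((hG.differentiableAt hz).hasFDerivAt).clm_apply h4).clm_apply
      (hasFDerivAt_const w z)).const_mul 2
    have h6 := congrArg (fun L => L v) (h3.unique (h5.congr_of_eventuallyEq h1))
    simp only [add_apply, ContinuousLinearMap.comp_apply, ContinuousLinearMap.flip_apply, zero_apply,
      map_zero, zero_add, smul_apply, smul_eq_mul, hG.fderiv_eq hz] at h6
    rw [h6]
    ring
  have hs : fderiv ℝ (fderiv ℝ fun z => G z w w) z v u = fderiv ℝ (fderiv ℝ fun z => G z w w) z u v := by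
    apply snd_fderiv_symm
    exact (((hG.contDiffAt hz).clm_apply contDiffAt_const).clm_apply contDiffAt_const).of_le
      (WithTop.coe_le_coe.2 le_top)
  rw [hsnd, hsnd, hG.symm z hz (christoffel G z v w)] at hs
  simp only [crdCurv, map_add, map_sub, add_apply, sub_apply]
  linarith

lemma crdCurv_metric_skew (hG : IsMetricOn G U) (hz : z ∈ U) (u v w w' : E) :
    G z (crdCurv G z u v w) w' = - G z (crdCurv G z u v w') w := by
  have h1 := hG.crdCurv_metric hz u v (w + w')
  have h2 := hG.crdCurv_metric hz u v w
  have h3 := hG.crdCurv_metric hz u v w'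
  have h4 : crdCurv G z u v (w + w') = crdCurv G z u v w + crdCurv G z u v w' := by
    simp only [crdCurv, map_add]
    abel
  rw [h4] at h1
  simp only [map_add, add_apply] at h1
  linarith

end IsMetricOn

end Curvature

/-! ### Covariant derivatives of `ξ` and `φ` on a Sasakian open set. -/

section Sasaki

variable {E : Type*} [NormedAddCommGroup E] [NormedSpace ℝ E] [FiniteDimensional ℝ E]

/-- A Sasakian structure on an open subset of a vector space. -/
structure IsSasakiOn (Φ : E → E →L[ℝ] E) (ξ : E → E) (η : E → E →L[ℝ] ℝ)
    (G : E → E →L[ℝ] E →L[ℝ] ℝ) (U : Set E) : Prop where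
  metric : IsMetricOn G U
  smooth_phi : ∀ z ∈ U, ContDiffAt ℝ ∞ Φ z
  smooth_xi : ∀ z ∈ U, ContDiffAt ℝ ∞ ξ z
  smooth_eta : ∀ z ∈ U, ContDiffAt ℝ ∞ η z
  phi_sq : ∀ z ∈ U, ∀ u, Φ z (Φ z u) = - u + η z u • ξ z
  eta_xi : ∀ z ∈ U, η z (ξ z) = 1
  phi_metric : ∀ z ∈ U, ∀ u v, G z (Φ z u) (Φ z v) = G z u v - η z u * η z v
  metric_phi : ∀ z ∈ U, ∀ u v, G z u (Φ z v) = (1 / 2) * (fderiv ℝ η z u v - fderiv ℝ η z v u)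
  normal : ∀ z ∈ U, ∀ u v, fderiv ℝ Φ z (Φ z u) v - fderiv ℝ Φ z (Φ z v) u
    + Φ z (fderiv ℝ Φ z v u) - Φ z (fderiv ℝ Φ z u v) + (2 * G z u (Φ z v)) • ξ z = 0

/-- The covariant derivative of an endomorphism field. -/
def crdNabla (G : E → E →L[ℝ] E →L[ℝ] ℝ) (Φ : E → E →L[ℝ] E) (z u : E) : E →L[ℝ] E :=
  fderiv ℝ Φ z u + (christoffel G z u).comp (Φ z) - (Φ z).comp (christoffel G z u)

lemma crdNabla_apply (G : E → E →L[ℝ] E →L[ℝ] ℝ) (Φ : E → E →L[ℝ] E) (z u v : E) :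
    crdNabla G Φ z u v = fderiv ℝ Φ z u v + christoffel G z u (Φ z v) - Φ z (christoffel G z u v) :=
  rfl

/-- The covariant derivative of a vector field. -/
def crdNablaVec (G : E → E →L[ℝ] E →L[ℝ] ℝ) (X : E → E) (z u : E) : E :=
  fderiv ℝ X z u + christoffel G z u (X z)

namespace IsSasakiOn

variable {Φ : E → E →L[ℝ] E} {ξ : E → E} {η : E → E →L[ℝ] ℝ} {G : E → E →L[ℝ] E →L[ℝ] ℝ}
  {U : Set E} {z : E}

lemma contactAlg (h : IsSasakiOn Φ ξ η G U) (hz : z ∈ U) : IsContactAlg (G z) (Φ z) (ξ z) (η z) where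
  symm := h.metric.symm z hz
  pos := h.metric.pos z hz
  phi_sq := h.phi_sq z hz
  eta_xi := h.eta_xi z hz
  phi_metric := h.phi_metric z hz
  skew u v := by
    rw [h.metric.symm z hz, h.metric_phi z hz, h.metric_phi z hz]
    ring

lemma hasFDerivAt_phi (h : IsSasakiOn Φ ξ η G U) (hz : z ∈ U) : HasFDerivAt Φ (fderiv ℝ Φ z) z :=
  ((h.smooth_phi z hz).differentiableAt (by simp)).hasFDerivAt

lemma hasFDerivAt_xi (h : IsSasakiOn Φ ξ η G U) (hz : z ∈ U) : HasFDerivAt ξ (fderiv ℝ ξ z) z :=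
  ((h.smooth_xi z hz).differentiableAt (by simp)).hasFDerivAt

lemma hasFDerivAt_eta (h : IsSasakiOn Φ ξ η G U) (hz : z ∈ U) : HasFDerivAt η (fderiv ℝ η z) z :=
  ((h.smooth_eta z hz).differentiableAt (by simp)).hasFDerivAt

lemma hasFDerivAt_metric (h : IsSasakiOn Φ ξ η G U) (hz : z ∈ U) : HasFDerivAt G (fderiv ℝ G z) z :=
  (h.metric.differentiableAt hz).hasFDerivAt

lemma crdNabla_skew (h : IsSasakiOn Φ ξ η G U) (hz : z ∈ U) (u v w : E) :
    G z (crdNabla G Φ z u v) w = - G z (crdNabla G Φ z u w) v := by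
  have hc := fun v => hasFDerivAt_const (𝕜 := ℝ) (v : E) z
  have h1 := ((h.hasFDerivAt_metric hz).clm_apply ((h.hasFDerivAt_phi hz).clm_apply (hc v))).clm_apply
    (hc w)
  have h2 := (((h.hasFDerivAt_metric hz).clm_apply (hc v)).clm_apply
    ((h.hasFDerivAt_phi hz).clm_apply (hc w))).neg
  have h3 : (fun z => G z (Φ z v) w) =ᶠ[nhds z] fun z => - G z v (Φ z w) := by
    filter_upwards [h.metric.isOpen.mem_nhds hz] with y hy using (h.contactAlg hy).skew v w
  have h4 := congrArg (fun L => L u) (h1.unique (h2.congr_of_eventuallyEq h3))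
  simp only [add_apply, ContinuousLinearMap.comp_apply, ContinuousLinearMap.flip_apply, zero_apply,
    map_zero, zero_add, neg_apply, h.metric.fderiv_eq hz, (h.contactAlg hz).skew] at h4
  simp only [crdNabla_apply, map_add, map_sub, add_apply, sub_apply, (h.contactAlg hz).skew]
  have hs := h.metric.symm z hz
  rw [hs (fderiv ℝ Φ z u w) v, hs (christoffel G z u (Φ z w)) v, hs (christoffel G z u w) (Φ z v),
    (h.contactAlg hz).skew]
  linarith

lemma fderiv_eta (h : IsSasakiOn Φ ξ η G U) (hz : z ∈ U) (u v : E) :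
    fderiv ℝ η z u v = G z (crdNablaVec G ξ z u) v + η z (christoffel G z u v) := by
  have hc := fun v => hasFDerivAt_const (𝕜 := ℝ) (v : E) z
  have h1 := (h.hasFDerivAt_eta hz).clm_apply (hc v)
  have h2 := ((h.hasFDerivAt_metric hz).clm_apply (hc v)).clm_apply (h.hasFDerivAt_xi hz)
  have h3 : (fun z => η z v) =ᶠ[nhds z] fun z => G z v (ξ z) := by
    filter_upwards [h.metric.isOpen.mem_nhds hz] with y hy using (h.contactAlg hy).eta_eq v
  have h4 := congrArg (fun L => L u) (h1.unique (h2.congr_of_eventuallyEq h3))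
  have h5 := (h.contactAlg hz).eta_eq (christoffel G z u v)
  simp only [add_apply, ContinuousLinearMap.comp_apply, ContinuousLinearMap.flip_apply, zero_apply,
    map_zero, zero_add, h.metric.fderiv_eq hz] at h4
  simp only [crdNablaVec, map_add, add_apply]
  have hs := h.metric.symm z hz
  rw [hs (fderiv ℝ ξ z u) v, hs (christoffel G z u (ξ z)) v]
  linarith

/-- Closedness of `dη`: the relation `g(u, φv) = dη(u, v)` is differentiated and summed cyclically,
where the second derivatives of `η` cancel by symmetry. -/
lemma crdNabla_cyclic (h : IsSasakiOn Φ ξ η G U) (hz : z ∈ U) (u v w : E) :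
    G z (crdNabla G Φ z u v) w + G z (crdNabla G Φ z v w) u + G z (crdNabla G Φ z w u) v = 0 := by
  have hc := fun v => hasFDerivAt_const (𝕜 := ℝ) (v : E) z
  have hs := h.metric.symm z hz
  have hsym := fun u v => snd_fderiv_symm ((h.smooth_eta z hz).of_le (WithTop.coe_le_coe.2 le_top)) u v
  have hd : HasFDerivAt (fderiv ℝ η) (fderiv ℝ (fderiv ℝ η) z) z :=
    (((h.smooth_eta z hz).fderiv_right (m := ∞) (by simp)).differentiableAt (by simp)).hasFDerivAt
  have key : ∀ u v w, G z (crdNabla G Φ z u v) w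
      + G z (Φ z (christoffel G z u v)) w + G z (Φ z v) (christoffel G z u w) =
      (1 / 2) * (fderiv ℝ (fderiv ℝ η) z u w v - fderiv ℝ (fderiv ℝ η) z u v w) := by
    intro u v w
    have h1 := ((h.hasFDerivAt_metric hz).clm_apply (hc w)).clm_apply
      ((h.hasFDerivAt_phi hz).clm_apply (hc v))
    have h2 := (((hd.clm_apply (hc w)).clm_apply (hc v)).sub
      ((hd.clm_apply (hc v)).clm_apply (hc w))).const_mul (1 / 2)
    have h3 : (fun z => G z w (Φ z v)) =ᶠ[nhds z]
        fun z => (1 / 2) * (fderiv ℝ η z w v - fderiv ℝ η z v w) := by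
      filter_upwards [h.metric.isOpen.mem_nhds hz] with y hy using h.metric_phi y hy w v
    have h4 := congrArg (fun L => L u) (h1.unique (h2.congr_of_eventuallyEq h3))
    simp only [add_apply, ContinuousLinearMap.comp_apply, ContinuousLinearMap.flip_apply, zero_apply,
      map_zero, zero_add, h.metric.fderiv_eq hz, smul_apply, smul_eq_mul, sub_apply] at h4
    rw [← h4]
    simp only [crdNabla_apply, map_add, map_sub, add_apply, sub_apply]
    rw [hs w, hs w, hs (Φ z v)]
    ring
  have k1 := key u v w
  have k2 := key v w u
  have k3 := key w u v
  have hk := (h.contactAlg hz).skew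
  have e : ∀ u v w, G z (Φ z (christoffel G z u v)) w = - G z (Φ z w) (christoffel G z v u) := by
    intro u v w
    rw [hk, hs, h.metric.christoffel_symm hz]
  rw [hsym u w, hsym u v] at k1
  rw [hsym v w, e] at k2
  rw [e] at k1 k3
  linarith

/-- The covariant derivative of `φξ = 0`. -/
lemma crdNabla_xi (h : IsSasakiOn Φ ξ η G U) (hz : z ∈ U) (u : E) :
    crdNabla G Φ z u (ξ z) = - Φ z (crdNablaVec G ξ z u) := by
  have h1 := (h.hasFDerivAt_phi hz).clm_apply (h.hasFDerivAt_xi hz)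
  have h3 : (fun z => Φ z (ξ z)) =ᶠ[nhds z] fun _ => 0 := by
    filter_upwards [h.metric.isOpen.mem_nhds hz] with y hy using (h.contactAlg hy).phi_xi
  have h4 := congrArg (fun L => L u) (h1.unique ((hasFDerivAt_const 0 z).congr_of_eventuallyEq h3))
  simp only [add_apply, ContinuousLinearMap.comp_apply, ContinuousLinearMap.flip_apply,
    zero_apply] at h4
  rw [crdNabla_apply, (h.contactAlg hz).phi_xi, crdNablaVec, map_zero, map_add,
    eq_neg_of_add_eq_zero_right h4]
  abel

lemma met_crdNablaVec_xi (h : IsSasakiOn Φ ξ η G U) (hz : z ∈ U) (u : E) :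
    G z (crdNablaVec G ξ z u) (ξ z) = 0 := by
  have h1 := ((h.hasFDerivAt_metric hz).clm_apply (h.hasFDerivAt_xi hz)).clm_apply
    (h.hasFDerivAt_xi hz)
  have h3 : (fun z => G z (ξ z) (ξ z)) =ᶠ[nhds z] fun _ => 1 := by
    filter_upwards [h.metric.isOpen.mem_nhds hz] with y hy using (h.contactAlg hy).met_xi_xi
  have h4 := congrArg (fun L => L u) (h1.unique ((hasFDerivAt_const 1 z).congr_of_eventuallyEq h3))
  simp only [add_apply, ContinuousLinearMap.comp_apply, ContinuousLinearMap.flip_apply,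
    zero_apply, h.metric.fderiv_eq hz, h.metric.symm z hz (ξ z)] at h4
  simp only [crdNablaVec, map_add, add_apply]
  linarith

/-- The covariant derivative of `φ² = -1 + η ⊗ ξ`. -/
lemma crdNabla_phi (h : IsSasakiOn Φ ξ η G U) (hz : z ∈ U) (u v : E) :
    crdNabla G Φ z u (Φ z v) + Φ z (crdNabla G Φ z u v)
      = G z (crdNablaVec G ξ z u) v • ξ z + η z v • crdNablaVec G ξ z u := by
  have hc := fun v => hasFDerivAt_const (𝕜 := ℝ) (v : E) z
  have h1 := (h.hasFDerivAt_phi hz).clm_apply ((h.hasFDerivAt_phi hz).clm_apply (hc v))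
  have h2 := (hc (-v)).add (((h.hasFDerivAt_eta hz).clm_apply (hc v)).fun_smul (h.hasFDerivAt_xi hz))
  have h3 : (fun z => Φ z (Φ z v)) =ᶠ[nhds z] fun z => - v + η z v • ξ z := by
    filter_upwards [h.metric.isOpen.mem_nhds hz] with y hy using h.phi_sq y hy v
  have h4 := congrArg (fun L => L u) (h1.unique (h2.congr_of_eventuallyEq h3))
  simp only [add_apply, ContinuousLinearMap.comp_apply, ContinuousLinearMap.flip_apply,
    zero_apply, map_zero, zero_add, smul_apply, ContinuousLinearMap.smulRight_apply,
    h.fderiv_eta hz] at h4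
  simp only [crdNabla_apply, h.phi_sq z hz, map_add, map_sub, map_smul, map_neg]
  rw [← sub_eq_zero] at h4 ⊢
  rw [← h4]
  simp only [crdNablaVec, map_add, add_apply, add_smul, smul_add]
  abel

/-- The connection is torsion-free, so the Christoffel terms added to the coordinate form of
normality cancel in pairs. -/
lemma crdNabla_normal (h : IsSasakiOn Φ ξ η G U) (hz : z ∈ U) (u v : E) :
    crdNabla G Φ z (Φ z u) v - crdNabla G Φ z (Φ z v) u + Φ z (crdNabla G Φ z v u)
      - Φ z (crdNabla G Φ z u v) + (2 * G z u (Φ z v)) • ξ z = 0 := by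
  rw [← h.normal z hz u v]
  simp only [crdNabla_apply, map_add, map_sub]
  rw [h.metric.christoffel_symm hz (Φ z u) (Φ z v), h.metric.christoffel_symm hz (Φ z u) v,
    h.metric.christoffel_symm hz (Φ z v) u, h.metric.christoffel_symm hz u v]
  abel

lemma crdNablaVec_eq (h : IsSasakiOn Φ ξ η G U) (hz : z ∈ U) (u : E) :
    crdNablaVec G ξ z u = - Φ z u := by
  refine (h.contactAlg hz).nabla_xi (h.crdNabla_cyclic hz) (h.crdNabla_skew hz) (h.crdNabla_xi hz)
    (h.met_crdNablaVec_xi hz) ?_ ?_ ?_ (h.crdNabla_normal hz) u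
  · intro u v
    simp only [crdNablaVec, map_add, add_apply]
    abel
  · intro a u
    simp only [crdNablaVec, map_smul, smul_apply, smul_add]
  · intro u v
    rw [h.metric_phi z hz, h.fderiv_eta hz, h.fderiv_eta hz, h.metric.christoffel_symm hz u v]
    ring

lemma crdNabla_eq (h : IsSasakiOn Φ ξ η G U) (hz : z ∈ U) (u v : E) :
    crdNabla G Φ z u v = G z u v • ξ z - η z v • u :=
  (h.contactAlg hz).nabla_phi (h.crdNabla_cyclic hz) (h.crdNabla_skew hz) (h.crdNabla_xi hz)
    (h.crdNablaVec_eq hz) (h.crdNabla_phi hz) (h.crdNabla_normal hz) u v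

end IsSasakiOn

end Sasaki

/-! ### The curvature tensor of a Sasakian space form. -/

section SasakiCurvature

variable {E : Type*} [NormedAddCommGroup E] [NormedSpace ℝ E] [FiniteDimensional ℝ E]

/-- The Ricci identity for a vector field. -/
lemma IsMetricOn.ricci_identity {G : E → E →L[ℝ] E →L[ℝ] ℝ} {U : Set E} {z : E} {V : E → E}
    (hG : IsMetricOn G U) (hz : z ∈ U) (hV : ContDiffAt ℝ 2 V z) {A : E → E →L[ℝ] E}
    (hA : ∀ v, HasFDerivAt (fun z => crdNablaVec G V z v) (A v) z) (u v : E) :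
    A v u + christoffel G z u (crdNablaVec G V z v) - A u v - christoffel G z v (crdNablaVec G V z u)
      = crdCurv G z u v (V z) := by
  have e : ∀ z, crdPbc G id V z = crdNablaVec G V z := by
    intro z
    ext1 u
    simp [crdPbc, crdNablaVec]
  have h := crdHess_sub (f := id) (V := V) hG hG hz hz contDiffAt_id hV u v
  simp only [crdHess, e, (hA _).fderiv, fderiv_id, ContinuousLinearMap.id_apply, id_eq] at h
  rw [← h, hG.christoffel_symm hz v u]
  abel

/-- The curvature tensor of a Sasakian space form. -/
def spaceFormCurv (c : ℝ) (G : E →L[ℝ] E →L[ℝ] ℝ) (Φ : E →L[ℝ] E) (ξ : E) (η : E →L[ℝ] ℝ)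
    (x y z : E) : E :=
  ((c + 3) / 4) • (G z y • x - G z x • y) + ((c - 1) / 4) • ((η z * η x) • y - (η z * η y) • x
    + (G z x * η y) • ξ - (G z y * η x) • ξ + G z (Φ y) • Φ x - G z (Φ x) • Φ y
    + (2 * G x (Φ y)) • Φ z)

namespace IsSasakiOn

variable {Φ : E → E →L[ℝ] E} {ξ : E → E} {η : E → E →L[ℝ] ℝ} {G : E → E →L[ℝ] E →L[ℝ] ℝ}
  {U : Set E} {z : E}

/-- The Ricci identity for `ξ`: as `∇ξ = -φ`, the second derivatives of `ξ` are given by the known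
`∇φ`. -/
lemma crdCurv_xi (h : IsSasakiOn Φ ξ η G U) (hz : z ∈ U) (u v : E) :
    crdCurv G z u v (ξ z) = η z v • u - η z u • v := by
  have hA : ∀ v, HasFDerivAt (fun z => crdNablaVec G ξ z v) (-(fderiv ℝ Φ z).flip v) z := by
    intro v
    have h1 := ((h.hasFDerivAt_phi hz).clm_apply (hasFDerivAt_const v z)).neg
    have h2 : (fun z => crdNablaVec G ξ z v) =ᶠ[nhds z] fun z => - Φ z v := by
      filter_upwards [h.metric.isOpen.mem_nhds hz] with y hy using h.crdNablaVec_eq hy v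
    refine (h1.congr_of_eventuallyEq h2).congr_fderiv ?_
    ext u
    simp
  have h1 := h.metric.ricci_identity hz ((h.smooth_xi z hz).of_le (WithTop.coe_le_coe.2 le_top)) hA u v
  have h2 := h.crdNabla_eq hz u v
  have h3 := h.crdNabla_eq hz v u
  rw [crdNabla_apply, sub_eq_iff_eq_add, ← eq_sub_iff_add_eq] at h2 h3
  simp only [neg_apply, ContinuousLinearMap.flip_apply, h.crdNablaVec_eq hz, map_neg, h2, h3] at h1
  rw [← h1, h.metric.symm z hz v u, h.metric.christoffel_symm hz v u]
  abel

/-- The Ricci identity for the field `φw` with constant `w`, every derivative of the structure being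
replaced by its Sasakian expression. -/
lemma crdCurv_phi (h : IsSasakiOn Φ ξ η G U) (hz : z ∈ U) (u v w : E) :
    crdCurv G z u v (Φ z w) = Φ z (crdCurv G z u v w) - G z v w • Φ z u + G z u w • Φ z v
      - G z u (Φ z w) • v + G z v (Φ z w) • u := by
  have hc := fun v => hasFDerivAt_const (𝕜 := ℝ) (v : E) z
  have hΓ := fun v => ((h.metric.hasFDerivAt_christoffel hz).clm_apply (hc v)).clm_apply (hc w)
  have hD := fun v => ((((((h.hasFDerivAt_metric hz).clm_apply (hc v)).clm_apply (hc w)).fun_smul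
      (h.hasFDerivAt_xi hz)).sub (((h.hasFDerivAt_eta hz).clm_apply (hc w)).fun_smul (hc v))).add
      ((h.hasFDerivAt_phi hz).clm_apply (hΓ v)))
  have hA := fun v => (hD v).congr_of_eventuallyEq
    (f₁ := fun z => crdNablaVec G (fun z => Φ z w) z v) (by
      filter_upwards [h.metric.isOpen.mem_nhds hz] with y hy
      have h1 := h.crdNabla_eq hy v w
      have h2 := (h.hasFDerivAt_phi hy).clm_apply (hasFDerivAt_const (w : E) y)
      rw [crdNablaVec, h2.fderiv]
      simp only [Pi.add_apply, Pi.sub_apply]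
      rw [← h1, crdNabla_apply]
      simp)
  have h1 := h.metric.ricci_identity hz
    (((h.smooth_phi z hz).clm_apply contDiffAt_const).of_le (WithTop.coe_le_coe.2 le_top)) hA u v
  have hV : ∀ v, crdNablaVec G (fun z => Φ z w) z v = G z v w • ξ z - η z w • v
      + Φ z (christoffel G z v w) := fun v => by
    rw [← h.crdNabla_eq hz v w, crdNabla_apply, crdNablaVec,
      ((h.hasFDerivAt_phi hz).clm_apply (hc w)).fderiv]
    simp
  have h2 : ∀ u v, fderiv ℝ Φ z u (christoffel G z v w) =
      G z u (christoffel G z v w) • ξ z - η z (christoffel G z v w) • u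
      - christoffel G z u (Φ z (christoffel G z v w)) + Φ z (christoffel G z u (christoffel G z v w)) := by
    intro u v
    rw [← h.crdNabla_eq hz, crdNabla_apply]
    abel
  have h3 : ∀ u, fderiv ℝ ξ z u = - Φ z u - christoffel G z u (ξ z) := by
    intro u
    rw [← h.crdNablaVec_eq hz, crdNablaVec]
    abel
  have hs := h.metric.symm z hz
  have hk := (h.contactAlg hz).skew
  simp only [hV, h2, h3, add_apply, sub_apply, ContinuousLinearMap.comp_apply,
    ContinuousLinearMap.flip_apply, zero_apply, map_zero, zero_add, smul_apply,
    ContinuousLinearMap.smulRight_apply, h.fderiv_eta hz, h.metric.fderiv_eq hz, map_add, map_sub,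
    map_smul, h.crdNablaVec_eq hz, map_neg, neg_apply, hk, smul_zero] at h1
  rw [← h1]
  simp only [crdCurv, map_add, map_sub]
  rw [h.metric.christoffel_symm hz v u]
  simp only [add_smul, sub_smul, neg_smul, smul_sub, smul_add, smul_neg]
  abel

/-- The curvature tensor of a Sasakian manifold of constant `φ`-sectional curvature. -/
theorem crdCurv_eq (h : IsSasakiOn Φ ξ η G U) (hz : z ∈ U) {c : ℝ}
    (hc : ∀ u, G z u u = 1 → G z u (ξ z) = 0 → G z (crdCurv G z u (Φ z u) (Φ z u)) u = c)
    (x y w : E) : crdCurv G z x y w = spaceFormCurv c (G z) (Φ z) (ξ z) (η z) x y w := by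
  have hs := h.metric.symm z hz
  have ha := h.contactAlg hz
  have hξ := h.crdCurv_xi hz
  set R := spaceFormCurv c (G z) (Φ z) (ξ z) (η z) with hR
  apply ha.eq_of_forall
  intro w'
  rw [← sub_eq_zero]
  have hη : ∀ u, G z (ξ z) u = η z u := fun u => by rw [hs, ← ha.eta_eq]
  have hsk : ∀ u v, G z (Φ z u) v = - G z (Φ z v) u := fun u v => by rw [ha.skew, hs]
  -- The true curvature and the model tensor obey the same inhomogeneous identities for `ξ` and `φ`,
  -- so their difference obeys the homogeneous ones.
  refine ha.kahler_eq_zero (Q := fun x y z' w => G z (crdCurv G z x y z') w - G z (R x y z') w)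
    ?_ ?_ ?_ ?_ ?_ ?_ ?_ ?_ x y w w'
  · intros
    simp only [map_add]
    ring
  · intros
    simp only [map_smul, smul_eq_mul]
    ring
  · intro x y a w
    simp only [crdCurv_skew G z x y, hR, spaceFormCurv, map_add, map_sub, map_neg, map_smul, neg_apply,
      add_apply, sub_apply, smul_apply, smul_eq_mul]
    rw [ha.symm y (Φ z x), hsk x y, ha.symm x (Φ z y)]
    ring
  · intro x y a w
    simp only [h.metric.crdCurv_metric_skew hz x y a w, hR, spaceFormCurv, map_add, map_sub, map_neg,
      map_smul, neg_apply, add_apply, sub_apply, smul_apply, smul_eq_mul, hη]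
    rw [hs a (Φ z y), hs a (Φ z x), hs w (Φ z y), hs w (Φ z x), hsk a w, hs w x, hs w y, hs a x, hs a y]
    ring
  · intro x y a w
    have h1 := congrArg (fun v => G z v w) (h.metric.crdCurv_cyclic hz x y a)
    simp only [map_add, add_apply, map_zero, zero_apply] at h1
    simp only [hR, spaceFormCurv, map_add, map_sub, map_neg,
      map_smul, neg_apply, add_apply, sub_apply, smul_apply, smul_eq_mul, hη]
    rw [hs a (Φ z y), hs a (Φ z x), hs x (Φ z y), hs x (Φ z a), hs y (Φ z a), hs y (Φ z x), hsk y x,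
      hsk a x, hsk a y, hs a x, hs a y, hs y x]
    linear_combination h1
  · intro x y w
    simp only [hξ, hR, spaceFormCurv, map_add, map_sub, map_neg, ha.eta_xi, ha.phi_xi, map_zero,
      zero_apply, ha.eta_phi,
      map_smul, neg_apply, add_apply, sub_apply, smul_apply, smul_eq_mul, hη]
    ring
  · intro x y a w
    simp only [h.crdCurv_phi hz, hR, spaceFormCurv, map_add, map_sub, map_neg, ha.eta_phi, ha.phi_sq,
      map_smul, neg_apply, add_apply, sub_apply, smul_apply, smul_eq_mul, hη, ha.skew]
    simp only [← ha.eta_eq]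
    have hsk' : ∀ u v, G z u (Φ z v) = - G z v (Φ z u) := fun u v => by rw [← ha.skew, hs]
    rw [hsk' a y, hsk' a x, hs a y, hs a x]
    ring
  · intro x hx
    have hx' : G z x (ξ z) = 0 := by rw [← ha.eta_eq, hx]
    have hRx : G z (R x (Φ z x) (Φ z x)) x = c * G z x x ^ 2 := by
      simp only [hR, spaceFormCurv, map_add, map_sub, map_neg, ha.eta_phi, ha.phi_sq, hx, ha.phi_metric,
        map_smul, neg_apply, add_apply, sub_apply, smul_apply, smul_eq_mul, hη, ha.skew, ha.met_phi_self]
      ring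
    change G z (crdCurv G z x (Φ z x) (Φ z x)) x - G z (R x (Φ z x) (Φ z x)) x = 0
    rw [hRx]
    by_cases h0 : x = 0
    · simp [h0]
    have hp := ha.pos x h0
    -- The curvature hypothesis concerns unit vectors only; both sides are homogeneous of degree
    -- four in `x`, so rescaling suffices.
    set a := (Real.sqrt (G z x x))⁻¹ with ha'
    have hsq : a ^ 2 * G z x x = 1 := by
      rw [ha', inv_pow, Real.sq_sqrt hp.le, inv_mul_cancel₀ hp.ne']
    have hsm : ∀ (a : ℝ) x, crdCurv G z (a • x) (a • Φ z x) (a • Φ z x)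
        = a ^ 3 • crdCurv G z x (Φ z x) (Φ z x) := by
      intro a x
      simp only [crdCurv, map_smul, smul_apply, smul_sub, smul_add, smul_smul]
      ring_nf
    have h1 := hc (a • x) (by simpa [pow_two, mul_assoc] using hsq) (by simp [hx'])
    simp only [map_smul, hsm, smul_apply, smul_eq_mul] at h1
    have h2 : a ^ 4 * G z (crdCurv G z x (Φ z x) (Φ z x)) x = c := by rw [← h1]; ring
    have h3 : a ^ 4 * G z x x ^ 2 = 1 := by rw [← one_pow 2, ← hsq]; ring
    have h4 : a ^ 4 ≠ 0 := fun h0 => by rw [h0] at h3; simp at h3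
    apply mul_left_cancel₀ h4
    linear_combination h2 - c * h3

end IsSasakiOn

end SasakiCurvature

/-! ## Sasakian manifolds in charts -/

section Charts

variable {m : ℕ} {N : Type*} [TopologicalSpace N]
  [ChartedSpace (EuclideanSpace ℝ (Fin m)) N] [IsManifold (𝓡 m) ∞ N]

/-- An endomorphism field, with values in the endomorphisms of the model space. -/
def endo (φ : (y : N) → TangentSpace (𝓡 m) y →L[ℝ] TangentSpace (𝓡 m) y) (y : N) :
    Model m →L[ℝ] Model m := φ y

/-- A 1-form, with values in the dual of the model space. -/
def form (η : (y : N) → TangentSpace (𝓡 m) y →L[ℝ] ℝ) (y : N) : Model m →L[ℝ] ℝ := η y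

/-- A vector field, with values in the model space. -/
def vec (ξ : (y : N) → TangentSpace (𝓡 m) y) (y : N) : Model m := ξ y

/-- An endomorphism field, read in the chart at `x`. -/
def crdEndo (φ : (y : N) → TangentSpace (𝓡 m) y →L[ℝ] TangentSpace (𝓡 m) y) (x : N) (z : Model m) :
    Model m →L[ℝ] Model m :=
  (toCoord m x ((crd m x).symm z)).comp
    ((endo φ ((crd m x).symm z)).comp (ofCoord m x ((crd m x).symm z)))

/-- A 1-form, read in the chart at `x`. -/
def crdForm (η : (y : N) → TangentSpace (𝓡 m) y →L[ℝ] ℝ) (x : N) (z : Model m) : Model m →L[ℝ] ℝ :=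
  (form η ((crd m x).symm z)).comp (ofCoord m x ((crd m x).symm z))

/-- The vector field which is constant in the chart at `x`. -/
def constVec (x : N) (a : Model m) : N → Model m := fun y => ofCoord m x y a

variable {φ : (y : N) → TangentSpace (𝓡 m) y →L[ℝ] TangentSpace (𝓡 m) y}
  {ξ : (y : N) → TangentSpace (𝓡 m) y} {η : (y : N) → TangentSpace (𝓡 m) y →L[ℝ] ℝ}
  {g : RiemMetric m N} {x y : N}

lemma crdEndo_crd (φ : (y : N) → TangentSpace (𝓡 m) y →L[ℝ] TangentSpace (𝓡 m) y)
    (h : y ∈ (crd m x).source) (u : Model m) :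
    crdEndo φ x (crd m x y) u = toCoord m x y (endo φ y (ofCoord m x y u)) := by
  simp only [crdEndo, ContinuousLinearMap.comp_apply]
  rw [(crd m x).left_inv h]

lemma crdForm_crd (η : (y : N) → TangentSpace (𝓡 m) y →L[ℝ] ℝ)
    (h : y ∈ (crd m x).source) (u : Model m) :
    crdForm η x (crd m x y) u = form η y (ofCoord m x y u) := by
  simp only [crdForm, ContinuousLinearMap.comp_apply]
  rw [(crd m x).left_inv h]

lemma crdField_constVec (a : Model m) {z : Model m} (hz : z ∈ (crd m x).target) :
    crdField m x (constVec x a) z = a :=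
  toCoord_ofCoord ((crd m x).map_target hz) a

lemma IsContactMetric.contDiffOn_crdEndo (h : IsContactMetric φ ξ η g) (x : N) :
    ContDiffOn ℝ ∞ (crdEndo φ x) (crd m x).target := by
  rw [contDiffOn_clm_apply]
  intro a z hz
  apply ContDiffAt.contDiffWithinAt
  have hy := (crd m x).map_target hz
  have ha := smoothVF_ofCoord hy a
  have h1 : SmoothVF m (fun y => endo φ y (constVec x a y)) ((crd m x).symm z) :=
    ContMDiffAt.clm_bundle_apply (F₁ := Model m) (F₂ := Model m)
      (E₁ := (TangentSpace (𝓡 m) : N → Type _)) (E₂ := (TangentSpace (𝓡 m) : N → Type _)) h.smooth_phi.contMDiffAt ha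
  have h2 := (smoothVF_iff hy).1 h1
  rwa [(crd m x).right_inv hz] at h2

lemma IsContactMetric.contDiffOn_crdForm (h : IsContactMetric φ ξ η g) (x : N) :
    ContDiffOn ℝ ∞ (crdForm η x) (crd m x).target := by
  rw [contDiffOn_clm_apply]
  intro a z hz
  apply ContDiffAt.contDiffWithinAt
  have hy := (crd m x).map_target hz
  have ha := smoothVF_ofCoord hy a
  have h1 := ContMDiffAt.clm_bundle_apply (F₁ := Model m) (F₂ := ℝ) (E₂ := fun _ : N => ℝ)
    h.smooth_eta.contMDiffAt ha
  rw [Bundle.contMDiffAt_totalSpace] at h1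
  have h2 := (contMDiffAt_iff_crd hy).1 h1.2
  rw [(crd m x).right_inv hz] at h2
  exact h2

lemma extDeriv_eq (η : (y : N) → TangentSpace (𝓡 m) y →L[ℝ] ℝ) (X Y : N → Model m) (y : N) :
    extDeriv₁ η X Y y = (1 / 2) * (mvfderiv (𝓡 m) (fun y => form η y (Y y)) y (X y)
      - mvfderiv (𝓡 m) (fun y => form η y (X y)) y (Y y) - form η y (brk m X Y y)) := rfl

lemma crdField_constVec_eventuallyEq (h : y ∈ (crd m x).source) (a : Model m) :
    crdField m x (constVec x a) =ᶠ[nhds (crd m x y)] fun _ => a := by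
  filter_upwards [crd_target_mem_nhds h] with z hz using crdField_constVec a hz

lemma brk_constVec (h : y ∈ (crd m x).source) (a b : Model m) :
    brk m (constVec x a) (constVec x b) y = 0 := by
  have ha := crdField_constVec_eventuallyEq h a
  have hb := crdField_constVec_eventuallyEq h b
  have h1 := toCoord_mlieBracket h (ha.differentiableAt_iff.2 (differentiableAt_const a))
    (hb.differentiableAt_iff.2 (differentiableAt_const b))
  rw [ha.fderiv_eq, hb.fderiv_eq] at h1
  rw [← ofCoord_toCoord h (brk m _ _ y), h1]
  simp

lemma IsContactMetric.extDeriv_constVec (hS : IsContactMetric φ ξ η g) (h : y ∈ (crd m x).source)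
    (a b : Model m) : extDeriv₁ η (constVec x a) (constVec x b) y =
      (1 / 2) * (fderiv ℝ (crdForm η x) (crd m x y) a b - fderiv ℝ (crdForm η x) (crd m x y) b a) := by
  have hz := (crd m x).map_source h
  have hd : DifferentiableAt ℝ (crdForm η x) (crd m x y) :=
    ((hS.contDiffOn_crdForm x).contDiffAt (crd_target_mem_nhds h)).differentiableAt (by simp)
  have key : ∀ a b : Model m, mvfderiv (𝓡 m) (fun y => form η y (constVec x b y)) y (constVec x a y)
      = fderiv ℝ (crdForm η x) (crd m x y) a b := by
    intro a b
    have e : (fun y => form η y (constVec x b y)) ∘ (crd m x).symm = fun z => crdForm η x z b := rfl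
    have hd' := hd.hasFDerivAt.clm_apply (hasFDerivAt_const b (crd m x y))
    have hm : MDifferentiableAt (𝓡 m) 𝓘(ℝ, ℝ) (fun y => form η y (constVec x b y)) y := by
      rw [mdifferentiableAt_iff_crd h, e]
      exact hd'.differentiableAt
    rw [mvfderiv_eq h hm, e, hd'.fderiv, constVec, toCoord_ofCoord h]
    simp
  rw [extDeriv_eq, key, key, brk_constVec h, map_zero, sub_zero]

/-- The Nijenhuis tensor is evaluated on coordinate-constant fields. Their own brackets vanish, and
only derivatives of `φ` remain. -/
lemma IsSasakian.normal_crd (hS : IsSasakian φ ξ η g) (h : y ∈ (crd m x).source) (a b : Model m) :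
    fderiv ℝ (crdEndo φ x) (crd m x y) (crdEndo φ x (crd m x y) a) b
      - fderiv ℝ (crdEndo φ x) (crd m x y) (crdEndo φ x (crd m x y) b) a
      + crdEndo φ x (crd m x y) (fderiv ℝ (crdEndo φ x) (crd m x y) b a)
      - crdEndo φ x (crd m x y) (fderiv ℝ (crdEndo φ x) (crd m x y) a b)
      + (2 * extDeriv₁ η (constVec x a) (constVec x b) y) • crdField m x ξ (crd m x y) = 0 := by
  have hc := fun a : Model m => crdField_constVec_eventuallyEq h a
  have hc' := fun a : Model m => (hc a).differentiableAt_iff.2 (differentiableAt_const (𝕜 := ℝ) a)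
  have hd : DifferentiableAt ℝ (crdEndo φ x) (crd m x y) :=
    ((hS.contDiffOn_crdEndo x).contDiffAt (crd_target_mem_nhds h)).differentiableAt (by simp)
  have hd' := fun b : Model m => hd.hasFDerivAt.clm_apply (hasFDerivAt_const b (crd m x y))
  have hE : ∀ a : Model m, crdField m x (fun y => endo φ y (constVec x a y))
    = fun z => crdEndo φ x z a := fun a => rfl
  have hE' : ∀ a : Model m, DifferentiableAt ℝ
      (crdField m x (fun y => endo φ y (constVec x a y))) (crd m x y) := fun a => by
    rw [hE]
    exact (hd' a).differentiableAt
  have hN : brk m (fun y => endo φ y (constVec x a y)) (fun y => endo φ y (constVec x b y)) y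
        - endo φ y (brk m (fun y => endo φ y (constVec x a y)) (constVec x b) y)
        - endo φ y (brk m (constVec x a) (fun y => endo φ y (constVec x b y)) y)
        + endo φ y (endo φ y (brk m (constVec x a) (constVec x b) y))
        + (2 * extDeriv₁ η (constVec x a) (constVec x b) y) • vec ξ y = 0 :=
    hS.normal (constVec x a) (constVec x b) y (smoothVF_ofCoord h a) (smoothVF_ofCoord h b)
  have h1 := congrArg (toCoord m x y) hN
  have hte : ∀ v, toCoord m x y (endo φ y v) = crdEndo φ x (crd m x y) (toCoord m x y v) := fun v => by
    rw [crdEndo_crd φ h, ofCoord_toCoord h]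
  have hcv : ∀ a, toCoord m x y (constVec x a y) = a := fun a => toCoord_ofCoord h a
  simp only [map_add, map_sub, map_smul, hte, toCoord_mlieBracket h (hE' _) (hE' _),
    toCoord_mlieBracket h (hE' _) (hc' _), toCoord_mlieBracket h (hc' _) (hE' _),
    toCoord_mlieBracket h (hc' _) (hc' _), hE, (hd' _).fderiv, (hc _).fderiv_eq, hcv,
    fderiv_fun_const, add_apply, ContinuousLinearMap.comp_apply, ContinuousLinearMap.flip_apply,
    zero_apply, map_zero, Pi.zero_apply] at h1
  have h2 : crdField m x ξ (crd m x y) = toCoord m x y (vec ξ y) := crdField_crd _ h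
  rw [h2, ← h1]
  abel

/-- A Sasakian structure, read in a chart. -/
lemma IsSasakian.isSasakiOn (hS : IsSasakian φ ξ η g) (x : N) :
    IsSasakiOn (crdEndo φ x) (crdField m x ξ) (crdForm η x) (crdMetric g x) (crd m x).target := by
  have key : ∀ P : Model m → Prop, (∀ y ∈ (crd m x).source, P (crd m x y)) →
      ∀ z ∈ (crd m x).target, P z := fun P hP z hz => by
    rw [← (crd m x).right_inv hz]
    exact hP _ ((crd m x).map_target hz)
  have hxi : ∀ y ∈ (crd m x).source, crdField m x ξ (crd m x y) = toCoord m x y (vec ξ y) :=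
    fun y h => crdField_crd _ h
  have hmet : ∀ y (_ : y ∈ (crd m x).source) (u v : Model m), crdMetric g x (crd m x y) u
      (crdEndo φ x (crd m x y) v) = extDeriv₁ η (constVec x u) (constVec x v) y := by
    intro y h u v
    rw [crdEndo_crd _ h, crdMetric_crd g h, ofCoord_toCoord h]
    exact hS.metric_phi (constVec x u) (constVec x v) y (smoothVF_ofCoord h u) (smoothVF_ofCoord h v)
  refine ⟨isMetricOn_crdMetric g x,
    fun z hz => (hS.contDiffOn_crdEndo x).contDiffAt ((crd_target_isOpen m x).mem_nhds hz), ?_,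
    fun z hz => (hS.contDiffOn_crdForm x).contDiffAt ((crd_target_isOpen m x).mem_nhds hz),
    ?_, ?_, ?_, ?_, ?_⟩ <;> apply key <;> intro y h
  · exact (smoothVF_iff h).1 (hS.smooth_xi y)
  · intro u
    rw [crdEndo_crd _ h, crdEndo_crd _ h, crdForm_crd _ h, hxi y h, ofCoord_toCoord h]
    have h1 : endo φ y (endo φ y (ofCoord m x y u)) = - ofCoord m x y u
      + form η y (ofCoord m x y u) • vec ξ y := hS.phi_sq y (ofCoord m x y u)
    rw [h1, map_add, map_neg, map_smul, toCoord_ofCoord h]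
  · rw [crdForm_crd _ h, hxi y h, ofCoord_toCoord h]
    exact hS.eta_xi y
  · intro u v
    rw [crdEndo_crd _ h, crdEndo_crd _ h, crdForm_crd _ h, crdForm_crd _ h, crdMetric_crd g h,
      crdMetric_crd g h, ofCoord_toCoord h, ofCoord_toCoord h]
    exact hS.phi_metric y _ _
  · intro u v
    rw [hmet y h, hS.extDeriv_constVec h]
  · intro u v
    rw [hmet y h]
    exact hS.normal_crd h u v

lemma crdEndo_self (φ : (y : N) → TangentSpace (𝓡 m) y →L[ℝ] TangentSpace (𝓡 m) y) (x : N) :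
    crdEndo φ x (crd m x x) = endo φ x := by
  ext1 u
  rw [crdEndo_crd φ (mem_crd_source m x), toCoord_self, ofCoord_self]

lemma crdForm_self (η : (y : N) → TangentSpace (𝓡 m) y →L[ℝ] ℝ) (x : N) :
    crdForm η x (crd m x x) = form η x := by
  ext1 u
  rw [crdForm_crd η (mem_crd_source m x), ofCoord_self]

lemma crdField_self (ξ : (y : N) → TangentSpace (𝓡 m) y) (x : N) :
    crdField m x ξ (crd m x x) = vec ξ x := by
  have : crdField m x ξ (crd m x x) = toCoord m x x (vec ξ x) := crdField_crd _ (mem_crd_source m x)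
  rw [this, toCoord_self]

lemma IsSasakian.contactAlg (hS : IsSasakian φ ξ η g) (x : N) :
    IsContactAlg (met g x) (endo φ x) (vec ξ x) (form η x) := by
  have := (hS.isSasakiOn x).contactAlg ((crd m x).map_source (mem_crd_source m x))
  rwa [crdEndo_self, crdForm_self, crdField_self, ← met_crd] at this

/-- The curvature tensor of a Sasakian space form. -/
theorem IsSasakian.curv_eq (hS : IsSasakian φ ξ η g) {c : ℝ} (hc : HasPhiSectionalCurvature φ ξ g c)
    (x : N) (u v w : Model m) : curv g x u v w =
      spaceFormCurv c (met g x) (endo φ x) (vec ξ x) (form η x) u v w := by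
  have h := (hS.isSasakiOn x).crdCurv_eq ((crd m x).map_source (mem_crd_source m x)) (c := c) (by
    intro u h1 h2
    rw [crdField_self, ← met_crd] at h2
    rw [← met_crd] at h1
    rw [crdEndo_self, ← curv_crd, ← met_crd]
    have h3 : met g x (curv g x u (endo φ x u) (endo φ x u)) u
        / (met g x u u * met g x (endo φ x u) (endo φ x u) - met g x u (endo φ x u) ^ 2) = c :=
      hc x u h1 h2
    have ha := hS.contactAlg x
    -- A unit vector orthogonal to `ξ` and its image under `φ` are orthonormal, so the denominator
    -- of the sectional curvature is `1`.
    rw [ha.phi_metric, ha.met_phi_self, h1, ha.eta_eq, h2] at h3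
    simpa using h3) u v w
  rwa [crdEndo_self, crdForm_self, crdField_self, ← met_crd, ← curv_crd] at h

end Charts

/-! ## The Boothby-Wang fibration -/

section Composition

variable {m k l : ℕ} {M : Type*} [TopologicalSpace M]
  [ChartedSpace (EuclideanSpace ℝ (Fin m)) M] [IsManifold (𝓡 m) ∞ M]
  {N : Type*} [TopologicalSpace N]
  [ChartedSpace (EuclideanSpace ℝ (Fin k)) N] [IsManifold (𝓡 k) ∞ N]
  {P : Type*} [TopologicalSpace P]
  [ChartedSpace (EuclideanSpace ℝ (Fin l)) P] [IsManifold (𝓡 l) ∞ P]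

lemma dmap_comp {h : N → P} {f : M → N} (hh : ContMDiff (𝓡 k) (𝓡 l) ∞ h)
    (hf : ContMDiff (𝓡 m) (𝓡 k) ∞ f) (x : M) (v : Model m) :
    (dmap (h ∘ f) x v : Model l) = dmap h (f x) (dmap f x v : Model k) :=
  congrArg (fun L : Model m →L[ℝ] Model l => L v)
    (mfderiv_comp x (hh.mdifferentiableAt (by simp)) (hf.mdifferentiableAt (by simp)))

/-- The second covariant derivative of a composition. -/
lemma sff_comp (g : RiemMetric m M) (g' : RiemMetric k N) (g'' : RiemMetric l P) {h : N → P}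
    {f : M → N} (hh : ContMDiff (𝓡 k) (𝓡 l) ∞ h) (hf : ContMDiff (𝓡 m) (𝓡 k) ∞ f) (x : M)
    (u v : Model m) : sff g g'' (h ∘ f) x u v = dmap h (f x) (sff g g' f x u v)
      + sff g' g'' h (f x) (dmap f x u) (dmap f x v) := by
  have hx := mem_crd_source m x
  have hq := mem_crd_source k (f x)
  have hp := mem_crd_source l (h (f x))
  have e : crdMap m l x (h (f x)) (h ∘ f) =ᶠ[nhds (crd m x x)]
      crdMap k l (f x) (h (f x)) h ∘ crdMap m k x (f x) f := by
    filter_upwards [eventually_mem_source hx hq hf.continuous.continuousAt] with z hz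
    simp only [crdMap, Function.comp_apply]
    rw [(crd k (f x)).left_inv hz.2]
  have hz : crdMap m k x (f x) f (crd m x x) = crd k (f x) (f x) := crdMap_crd hx
  have h1 : ContDiffAt ℝ 2 (crdMap m k x (f x) f) (crd m x x) :=
    (contDiffAt_crdMap hx hq hf.contMDiffAt).of_le (WithTop.coe_le_coe.2 le_top)
  have h2 : ContDiffAt ℝ 2 (crdMap k l (f x) (h (f x)) h) (crdMap m k x (f x) f (crd m x x)) := by
    rw [hz]
    exact (contDiffAt_crdMap hq hp hh.contMDiffAt).of_le (WithTop.coe_le_coe.2 le_top)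
  have key := crdSff_comp (G := crdMetric g x) (H := crdMetric g' (f x))
    (L := crdMetric g'' (h (f x))) h1 h2 u v
  rw [hz, ← dmap_crd hh, ← sff_crd g g' hf, ← dmap_crd hf, ← sff_crd g' g'' hh] at key
  rw [← key, sff_crd g g'' (hh.comp hf)]
  simp only [crdSff, Function.comp_apply]
  rw [e.fderiv.fderiv_eq, e.fderiv_eq, e.self_of_nhds]
  rfl

end Composition

/-! ### Differential and second fundamental form of the projection to the orbit space. -/

section Fibration

variable {m k : ℕ} {N : Type*} [TopologicalSpace N]
  [ChartedSpace (EuclideanSpace ℝ (Fin m)) N] [IsManifold (𝓡 m) ∞ N]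
  {φ : (y : N) → TangentSpace (𝓡 m) y →L[ℝ] TangentSpace (𝓡 m) y}
  {ξ : (y : N) → TangentSpace (𝓡 m) y} {η : (y : N) → TangentSpace (𝓡 m) y →L[ℝ] ℝ}
  {g : RiemMetric m N}
  [ChartedSpace (EuclideanSpace ℝ (Fin k)) (OrbitSpace ξ)] [IsManifold (𝓡 k) ∞ (OrbitSpace ξ)]
  {gbar : RiemMetric k (OrbitSpace ξ)}

/-- The projection to the orbit space maps the field to zero. -/
lemma dmap_orbitProj_vec (hξ : ∀ x, SmoothFieldAt ξ x)
    (hπ : ContMDiff (𝓡 m) (𝓡 k) ∞ (orbitProj ξ)) (x : N) :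
    (dmap (orbitProj ξ) x (vec ξ x) : Model k) = 0 := by
  have hM : IsManifold (𝓡 m) 1 N := IsManifold.of_le (n := ∞) (WithTop.coe_le_coe.2 le_top)
  have hx1 : ContMDiffAt (𝓡 m) (𝓡 m).tangent 1 (fun y => (⟨y, ξ y⟩ : TangentBundle (𝓡 m) N)) x :=
    (hξ x).of_le (WithTop.coe_le_coe.2 le_top)
  obtain ⟨γ, hγ0, hγ⟩ := exists_isMIntegralCurveAt_of_contMDiffAt_boundaryless 0 hx1
  obtain ⟨ε, hε, hγε⟩ := isMIntegralCurveAt_iff'.1 hγ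
  rw [Real.ball_eq_Ioo] at hγε
  have h0 : (0 : ℝ) ∈ Set.Ioo (0 - ε) (0 + ε) := by constructor <;> linarith
  -- An integral curve stays in one orbit by construction, so its projection is constant and has
  -- zero derivative.
  have hconst : orbitProj ξ ∘ γ =ᶠ[nhds 0] fun _ => orbitProj ξ x := by
    filter_upwards [isOpen_Ioo.mem_nhds h0] with t ht
    exact Quotient.sound (Relation.EqvGen.rel _ _
      ⟨γ, 0 - ε, 0 + ε, hγε, ⟨t, ht, rfl⟩, ⟨0, h0, hγ0⟩⟩)
  have h1 := hγ.hasMFDerivAt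
  have h2 : HasMFDerivAt (𝓡 m) (𝓡 k) (orbitProj ξ) (γ 0) (mfderiv (𝓡 m) (𝓡 k) (orbitProj ξ) (γ 0)) :=
    (hπ.mdifferentiableAt (by simp)).hasMFDerivAt
  have h3 := h2.comp 0 h1
  have h4 := (hasMFDerivAt_const (I := 𝓘(ℝ, ℝ)) (I' := 𝓡 k) (orbitProj ξ x) (0 : ℝ)).congr_of_eventuallyEq
    hconst
  have h5 := hasMFDerivAt_unique h3 h4
  have h6 : (dmap (orbitProj ξ) (γ 0) (vec ξ (γ 0)) : Model k) = 0 := by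
    have h7 := congrArg (fun L : ℝ →L[ℝ] Model k => L 1) h5
    have h8 : ((1 : ℝ) • vec ξ (γ 0)) = vec ξ (γ 0) := one_smul ℝ _
    rw [← h8]
    exact h7
  rwa [hγ0] at h6

/-- The pull-back of the metric of the orbit space. -/
lemma IsBoothbyWang.met_dmap (hπ : IsBoothbyWang ξ η g gbar) (hS : IsSasakian φ ξ η g) (x : N)
    (u v : Model m) : met gbar (orbitProj ξ x) (dmap (orbitProj ξ) x u) (dmap (orbitProj ξ) x v)
      = met g x u v - form η x u * form η x v := by
  have ha := hS.contactAlg x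
  have hv := dmap_orbitProj_vec hS.smooth_xi hπ.contMDiff x
  have e : ∀ u : Model m, (dmap (orbitProj ξ) x u : Model k)
      = dmap (orbitProj ξ) x (u - form η x u • vec ξ x) := by
    intro u
    rw [map_sub, map_smul, hv, smul_zero, sub_zero]
  have e' : ∀ u : Model m, form η x (u - form η x u • vec ξ x) = 0 := by
    intro u
    rw [map_sub, map_smul, ha.eta_xi, smul_eq_mul, mul_one, sub_self]
  have h1 : met gbar (orbitProj ξ x) (dmap (orbitProj ξ) x (u - form η x u • vec ξ x))
      (dmap (orbitProj ξ) x (v - form η x v • vec ξ x))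
      = met g x (u - form η x u • vec ξ x) (v - form η x v • vec ξ x) :=
    hπ.isometric x _ _ (e' u) (e' v)
  rw [e u, e v, h1]
  simp only [map_sub, map_smul, sub_apply, smul_apply, smul_eq_mul, ha.met_xi_xi, ← ha.eta_eq,
    met_symm g x (vec ξ x)]
  ring

/-- The second fundamental form of the Boothby-Wang fibration. -/
lemma IsBoothbyWang.sff_orbitProj (hπ : IsBoothbyWang ξ η g gbar) (hS : IsSasakian φ ξ η g) (x : N)
    (u v : Model m) : sff g gbar (orbitProj ξ) x u v
      = dmap (orbitProj ξ) x (form η x u • endo φ x v + form η x v • endo φ x u) := by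
  have hx := mem_crd_source m x
  have hq := mem_crd_source k (orbitProj ξ x)
  have hz := (crd m x).map_source hx
  have hSx := hS.isSasakiOn x
  have hf0 : crdMap m k x (orbitProj ξ x) (orbitProj ξ) (crd m x x)
    = crd k (orbitProj ξ x) (orbitProj ξ x) := crdMap_crd hx
  have hev : ∀ᶠ z in nhds (crd m x x), ∀ v w,
      crdMetric gbar (orbitProj ξ x) (crdMap m k x (orbitProj ξ x) (orbitProj ξ) z)
      (fderiv ℝ (crdMap m k x (orbitProj ξ x) (orbitProj ξ)) z v)
      (fderiv ℝ (crdMap m k x (orbitProj ξ x) (orbitProj ξ)) z w)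
      = crdMetric g x z v w - crdForm η x z v * crdForm η x z w := by
    filter_upwards [eventually_crdMetric_dmap gbar hπ.contMDiff x] with z hz v w
    rw [hz, hπ.met_dmap hS]
    rfl
  have hH := isMetricOn_crdMetric gbar (orbitProj ξ x)
  have hfz : crdMap m k x (orbitProj ξ x) (orbitProj ξ) (crd m x x) ∈ (crd k (orbitProj ξ x)).target := by
    rw [hf0]
    exact (crd k _).map_source hq
  have hf : ContDiffAt ℝ 2 (crdMap m k x (orbitProj ξ x) (orbitProj ξ)) (crd m x x) :=
    (contDiffAt_crdMap hx hq hπ.contMDiff.contMDiffAt).of_le (WithTop.coe_le_coe.2 le_top)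
  have ha := hS.contactAlg x
  have hΓ := (isMetricOn_crdMetric g x).fderiv_eq hz
  have hη := hSx.fderiv_eta hz
  simp only [hSx.crdNablaVec_eq hz] at hη
  rw [crdForm_self, crdEndo_self, ← met_crd] at hη
  rw [← met_crd] at hΓ
  -- The covariant derivative of `π^* ḡ = g - η ⊗ η`, computed with `∇ξ = -φ`.
  have key : ∀ u v w : Model m, met gbar (orbitProj ξ x) (sff g gbar (orbitProj ξ) x u v)
      (dmap (orbitProj ξ) x w) + met gbar (orbitProj ξ x) (sff g gbar (orbitProj ξ) x u w)
      (dmap (orbitProj ξ) x v) = met g x (endo φ x u) v * form η x w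
        + form η x v * met g x (endo φ x u) w := by
    intro u v w
    have h1 := inner_crdSff_add hH hfz hf (crdMetric g x) (hev.mono fun z hz => hz v w) u
    have hc := fun v => hasFDerivAt_const (𝕜 := ℝ) (v : Model m) (crd m x x)
    have h2 := (((hSx.hasFDerivAt_metric hz).clm_apply (hc v)).clm_apply (hc w)).sub
      (((hSx.hasFDerivAt_eta hz).clm_apply (hc v)).mul ((hSx.hasFDerivAt_eta hz).clm_apply (hc w)))
    have h3 : fderiv ℝ (fun z => crdMetric g x z v w - crdForm η x z v * crdForm η x z w)
      (crd m x x) u = fderiv ℝ (crdMetric g x) (crd m x x) u v w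
        - (form η x v * fderiv ℝ (crdForm η x) (crd m x x) u w
          + form η x w * fderiv ℝ (crdForm η x) (crd m x x) u v) := by
      rw [← crdForm_self]
      refine (congrArg (fun L => L u) h2.fderiv).trans ?_
      simp
    rw [h3, hf0, ← met_crd, ← dmap_crd hπ.contMDiff, ← sff_crd g gbar hπ.contMDiff,
      ← sff_crd g gbar hπ.contMDiff, hπ.met_dmap hS, hπ.met_dmap hS, hη, hη, hΓ,
      met_symm gbar _ (dmap (orbitProj ξ) x v)] at h1
    rw [h1]
    simp only [map_neg, neg_apply]
    ring
  have hsym : ∀ u v : Model m, sff g gbar (orbitProj ξ) x u v = sff g gbar (orbitProj ξ) x v u := by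
    intro u v
    rw [sff_crd g gbar hπ.contMDiff, sff_crd g gbar hπ.contMDiff,
      crdSff_symm (isMetricOn_crdMetric g x) hH hz hfz hf]
  -- Because `∇dπ` is symmetric and `dπ` is onto, the pairing with `dπ(w)` follows from three
  -- permutations of `key`, as in the Koszul formula.
  apply met_eq_of_forall gbar
  intro w'
  obtain ⟨w, rfl⟩ : ∃ w : Model m, dmap (orbitProj ξ) x w = w' := hπ.submersion x w'
  rw [hπ.met_dmap hS]
  have k1 := key u v w
  have k2 := key v u w
  have k3 := key w u v
  rw [hsym v u] at k2
  rw [hsym w u, hsym w v] at k3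
  have hsk : ∀ u v, met g x (endo φ x u) v = - met g x (endo φ x v) u := fun u v => by
    rw [ha.skew, met_symm]
  rw [hsk v u] at k2
  rw [hsk w u, hsk w v] at k3
  simp only [map_add, map_smul, ha.eta_phi, add_apply, smul_apply, smul_eq_mul]
  linarith

end Fibration

/-! ## Hopf cylinders -/

section Hopf

variable {mN mC mB k : ℕ} {N : Type*} [TopologicalSpace N]
  [ChartedSpace (EuclideanSpace ℝ (Fin mN)) N] [IsManifold (𝓡 mN) ∞ N]
  {φ : (y : N) → TangentSpace (𝓡 mN) y →L[ℝ] TangentSpace (𝓡 mN) y}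
  {ξ : (y : N) → TangentSpace (𝓡 mN) y} {η : (y : N) → TangentSpace (𝓡 mN) y →L[ℝ] ℝ}
  {g : RiemMetric mN N}
  [ChartedSpace (EuclideanSpace ℝ (Fin k)) (OrbitSpace ξ)] [IsManifold (𝓡 k) ∞ (OrbitSpace ξ)]
  {gbar : RiemMetric k (OrbitSpace ξ)}
  {B : Type*} [TopologicalSpace B]
  [ChartedSpace (EuclideanSpace ℝ (Fin mB)) B] [IsManifold (𝓡 mB) ∞ B]
  {gB : RiemMetric mB B} {ι : B → OrbitSpace ξ}
  {C : Type*} [TopologicalSpace C]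
  [ChartedSpace (EuclideanSpace ℝ (Fin mC)) C] [IsManifold (𝓡 mC) ∞ C]
  {gC : RiemMetric mC C} {b : C → B} {i : C → N}

/-- `C` is a hypersurface of the Sasakian manifold `N` that lies over the hypersurface `B` of the
orbit space. -/
structure IsHopf (φ : (y : N) → TangentSpace (𝓡 mN) y →L[ℝ] TangentSpace (𝓡 mN) y)
    (η : (y : N) → TangentSpace (𝓡 mN) y →L[ℝ] ℝ) (g : RiemMetric mN N)
    (gbar : RiemMetric k (OrbitSpace ξ)) (gB : RiemMetric mB B) (ι : B → OrbitSpace ξ)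
    (gC : RiemMetric mC C) (b : C → B) (i : C → N) : Prop where
  sasakian : IsSasakian φ ξ η g
  fibration : IsBoothbyWang ξ η g gbar
  hypersurface : IsIsometricImmersion gB gbar ι
  immersion : IsIsometricImmersion gC g i
  smooth_base : ContMDiff (𝓡 mC) (𝓡 mB) ∞ b
  comm : ∀ x, orbitProj ξ (i x) = ι (b x)
  dim_base : mC = mB + 1
  dim_total : mN = mC + 1

namespace IsHopf

lemma comp_eq (h : IsHopf φ η g gbar gB ι gC b i) : orbitProj ξ ∘ i = ι ∘ b := funext h.comm

lemma dmap_comm (h : IsHopf φ η g gbar gB ι gC b i) (x : C) (u : Model mC) :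
    (dmap (orbitProj ξ) (i x) (dmap i x u : Model mN) : Model k)
      = dmap ι (b x) (dmap b x u : Model mB) := by
  rw [← dmap_comp h.fibration.contMDiff h.immersion.contMDiff, h.comp_eq,
    dmap_comp h.hypersurface.contMDiff h.smooth_base]

lemma met_dmap_base (h : IsHopf φ η g gbar gB ι gC b i) (x : C) (u v : Model mC) :
    met gB (b x) (dmap b x u) (dmap b x v) = met gC x u v
      - form η (i x) (dmap i x u) * form η (i x) (dmap i x v) := by
  rw [← met_dmap h.hypersurface, ← h.dmap_comm, ← h.dmap_comm, ← h.comm,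
    h.fibration.met_dmap h.sasakian, met_dmap h.immersion]

/-- If `db(u) = 0`, then `|di(u)|² = η(di(u))²`, so the horizontal part of `di(u)` has length zero.
-/
lemma eq_smul_of_dmap_base_eq_zero (h : IsHopf φ η g gbar gB ι gC b i) (x : C) {u : Model mC}
    (hu : (dmap b x u : Model mB) = 0) :
    (dmap i x u : Model mN) = form η (i x) (dmap i x u) • vec ξ (i x) := by
  have ha := h.sasakian.contactAlg (i x)
  have h1 := h.met_dmap_base x u u
  rw [hu, map_zero, ← met_dmap h.immersion] at h1
  rw [← sub_eq_zero]
  by_contra hne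
  have h2 := ha.pos _ hne
  simp only [map_sub, map_smul, sub_apply, smul_apply, smul_eq_mul, ha.met_xi_xi, ← ha.eta_eq,
    met_symm g (i x) (vec ξ (i x))] at h2
  linarith

/-- The kernel of `db` is nonzero for dimension reasons, and each of its vectors is sent to a
multiple of `ξ`; so `ξ` is tangent to the cylinder. -/
lemma exists_dmap_eq_vec (h : IsHopf φ η g gbar gB ι gC b i) (x : C) :
    ∃ v : Model mC, (dmap i x v : Model mN) = vec ξ (i x) ∧ (dmap b x v : Model mB) = 0 := by
  have h0 : LinearMap.ker ((dmap b x : Model mC →L[ℝ] Model mB) : Model mC →ₗ[ℝ] Model mB) ≠ ⊥ :=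
    LinearMap.ker_ne_bot_of_finrank_lt (by simp [h.dim_base])
  obtain ⟨u, hu, hu0⟩ := Submodule.exists_mem_ne_zero_of_ne_bot h0
  have hu' : (dmap b x u : Model mB) = 0 := hu
  have h1 := h.eq_smul_of_dmap_base_eq_zero x hu'
  have h2 : form η (i x) (dmap i x u) ≠ 0 := by
    intro h2
    have h3 := met_pos gC x hu0
    rw [← met_dmap h.immersion, h1, h2] at h3
    simp at h3
  refine ⟨(form η (i x) (dmap i x u))⁻¹ • u, ?_, by rw [map_smul, hu', smul_zero]⟩
  rw [map_smul]
  conv_lhs => rw [h1]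
  rw [smul_smul, map_smul, (h.sasakian.contactAlg (i x)).eta_xi, smul_eq_mul, mul_one,
    inv_mul_cancel₀ h2, one_smul]

/-- The kernel of `db` is spanned by the Reeb direction, and `dim C = dim B + 1`. -/
lemma dmap_base_surjective (h : IsHopf φ η g gbar gB ι gC b i) (x : C) :
    Function.Surjective (dmap b x : Model mC → Model mB) := by
  obtain ⟨v, hv, hv'⟩ := h.exists_dmap_eq_vec x
  have hker : LinearMap.ker ((dmap b x : Model mC →L[ℝ] Model mB) : Model mC →ₗ[ℝ] Model mB)
      ≤ Submodule.span ℝ {v} := by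
    intro u hu
    have hu' : (dmap b x u : Model mB) = 0 := hu
    have h1 := h.eq_smul_of_dmap_base_eq_zero x hu'
    refine Submodule.mem_span_singleton.2 ⟨form η (i x) (dmap i x u), ?_⟩
    apply met_eq_of_forall gC x
    intro w
    rw [← met_dmap h.immersion, ← met_dmap h.immersion, map_smul, hv, ← h1]
  have h1 := (Submodule.finrank_mono hker).trans (finrank_span_le_card ({v} : Set (Model mC)))
  have h2 := LinearMap.finrank_range_add_finrank_ker
    ((dmap b x : Model mC →L[ℝ] Model mB) : Model mC →ₗ[ℝ] Model mB)
  have h3 := h.dim_base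
  have h4 := Submodule.finrank_le
    (LinearMap.range ((dmap b x : Model mC →L[ℝ] Model mB) : Model mC →ₗ[ℝ] Model mB))
  simp only [finrank_euclideanSpace, Fintype.card_fin, Set.toFinset_singleton,
    Finset.card_singleton] at h1 h2 h4
  refine LinearMap.range_eq_top.1 (Submodule.eq_top_of_finrank_eq ?_)
  simp only [finrank_euclideanSpace, Fintype.card_fin]
  omega

/-- Dimension count: pairing with the image of `di` has a nontrivial kernel, since `dim N = dim C +
1`. -/
lemma exists_normal (h : IsHopf φ η g gbar gB ι gC b i) (x : C) :
    ∃ ν : Model mN, met g (i x) ν ν = 1 ∧ ∀ u : Model mC, met g (i x) ν (dmap i x u) = 0 := by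
  let L : Model mN →ₗ[ℝ] (Model mC →L[ℝ] ℝ) :=
    { toFun := fun a => (met g (i x) a).comp (dmap i x)
      map_add' := fun a c => by ext; simp
      map_smul' := fun r a => by ext; simp }
  have hfr : Module.finrank ℝ (Model mC →L[ℝ] ℝ) = mC :=
    (LinearEquiv.finrank_eq LinearMap.toContinuousLinearMap).symm.trans
      ((Module.finrank_linearMap_self ℝ ℝ (Model mC)).trans (by simp))
  have h0 : LinearMap.ker L ≠ ⊥ :=
    LinearMap.ker_ne_bot_of_finrank_lt (by simp [hfr, h.dim_total])
  obtain ⟨a, ha, ha0⟩ := Submodule.exists_mem_ne_zero_of_ne_bot h0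
  have ha' : ∀ u : Model mC, met g (i x) a (dmap i x u) = 0 := fun u =>
    congrArg (fun l : Model mC →L[ℝ] ℝ => l u) (LinearMap.mem_ker.1 ha)
  have hp := met_pos g (i x) ha0
  refine ⟨(Real.sqrt (met g (i x) a a))⁻¹ • a, ?_, fun u => by simp [ha']⟩
  have h1 := Real.mul_self_sqrt hp.le
  have h2 := (Real.sqrt_pos.2 hp).ne'
  simp only [map_smul, smul_apply, smul_eq_mul]
  field_simp
  rw [pow_two, h1]

end IsHopf

/-- A frame adapted to a Hopf cylinder: `e` is a horizontal lift of an orthonormal basis of the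
tangent space of the base, `v` is the Reeb direction and `ν` is a unit normal. -/
structure IsHopfFrame (φ : (y : N) → TangentSpace (𝓡 mN) y →L[ℝ] TangentSpace (𝓡 mN) y)
    (η : (y : N) → TangentSpace (𝓡 mN) y →L[ℝ] ℝ) (g : RiemMetric mN N)
    (gbar : RiemMetric k (OrbitSpace ξ)) (gB : RiemMetric mB B) (ι : B → OrbitSpace ξ)
    (gC : RiemMetric mC C) (b : C → B) (i : C → N) (x : C) (e : Fin mB → Model mC) (v : Model mC)
    (ν : Model mN) : Prop where
  hopf : IsHopf φ η g gbar gB ι gC b i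
  ortho : IsOrtho gB (b x) fun j => dmap b x (e j)
  horizontal : ∀ j, form η (i x) (dmap i x (e j)) = 0
  dmap_vert : (dmap i x v : Model mN) = vec ξ (i x)
  dmap_base_vert : (dmap b x v : Model mB) = 0
  met_normal : met g (i x) ν ν = 1
  normal : ∀ u : Model mC, met g (i x) ν (dmap i x u) = 0

lemma IsHopf.exists_frame (h : IsHopf φ η g gbar gB ι gC b i) (x : C) :
    ∃ e v ν, IsHopfFrame φ η g gbar gB ι gC b i x e v ν := by
  obtain ⟨v, hv, hv'⟩ := h.exists_dmap_eq_vec x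
  obtain ⟨ν, hν, hν'⟩ := h.exists_normal x
  obtain ⟨e, he⟩ := exists_isOrtho gB (b x)
  -- Horizontal lifts: the Reeb component of any preimage is removed by subtracting a multiple of
  -- `v`, which does not change its image under `db`.
  have key : ∀ w : Model mB, ∃ u : Model mC, dmap b x u = w ∧ form η (i x) (dmap i x u) = 0 := by
    intro w
    obtain ⟨u, hu⟩ := h.dmap_base_surjective x w
    refine ⟨u - form η (i x) (dmap i x u) • v, ?_, ?_⟩
    · rw [map_sub, map_smul, hv', smul_zero, sub_zero, hu]
    · rw [map_sub, map_smul, hv, map_sub, map_smul, (h.sasakian.contactAlg (i x)).eta_xi, smul_eq_mul,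
        mul_one, sub_self]
  choose l hl hl' using key
  refine ⟨fun j => l (e j), v, ν, h, ?_, fun j => hl' _, hv, hv', hν, hν'⟩
  simpa only [hl] using he

namespace IsHopfFrame

variable {x : C} {e : Fin mB → Model mC} {v : Model mC} {ν : Model mN}

/-- The orthonormal basis of the tangent space of the Hopf cylinder. -/
def frame (e : Fin mB → Model mC) (v : Model mC) (j : Option (Fin mB)) : Model mC := j.elim v e

/-- The orthonormal basis of the tangent space of the ambient manifold. -/
def ambientFrame (i : C → N) (x : C) (e : Fin mB → Model mC) (v : Model mC) (ν : Model mN)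
    (j : Option (Option (Fin mB))) : Model mN := j.elim ν fun j => dmap i x (frame e v j)

lemma contactAlg (h : IsHopfFrame φ η g gbar gB ι gC b i x e v ν) :
    IsContactAlg (met g (i x)) (endo φ (i x)) (vec ξ (i x)) (form η (i x)) :=
  h.hopf.sasakian.contactAlg (i x)

lemma form_normal (h : IsHopfFrame φ η g gbar gB ι gC b i x e v ν) : form η (i x) ν = 0 := by
  rw [h.contactAlg.eta_eq, ← h.dmap_vert, h.normal]

lemma isOrtho_frame (h : IsHopfFrame φ η g gbar gB ι gC b i x e v ν) : IsOrtho gC x (frame e v) := by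
  have key := h.hopf.met_dmap_base x
  have h1 : met gC x v v = 1 := by
    rw [← met_dmap h.hopf.immersion, h.dmap_vert, h.contactAlg.met_xi_xi]
  have h2 : ∀ j, met gC x (e j) v = 0 := by
    intro j
    rw [← met_dmap h.hopf.immersion, h.dmap_vert, ← h.contactAlg.eta_eq, h.horizontal]
  rintro (_ | j) (_ | l)
  · simpa [frame] using h1
  · simpa [frame, met_symm gC x v] using h2 l
  · simpa [frame] using h2 j
  · have h3 := h.ortho j l
    rw [key, h.horizontal, zero_mul, sub_zero] at h3
    simpa [frame] using h3

lemma card_frame (h : IsHopfFrame φ η g gbar gB ι gC b i x e v ν) :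
    Fintype.card (Option (Fin mB)) = mC := by
  simp [h.hopf.dim_base]

lemma isOrtho_ambientFrame (h : IsHopfFrame φ η g gbar gB ι gC b i x e v ν) :
    IsOrtho g (i x) (ambientFrame i x e v ν) := by
  rintro (_ | j) (_ | l)
  · simpa [ambientFrame] using h.met_normal
  · simpa [ambientFrame] using h.normal _
  · simpa [ambientFrame, met_symm g (i x) (dmap i x _)] using h.normal _
  · have := h.isOrtho_frame j l
    rw [← met_dmap h.hopf.immersion] at this
    simpa [ambientFrame] using this

lemma card_ambientFrame (h : IsHopfFrame φ η g gbar gB ι gC b i x e v ν) :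
    Fintype.card (Option (Option (Fin mB))) = mN := by
  simp [h.hopf.dim_base, h.hopf.dim_total]

lemma codim_one (h : IsHopfFrame φ η g gbar gB ι gC b i x e v ν) (a : Model mN)
    (ha : ∀ u : Model mC, met g (i x) a (dmap i x u) = 0) (ha' : met g (i x) a ν = 0) : a = 0 := by
  rw [h.isOrtho_ambientFrame.sum_eq h.card_ambientFrame a]
  refine Finset.sum_eq_zero fun j _ => ?_
  rcases j with _ | j
  · simp [ambientFrame, ha']
  · simp [ambientFrame, ha]

/-- The vector is lifted through the submersion; the horizontal part of the lift is orthogonal to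
the cylinder and to `ν`, hence zero. -/
lemma codim_one_base (h : IsHopfFrame φ η g gbar gB ι gC b i x e v ν) (a : Model k)
    (ha : ∀ u : Model mB, met gbar (ι (b x)) a (dmap ι (b x) u) = 0)
    (ha' : met gbar (ι (b x)) a (dmap (orbitProj ξ) (i x) ν) = 0) : a = 0 := by
  obtain ⟨c, rfl⟩ : ∃ c : Model mN, dmap (orbitProj ξ) (i x) c = a :=
    h.hopf.fibration.submersion (i x) a
  have hv := dmap_orbitProj_vec h.hopf.sasakian.smooth_xi h.hopf.fibration.contMDiff (i x)
  have hm := h.hopf.fibration.met_dmap h.hopf.sasakian (i x)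
  rw [← h.hopf.comm] at ha ha'
  have e1 : c - form η (i x) c • vec ξ (i x) = 0 := by
    apply h.codim_one
    · intro u
      have h1 := ha (dmap b x u)
      rw [← h.hopf.dmap_comm, hm] at h1
      rw [map_sub, sub_apply, map_smul, smul_apply, smul_eq_mul, met_symm g (i x) (vec ξ (i x)),
        ← h.contactAlg.eta_eq]
      exact h1
    · rw [hm, h.form_normal] at ha'
      rw [map_sub, sub_apply, map_smul, smul_apply, smul_eq_mul, met_symm g (i x) (vec ξ (i x)),
        ← h.contactAlg.eta_eq, h.form_normal]
      exact ha'
  have e2 := congrArg (dmap (orbitProj ξ) (i x) : Model mN → Model k) e1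
  rw [map_sub, map_smul, hv, smul_zero, sub_zero, map_zero] at e2
  exact e2

/-- The second fundamental forms of a hypersurface and of its Hopf cylinder. -/
lemma sff_eq (h : IsHopfFrame φ η g gbar gB ι gC b i x e v ν) (u w : Model mC) :
    met gbar (ι (b x)) (sff gB gbar ι (b x) (dmap b x u) (dmap b x w)) (dmap (orbitProj ξ) (i x) ν)
      = met g (i x) (sff gC g i x u w) ν
        + form η (i x) (dmap i x u) * met g (i x) (endo φ (i x) (dmap i x w)) ν
        + form η (i x) (dmap i x w) * met g (i x) (endo φ (i x) (dmap i x u)) ν := by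
  have h1 := sff_comp gC g gbar h.hopf.fibration.contMDiff h.hopf.immersion.contMDiff x u w
  have h2 := sff_comp gC gB gbar h.hopf.hypersurface.contMDiff h.hopf.smooth_base x u w
  rw [← h.hopf.comp_eq, h1, h.hopf.fibration.sff_orbitProj h.hopf.sasakian] at h2
  have h3 := congrArg (fun a => met gbar (ι (b x)) a (dmap (orbitProj ξ) (i x) ν)) h2
  -- The term coming from `∇db` is tangent to the hypersurface of the orbit space, so it drops out
  -- when paired with the projected normal.
  have h4 : met gbar (ι (b x)) (dmap ι (b x) (sff gC gB b x u w)) (dmap (orbitProj ξ) (i x) ν) = 0 := by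
    obtain ⟨a, ha⟩ := h.hopf.dmap_base_surjective x (sff gC gB b x u w)
    rw [← ha, ← h.hopf.dmap_comm, ← h.hopf.comm, h.hopf.fibration.met_dmap h.hopf.sasakian,
      h.form_normal, met_symm, h.normal, mul_zero, sub_zero]
  simp only [map_add, add_apply] at h3
  rw [h4, zero_add] at h3
  rw [← h3, ← h.hopf.comm]
  simp only [h.hopf.fibration.met_dmap h.hopf.sasakian, h.form_normal, map_smul, smul_apply,
    smul_eq_mul]
  ring

end IsHopfFrame

end Hopf

/-! ### The squared norm of the second fundamental form in an orthonormal basis. -/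

section NormSq

variable {m k : ℕ} {M : Type*} [TopologicalSpace M]
  [ChartedSpace (EuclideanSpace ℝ (Fin m)) M] [IsManifold (𝓡 m) ∞ M]
  {N : Type*} [TopologicalSpace N]
  [ChartedSpace (EuclideanSpace ℝ (Fin k)) N] [IsManifold (𝓡 k) ∞ N]

/-- The norm of the second fundamental form in terms of an orthonormal basis. -/
lemma normSq_eq_sum (g : RiemMetric m M) (h : RiemMetric k N) {f : M → N}
    (hf : ContMDiff (𝓡 m) (𝓡 k) ∞ f) (x : M) {ι : Type*} [Fintype ι] [DecidableEq ι]
    (hι : Fintype.card ι = m) {e : ι → Model m} (he : IsOrtho g x e) :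
    normSqSecondFundamentalForm g h f x =
      ∑ i, ∑ j, met h (f x) (sff g h f x (e i) (e j)) (sff g h f x (e i) (e j)) := by
  have hb := isBilin_sff g h hf x
  have h0 : normSqSecondFundamentalForm g h f x = mtr g x fun u u' => mtr g x fun v v' =>
      met h (f x) (sff g h f x u v) (sff g h f x u' v') := rfl
  have h1 : ∀ u u', mtr g x (fun v v' => met h (f x) (sff g h f x u v) (sff g h f x u' v')) =
      ∑ j, met h (f x) (sff g h f x u (e j)) (sff g h f x u' (e j)) := fun u u' =>
    he.mtr_eq hι
      { add_left := fun _ _ _ => by simp [hb.add_right]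
        smul_left := fun _ _ _ => by simp [hb.smul_right]
        add_right := fun _ _ _ => by simp [hb.add_right]
        smul_right := fun _ _ _ => by simp [hb.smul_right] }
  rw [h0]
  simp only [h1]
  exact he.mtr_eq hι
      { add_left := fun _ _ _ => by simp [hb.add_left, Finset.sum_add_distrib]
        smul_left := fun _ _ _ => by simp [hb.smul_left, Finset.mul_sum]
        add_right := fun _ _ _ => by simp [hb.add_left, Finset.sum_add_distrib]
        smul_right := fun _ _ _ => by simp [hb.smul_left, Finset.mul_sum] }

end NormSq

/-! ### Tension and second fundamental form of a Hopf cylinder. -/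

section Hopf

variable {mN mC mB k : ℕ} {N : Type*} [TopologicalSpace N]
  [ChartedSpace (EuclideanSpace ℝ (Fin mN)) N] [IsManifold (𝓡 mN) ∞ N]
  {φ : (y : N) → TangentSpace (𝓡 mN) y →L[ℝ] TangentSpace (𝓡 mN) y}
  {ξ : (y : N) → TangentSpace (𝓡 mN) y} {η : (y : N) → TangentSpace (𝓡 mN) y →L[ℝ] ℝ}
  {g : RiemMetric mN N}
  [ChartedSpace (EuclideanSpace ℝ (Fin k)) (OrbitSpace ξ)] [IsManifold (𝓡 k) ∞ (OrbitSpace ξ)]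
  {gbar : RiemMetric k (OrbitSpace ξ)}
  {B : Type*} [TopologicalSpace B]
  [ChartedSpace (EuclideanSpace ℝ (Fin mB)) B] [IsManifold (𝓡 mB) ∞ B]
  {gB : RiemMetric mB B} {ι : B → OrbitSpace ξ}
  {C : Type*} [TopologicalSpace C]
  [ChartedSpace (EuclideanSpace ℝ (Fin mC)) C] [IsManifold (𝓡 mC) ∞ C]
  {gC : RiemMetric mC C} {b : C → B} {i : C → N}

namespace IsHopfFrame

variable {x : C} {e : Fin mB → Model mC} {v : Model mC} {ν : Model mN}

lemma sff_eq_smul (h : IsHopfFrame φ η g gbar gB ι gC b i x e v ν) (u w : Model mC) :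
    sff gC g i x u w = met g (i x) (sff gC g i x u w) ν • ν := by
  rw [← sub_eq_zero]
  apply h.codim_one
  · intro a
    rw [map_sub, sub_apply, met_sff_dmap h.hopf.immersion, map_smul, smul_apply, h.normal, smul_zero,
      sub_zero]
  · rw [map_sub, sub_apply, map_smul, smul_apply, h.met_normal, smul_eq_mul, mul_one, sub_self]

lemma met_normal_base (h : IsHopfFrame φ η g gbar gB ι gC b i x e v ν) :
    met gbar (ι (b x)) (dmap (orbitProj ξ) (i x) ν) (dmap (orbitProj ξ) (i x) ν) = 1 := by
  rw [← h.hopf.comm, h.hopf.fibration.met_dmap h.hopf.sasakian, h.met_normal, h.form_normal, mul_zero,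
    sub_zero]

lemma normal_base (h : IsHopfFrame φ η g gbar gB ι gC b i x e v ν) (w : Model mB) :
    met gbar (ι (b x)) (dmap (orbitProj ξ) (i x) ν) (dmap ι (b x) w) = 0 := by
  obtain ⟨u, rfl⟩ := h.hopf.dmap_base_surjective x w
  rw [← h.hopf.dmap_comm, ← h.hopf.comm, h.hopf.fibration.met_dmap h.hopf.sasakian, h.normal,
    h.form_normal, zero_mul, sub_zero]

lemma sff_base_eq_smul (h : IsHopfFrame φ η g gbar gB ι gC b i x e v ν) (u w : Model mB) :
    sff gB gbar ι (b x) u w = met gbar (ι (b x)) (sff gB gbar ι (b x) u w)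
      (dmap (orbitProj ξ) (i x) ν) • dmap (orbitProj ξ) (i x) ν := by
  rw [← sub_eq_zero]
  apply h.codim_one_base
  · intro a
    rw [map_sub, sub_apply, met_sff_dmap h.hopf.hypersurface, map_smul, smul_apply, h.normal_base,
      smul_zero, sub_zero]
  · rw [map_sub, sub_apply, map_smul, smul_apply, h.met_normal_base, smul_eq_mul, mul_one, sub_self]

lemma met_sff_base (h : IsHopfFrame φ η g gbar gB ι gC b i x e v ν) (j l : Fin mB) :
    met gbar (ι (b x)) (sff gB gbar ι (b x) (dmap b x (e j)) (dmap b x (e l)))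
      (dmap (orbitProj ξ) (i x) ν) = met g (i x) (sff gC g i x (e j) (e l)) ν := by
  rw [h.sff_eq, h.horizontal, h.horizontal, zero_mul, zero_mul, add_zero, add_zero]

/-- The Reeb direction projects to zero, so the left side of `sff_eq` vanishes; what is left comes
from `∇dπ(ξ, u) = dπ(φu)`. -/
lemma met_sff_vert (h : IsHopfFrame φ η g gbar gB ι gC b i x e v ν) (u : Model mC) :
    met g (i x) (sff gC g i x v u) ν = - met g (i x) (endo φ (i x) (dmap i x u)) ν := by
  have h1 := h.sff_eq v u
  have hb := isBilin_sff gB gbar h.hopf.hypersurface.contMDiff (b x)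
  have h2 : sff gB gbar ι (b x) 0 (dmap b x u) = 0 := by
    have := hb.smul_left 0 0 (dmap b x u)
    rwa [zero_smul, zero_smul] at this
  rw [h.dmap_base_vert, h2, h.dmap_vert, h.contactAlg.eta_xi, h.contactAlg.phi_xi] at h1
  have h3 : (0 : Model k →L[ℝ] ℝ) (dmap (orbitProj ξ) (i x) ν) = 0 := rfl
  have h4 : (0 : Model mN →L[ℝ] ℝ) ν = 0 := rfl
  rw [map_zero, map_zero, h3, h4] at h1
  linarith

lemma met_sff_vert_right (h : IsHopfFrame φ η g gbar gB ι gC b i x e v ν) (u : Model mC) :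
    met g (i x) (sff gC g i x u v) ν = - met g (i x) (endo φ (i x) (dmap i x u)) ν := by
  have h1 := h.sff_eq u v
  have hb := isBilin_sff gB gbar h.hopf.hypersurface.contMDiff (b x)
  have h2 : sff gB gbar ι (b x) (dmap b x u) 0 = 0 := by
    have := hb.smul_right 0 (dmap b x u) 0
    rwa [zero_smul, zero_smul] at this
  rw [h.dmap_base_vert, h2, h.dmap_vert, h.contactAlg.eta_xi, h.contactAlg.phi_xi] at h1
  have h3 : (0 : Model k →L[ℝ] ℝ) (dmap (orbitProj ξ) (i x) ν) = 0 := rfl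
  have h4 : (0 : Model mN →L[ℝ] ℝ) ν = 0 := rfl
  rw [map_zero, map_zero, h3, h4] at h1
  linarith

lemma met_sff_vert_vert (h : IsHopfFrame φ η g gbar gB ι gC b i x e v ν) :
    met g (i x) (sff gC g i x v v) ν = 0 := by
  rw [h.met_sff_vert, h.dmap_vert, h.contactAlg.phi_xi, map_zero]
  simp

lemma tens_eq (h : IsHopfFrame φ η g gbar gB ι gC b i x e v ν) :
    tens gC g i x = (∑ j, met g (i x) (sff gC g i x (e j) (e j)) ν) • ν := by
  rw [_root_.tens_eq, h.isOrtho_frame.mtr_eq h.card_frame (isBilin_sff gC g h.hopf.immersion.contMDiff x),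
    Fintype.sum_option, Finset.sum_smul]
  have h1 : sff gC g i x (frame e v none) (frame e v none) = 0 := by
    change sff gC g i x v v = 0
    rw [h.sff_eq_smul, h.met_sff_vert_vert, zero_smul]
  rw [h1, zero_add]
  exact Finset.sum_congr rfl fun j _ => h.sff_eq_smul _ _

lemma tens_base_eq (h : IsHopfFrame φ η g gbar gB ι gC b i x e v ν) :
    tens gB gbar ι (b x) = (∑ j, met g (i x) (sff gC g i x (e j) (e j)) ν) •
      dmap (orbitProj ξ) (i x) ν := by
  rw [_root_.tens_eq, h.ortho.mtr_eq (by simp) (isBilin_sff gB gbar h.hopf.hypersurface.contMDiff (b x)),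
    Finset.sum_smul]
  refine Finset.sum_congr rfl fun j _ => ?_
  rw [h.sff_base_eq_smul, h.met_sff_base]

/-- The Reeb direction is asymptotic, so both tension fields have the same coefficient along the
unit normals. Constant mean curvature thus passes to the cylinder. -/
lemma met_tens (h : IsHopfFrame φ η g gbar gB ι gC b i x e v ν) :
    met g (i x) (tens gC g i x) (tens gC g i x) =
      met gbar (ι (b x)) (tens gB gbar ι (b x)) (tens gB gbar ι (b x)) := by
  rw [h.tens_eq, h.tens_base_eq]
  simp only [map_smul, smul_apply, h.met_normal, h.met_normal_base]

lemma normSq_base (h : IsHopfFrame φ η g gbar gB ι gC b i x e v ν) :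
    normSqSecondFundamentalForm gB gbar ι (b x) =
      ∑ j, ∑ l, met g (i x) (sff gC g i x (e j) (e l)) ν ^ 2 := by
  rw [normSq_eq_sum gB gbar h.hopf.hypersurface.contMDiff (b x) (by simp) h.ortho]
  refine Finset.sum_congr rfl fun j _ => Finset.sum_congr rfl fun l _ => ?_
  rw [h.sff_base_eq_smul, h.met_sff_base]
  simp only [map_smul, smul_apply, h.met_normal_base, smul_eq_mul]
  ring

lemma sum_ambient (h : IsHopfFrame φ η g gbar gB ι gC b i x e v ν) (a c : Model mN) :
    met g (i x) a ν * met g (i x) c ν + (met g (i x) a (vec ξ (i x)) * met g (i x) c (vec ξ (i x))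
      + ∑ j, met g (i x) a (dmap i x (e j)) * met g (i x) c (dmap i x (e j))) = met g (i x) a c := by
  rw [← h.isOrtho_ambientFrame.sum_mul h.card_ambientFrame a c, Fintype.sum_option,
    Fintype.sum_option, ← h.dmap_vert]
  rfl

/-- The sum is `|φν|²`, because `φν` is orthogonal to both `ν` and `ξ`. -/
lemma sum_theta (h : IsHopfFrame φ η g gbar gB ι gC b i x e v ν) :
    ∑ j, met g (i x) (endo φ (i x) (dmap i x (e j))) ν ^ 2 = 1 := by
  have ha := h.contactAlg
  have h1 := h.sum_ambient (endo φ (i x) ν) (endo φ (i x) ν)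
  rw [← ha.eta_eq, ha.eta_phi, met_symm g (i x) _ ν, ha.met_phi_self, ha.phi_metric, h.met_normal,
    h.form_normal] at h1
  have h2 : ∀ j, met g (i x) (endo φ (i x) (dmap i x (e j))) ν ^ 2 =
      met g (i x) (endo φ (i x) ν) (dmap i x (e j)) * met g (i x) (endo φ (i x) ν) (dmap i x (e j)) := by
    intro j
    rw [ha.skew, met_symm g (i x) (dmap i x (e j))]
    ring
  simp only [h2]
  linarith

/-- The horizontal block is that of the base, the Reeb entry is zero, and each of the two mixed
blocks contributes `∑ ⟨φe_j, ν⟩² = 1`. -/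
lemma sum_sq_frame (h : IsHopfFrame φ η g gbar gB ι gC b i x e v ν) :
    ∑ j, ∑ l, met g (i x) (sff gC g i x (frame e v j) (frame e v l)) ν ^ 2 =
      normSqSecondFundamentalForm gB gbar ι (b x) + 2 := by
  rw [h.normSq_base]
  have hn : frame e v none = v := rfl
  have hs : ∀ j, frame e v (some j) = e j := fun j => rfl
  simp only [Fintype.sum_option, hn, hs, h.met_sff_vert_vert, Finset.sum_add_distrib]
  simp only [h.met_sff_vert, h.met_sff_vert_right, neg_sq, h.sum_theta]
  ring

end IsHopfFrame

/-! ### The curvature terms and the biharmonic equation of a Hopf cylinder. -/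

namespace IsHopfFrame

variable {x : C} {e : Fin mB → Model mC} {v : Model mC} {ν : Model mN}

lemma sum_curv (h : IsHopfFrame φ η g gbar gB ι gC b i x e v ν) {c : ℝ}
    (hc : HasPhiSectionalCurvature φ ξ g c) :
    ∑ j, curv g (i x) (dmap i x (frame e v j)) ν (dmap i x (frame e v j)) =
      - (((c + 3) * (mC : ℝ) + 2 * (c - 1)) / 4) • ν := by
  have ha := h.contactAlg
  have key : ∀ u : Model mC, curv g (i x) (dmap i x u) ν (dmap i x u) =
      - ((c + 3) / 4 * met gC x u u) • ν + ((c - 1) / 4) • ((form η (i x) (dmap i x u) ^ 2) • ν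
        + (3 * met g (i x) (dmap i x u) (endo φ (i x) ν)) • endo φ (i x) (dmap i x u)) := by
    intro u
    rw [h.hopf.sasakian.curv_eq hc, spaceFormCurv, met_symm g (i x) _ ν, h.normal, h.form_normal,
      ha.met_phi_self, met_dmap h.hopf.immersion]
    module
  simp only [key]
  have h1 : ∑ j, met gC x (frame e v j) (frame e v j) = mC := by
    simp [h.isOrtho_frame _ _, ← h.card_frame]
  have h2 : ∑ j, form η (i x) (dmap i x (frame e v j)) ^ 2 = 1 := by
    rw [Fintype.sum_option]
    simp [frame, h.horizontal, h.dmap_vert, ha.eta_xi]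
  -- The vector `φν` is tangent to the cylinder; applying `φ` to its expansion in the frame gives
  -- `φ²ν = -ν`.
  have h3 : ∑ j, met g (i x) (dmap i x (frame e v j)) (endo φ (i x) ν) •
      endo φ (i x) (dmap i x (frame e v j)) = - ν := by
    have h4 := h.isOrtho_ambientFrame.sum_eq h.card_ambientFrame (endo φ (i x) ν)
    have h5 := congrArg (endo φ (i x)) h4
    rw [ha.phi_sq, h.form_normal, zero_smul, add_zero, Fintype.sum_option] at h5
    have h6 : ambientFrame i x e v ν none = ν := rfl
    rw [h6, met_symm, ha.met_phi_self, zero_smul, zero_add, map_sum] at h5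
    rw [h5]
    refine Finset.sum_congr rfl fun j _ => ?_
    rw [map_smul, met_symm]
    rfl
  simp only [Finset.sum_add_distrib, ← Finset.smul_sum, ← Finset.sum_smul, mul_smul, neg_smul,
    Finset.sum_neg_distrib, h1, h2, h3]
  module

/-- Only the `φ`-terms of the curvature contribute. They sum to multiples of the inner product of
`φν` with the tangential part of `φw`, which is `⟨φν, φw⟩ = ⟨ν, w⟩ = 0` since `φν` is tangent. -/
lemma sum_curv_tangent (h : IsHopfFrame φ η g gbar gB ι gC b i x e v ν) {c : ℝ}
    (hc : HasPhiSectionalCurvature φ ξ g c) (w : Model mC) :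
    ∑ j, met g (i x) (curv g (i x) (dmap i x (frame e v j)) (dmap i x w) ν) (dmap i x (frame e v j))
      = 0 := by
  have ha := h.contactAlg
  have hsk : ∀ a c, met g (i x) a (endo φ (i x) c) = - met g (i x) c (endo φ (i x) a) :=
    fun a c => by rw [← ha.skew, met_symm]
  have key : ∀ u : Model mC, met g (i x) (curv g (i x) (dmap i x u) (dmap i x w) ν) (dmap i x u) =
      ((c - 1) / 4) * (met g (i x) (endo φ (i x) ν) (dmap i x u)
          * met g (i x) (endo φ (i x) (dmap i x w)) (dmap i x u)
        + 2 * (met g (i x) (endo φ (i x) (dmap i x w)) (dmap i x u)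
          * met g (i x) (endo φ (i x) ν) (dmap i x u))) := by
    intro u
    rw [h.hopf.sasakian.curv_eq hc, spaceFormCurv, h.normal, h.normal, h.form_normal,
      hsk ν (dmap i x u)]
    simp only [map_add, map_sub, map_smul, map_neg, add_apply, sub_apply, smul_apply, smul_eq_mul,
      neg_apply]
    rw [met_symm g (i x) (endo φ (i x) (dmap i x u)), ha.met_phi_self,
      met_symm g (i x) (dmap i x u) (endo φ (i x) ν),
      met_symm g (i x) (dmap i x u) (endo φ (i x) (dmap i x w))]
    ring
  have h1 := h.sum_ambient (endo φ (i x) ν) (endo φ (i x) (dmap i x w))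
  rw [ha.phi_metric, h.form_normal, h.normal, met_symm g (i x) _ ν, ha.met_phi_self, ← h.dmap_vert] at h1
  have h2 : ∑ j, met g (i x) (endo φ (i x) ν) (dmap i x (frame e v j))
      * met g (i x) (endo φ (i x) (dmap i x w)) (dmap i x (frame e v j)) = 0 := by
    rw [Fintype.sum_option]
    simp only [frame, Option.elim]
    linarith
  simp only [key, ← Finset.mul_sum, Finset.sum_add_distrib, h2]
  simp only [mul_comm (met g (i x) (endo φ (i x) (dmap i x w)) _), h2]
  ring

/-- The bitension field of a Hopf cylinder over a hypersurface of constant mean curvature. -/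
theorem bitens_eq_zero_iff (h : IsHopfFrame φ η g gbar gB ι gC b i x e v ν) {c : ℝ}
    (hc : HasPhiSectionalCurvature φ ξ g c) {A : ℝ} (hA : A ≠ 0)
    (hτ : ∀ y, met g (i y) (tens gC g i y) (tens gC g i y) = A) :
    bitens gC g i x = 0 ↔ normSqSecondFundamentalForm gB gbar ι (b x) + 2
      = ((c + 3) * (mC : ℝ) + 2 * (c - 1)) / 4 := by
  set t := ∑ j, met g (i x) (sff gC g i x (e j) (e j)) ν with ht
  have htens : tens gC g i x = t • ν := h.tens_eq
  have htA : t ^ 2 = A := by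
    rw [← hτ x, htens]
    simp only [map_smul, smul_apply, h.met_normal, smul_eq_mul]
    ring
  have ht0 : t ≠ 0 := fun h0 => hA (by rw [← htA, h0]; ring)
  have h1 := _root_.bitens_eq_zero_iff h.hopf.immersion hA hτ x
    (fun a h1 h2 => h.codim_one a h1 (by
      rw [htens, map_smul, smul_eq_mul] at h2
      exact (mul_eq_zero.1 h2).resolve_left ht0)) h.card_frame h.isOrtho_frame
    (l := ((c + 3) * (mC : ℝ) + 2 * (c - 1)) / 4) (by
      have h2 : ∀ u : Model mN, curv g (i x) u (t • ν) u = t • curv g (i x) u ν u := by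
        intro u
        simp only [curv_crd, crdCurv, map_smul, smul_apply, smul_sub, smul_add]
      rw [htens]
      simp only [h2]
      rw [← Finset.smul_sum, h.sum_curv hc, smul_comm]) (by
      intro w
      have h2 : ∀ u : Model mN, met g (i x) (curv g (i x) u (dmap i x w) (t • ν)) u
          = t * met g (i x) (curv g (i x) u (dmap i x w) ν) u := by
        intro u
        simp only [curv_crd, crdCurv, map_smul, smul_apply, ← smul_sub, ← smul_add, smul_eq_mul]
      rw [htens]
      simp only [h2]
      rw [← Finset.mul_sum, h.sum_curv_tangent hc, mul_zero])
  -- With `τ = t ν`, both sides of the scalar equation carry the factor `t²`, which is nonzero and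
  -- cancels.
  rw [h1, ← h.sum_sq_frame, htens, ← htA]
  have h3 : ∀ j l, met g (i x) (sff gC g i x (frame e v j) (frame e v l)) (t • ν) ^ 2
      = t ^ 2 * met g (i x) (sff gC g i x (frame e v j) (frame e v l)) ν ^ 2 := by
    intro j l
    rw [map_smul, smul_eq_mul]
    ring
  simp only [h3, ← Finset.mul_sum]
  rw [mul_comm (_ / 4)]
  exact mul_right_inj' (pow_ne_zero 2 ht0)

end IsHopfFrame

end Hopf

/-! ### From mean curvature to tension, and the main theorem. -/

section CMC

variable {m k : ℕ} {M : Type*} [TopologicalSpace M]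
  [ChartedSpace (EuclideanSpace ℝ (Fin m)) M] [IsManifold (𝓡 m) ∞ M]
  {N : Type*} [TopologicalSpace N]
  [ChartedSpace (EuclideanSpace ℝ (Fin k)) N] [IsManifold (𝓡 k) ∞ N]

/-- The length of the tension field in terms of the mean curvature. -/
lemma met_tens_of_meanCurvature (g : RiemMetric m M) (h : RiemMetric k N) (f : M → N) (x : M)
    (hm : m ≠ 0) {a : ℝ} (ha : a ≠ 0) (hH : meanCurvature g h f x = a) :
    met h (f x) (tens g h f x) (tens g h f x) = (m * a) ^ 2 := by
  have h1 : Real.sqrt (met h (f x) ((1 / (m : ℝ)) • tens g h f x) ((1 / (m : ℝ)) • tens g h f x))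
    = a := hH
  -- `Real.sqrt` is zero on negative numbers, so the nonzero value `a` forces its argument to be
  -- nonnegative.
  have h2 : 0 ≤ met h (f x) ((1 / (m : ℝ)) • tens g h f x) ((1 / (m : ℝ)) • tens g h f x) := by
    by_contra hneg
    exact ha (h1.symm.trans (Real.sqrt_eq_zero_of_nonpos (not_le.1 hneg).le))
  have h3 := Real.sq_sqrt h2
  have hm' : (m : ℝ) ≠ 0 := Nat.cast_ne_zero.2 hm
  rw [h1] at h3
  simp only [map_smul, smul_apply, smul_eq_mul] at h3
  rw [mul_pow, h3]
  field_simp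

end CMC

/-- The smooth structure of the fibre product is arbitrary, subject to smoothness of the base
projection and to the inclusion being an isometric immersion. These, with the dimensions, suffice to
build adapted frames. -/
theorem mainTheorem9 (n : ℕ) (hn : 1 ≤ n) (c : ℝ)
    -- the strictly regular Sasakian space form `N(c)` of dimension `2n+1`
    {N : Type*} [TopologicalSpace N] [T2Space N]
    [ChartedSpace (EuclideanSpace ℝ (Fin (2 * n + 1))) N] [IsManifold (𝓡 (2 * n + 1)) ∞ N]
    (φ : (y : N) → TangentSpace (𝓡 (2 * n + 1)) y →L[ℝ] TangentSpace (𝓡 (2 * n + 1)) y)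
    (ξ : (y : N) → TangentSpace (𝓡 (2 * n + 1)) y)
    (η : (y : N) → TangentSpace (𝓡 (2 * n + 1)) y →L[ℝ] ℝ)
    (g : RiemMetric (2 * n + 1) N)
    (hS : IsSasakian φ ξ η g) (hc : HasPhiSectionalCurvature φ ξ g c)
    (hreg : IsStrictlyRegularField ξ)
    -- the natural manifold structure and metric of the orbit space
    [T2Space (OrbitSpace ξ)] [ChartedSpace (EuclideanSpace ℝ (Fin (2 * n))) (OrbitSpace ξ)]
    [IsManifold (𝓡 (2 * n)) ∞ (OrbitSpace ξ)]
    (gbar : RiemMetric (2 * n) (OrbitSpace ξ)) (hπ : IsBoothbyWang ξ η g gbar)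
    -- the hypersurface of the orbit space, with its induced metric
    {Mbar : Type*} [TopologicalSpace Mbar] [T2Space Mbar] [Nonempty Mbar]
    [ChartedSpace (EuclideanSpace ℝ (Fin (2 * n - 1))) Mbar]
    [IsManifold (𝓡 (2 * n - 1)) ∞ Mbar]
    (gM : RiemMetric (2 * n - 1) Mbar) (ι : Mbar → OrbitSpace ξ)
    (hι : IsIsometricImmersion gM gbar ι)
    -- its mean curvature is a nonzero constant
    (H₀ : ℝ) (hH₀ : H₀ ≠ 0) (hH : ∀ y : Mbar, meanCurvature gM gbar ι y = H₀)
    -- the Hopf cylinder, as an immersed submanifold of `N` with its induced metric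
    [ChartedSpace (EuclideanSpace ℝ (Fin (2 * n))) (HopfCylinder ξ ι)]
    [IsManifold (𝓡 (2 * n)) ∞ (HopfCylinder ξ ι)]
    (hbase : ContMDiff (𝓡 (2 * n)) (𝓡 (2 * n - 1)) ∞ (HopfCylinder.base ξ ι))
    (gC : RiemMetric (2 * n) (HopfCylinder ξ ι))
    (hincl : IsIsometricImmersion gC g (HopfCylinder.incl ξ ι)) :
    IsProperBiharmonic gC g (HopfCylinder.incl ξ ι) ↔
      ∀ y : Mbar, normSqSecondFundamentalForm gM gbar ι y
        = (c * ((n : ℝ) + 1) + 3 * (n : ℝ) - 5) / 2 := by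
  have hHopf : IsHopf φ η g gbar gM ι gC (HopfCylinder.base ξ ι) (HopfCylinder.incl ξ ι) :=
    ⟨hS, hπ, hι, hincl, hbase, fun x => x.2, by omega, by omega⟩
  have hA0 : (((2 * n - 1 : ℕ) : ℝ) * H₀) ^ 2 ≠ 0 :=
    pow_ne_zero 2 (mul_ne_zero (Nat.cast_ne_zero.2 (by omega)) hH₀)
  have hτ : ∀ x, met g (HopfCylinder.incl ξ ι x) (tens gC g (HopfCylinder.incl ξ ι) x)
      (tens gC g (HopfCylinder.incl ξ ι) x) = (((2 * n - 1 : ℕ) : ℝ) * H₀) ^ 2 := by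
    intro x
    obtain ⟨e, v, ν, h⟩ := hHopf.exists_frame x
    rw [h.met_tens]
    exact met_tens_of_meanCurvature gM gbar ι _ (by omega) hH₀ (hH _)
  -- Orbits are nonempty, so every point of the base has a point of the cylinder above it; this
  -- transfers the pointwise condition to all of `Mbar`.
  have hsurj : Function.Surjective (HopfCylinder.base ξ ι) := by
    intro y
    obtain ⟨p, hp⟩ := Quotient.exists_rep (ι y)
    exact ⟨⟨(p, y), hp⟩, rfl⟩
  have key : ∀ x, bitensionField gC g (HopfCylinder.incl ξ ι) x = 0 ↔
      normSqSecondFundamentalForm gM gbar ι (HopfCylinder.base ξ ι x)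
        = (c * ((n : ℝ) + 1) + 3 * (n : ℝ) - 5) / 2 := by
    intro x
    obtain ⟨e, v, ν, h⟩ := hHopf.exists_frame x
    refine (h.bitens_eq_zero_iff hc hA0 hτ).trans ?_
    rw [← eq_sub_iff_add_eq]
    -- The subtracted `2` is the contribution of the two mixed blocks, and `2 * n` is the dimension
    -- of the cylinder.
    have : ((c + 3) * ((2 * n : ℕ) : ℝ) + 2 * (c - 1)) / 4 - 2
        = (c * ((n : ℝ) + 1) + 3 * (n : ℝ) - 5) / 2 := by
      push_cast
      ring
    rw [this]
  constructor
  · rintro ⟨hb, -⟩ y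
    obtain ⟨x, rfl⟩ := hsurj y
    exact (key x).1 (hb x)
  · intro h
    refine ⟨fun x => (key x).2 (h _), fun hharm => ?_⟩
    -- Harmonicity would hold vacuously on an empty cylinder; since `Mbar` is nonempty, there is a
    -- point at which `|τ|²` is a nonzero constant.
    obtain ⟨x, -⟩ := hsurj (Classical.arbitrary Mbar)
    have h0 : tens gC g (HopfCylinder.incl ξ ι) x = 0 := hharm x
    have h1 := hτ x
    rw [h0, map_zero] at h1
    exact hA0 h1.symm
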